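/- Let $Q=(Q^0,Q^1,r,s)$ be a countable oriented graph and $1\le p<\infty$. A vertex is a sink if it emits no edge, an infinite emitter if it emits infinitely many edges, singular if it is one of these and regular otherwise, and a source if it receives no edge. Let $L_Q$ be the Leavitt path $\mathbb C$-algebra of $Q$: the (not necessarily unital) algebra generated by $Q^0\cup Q^1\cup (Q^1)^*$ subject to $vv'=\delta_{v,v'}v$, $s(e)e=er(e)=e$, $r(e)e^*=e^*s(e)=e^*$, $e^*e'=\delta_{e,e'}r(e)$, and $v=\sum_{s(e)=v}ee^*$ for $v$ regular. For a $\sigma$-finite measure space $X$, a spatial partial isometry of $L^p(X)$ is an operator $\iota_B u\pi_A$, where $\pi_A:L^p(X)\to L^p(A)$ is the restriction, $\iota_B:L^p(B)\to L^p(X)$ the extension by zero, and $u:L^p(A)\to L^p(B)$ an isometric isomorphism of the form $u(\xi)=h\,\bigl(dS_*(\mu|_A)/d\mu|_B\bigr)^{1/p}S_*(\xi)$ with $|h|=1$ a.e. and $S$ an isomorphism from the $\sigma$-algebra of measurable subsets of $A$ modulo null sets to that of $B$; its reverse is $\iota_A u^{-1}\pi_B$. A homomorphism $\rho:L_Q\to\mathcal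 L(L^p(X))$ is spatial if each $\rho(v)$, $v\in Q^0$, is an idempotent spatial partial isometry, and each $\rho(e)$, $e\in Q^1$, is a spatial partial isometry with reverse $\rho(e^*)$. A spatial $p$-seminorm on $L_Q$ is a function $a\mapsto\|\rho(a)\|$ with $\rho$ a spatial representation of $L_Q$ on $L^p(X)$ for some $\sigma$-finite $X$; write $\mathrm{S}_p(Q)$ for the set of all of them. $\mathcal O^p(Q)$ is the Banach algebra obtained by completing $L_Q$ with respect to $\|a\|=\sup\{h(a):h\in \mathrm{S}_p(Q)\}$. The desingularization $Q_d$ is obtained by adding at each singular vertex $v$ an infinite tail $v=v_0\xrightarrow{f_1}v_1\xrightarrow{f_2}v_2\to\cdots$ and, at each infinite emitter $v$, after numbering $s^{-1}(v)=\{e_1,e_2,\dots\}$ in any way, replacing the edges $e_i$ by edges $g_i:v_i\to r(e_i)$ $(i\ge1)$. Let $\phi_d:L_Q\to L_{Q_d}$ be the homomorphism with $\phi_d(v)=v$; $\phi_d(e)=e$ and $\phi_d(e^*)=e^*$ if $s(e)$ is regular; and $\phi_d(e_i)=f_1\cdots f_ig_i$, $\phi_d(e_i^*)=g_i^*f_i^*\cdots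 f_1^*$ for the edges emitted by an infinite emitter. The source-free graph $Q_o$ is obtained by adding at each source $w$ an infinite head $w=w_0\xleftarrow{f_1}w_1\xleftarrow{f_2}w_2\leftarrow\cdots$, and $\phi_o:L_Q\to L_{Q_o}$ is induced by the inclusion $Q\subset Q_o$. Then for $\#\in\{d,o\}$: 1. $h\mapsto h\circ\phi_\#$ maps $\mathrm{S}_p(Q_\#)$ into, and onto, $\mathrm{S}_p(Q)$; that is, $\{h\circ\phi_\#: h\in \mathrm{S}_p(Q_\#)\}=\mathrm{S}_p(Q)$. 2. $\phi_\#$ induces an isometric homomorphism $\mathcal O^p(Q)\to\mathcal O^p(Q_\#)$: there is an isometric algebra homomorphism $\Phi:\mathcal O^p(Q)\to\mathcal O^p(Q_\#)$ that agrees with $\phi_\#$ on the image of $L_Q$. -/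

import Mathlib

universe u

/-- An oriented graph with vertex set `V`, edge set `E`, range map `r` and source map `s`. -/
structure OrientedGraph (V E : Type u) where
  r : E → V
  s : E → V

namespace OrientedGraph

section Graphs

variable {V E : Type u} (Q : OrientedGraph V E)

/-- A vertex that emits no edge. -/
def IsSink (v : V) : Prop := {e | Q.s e = v} = ∅

/-- A vertex that emits infinitely many edges. -/
def IsInfiniteEmitter (v : V) : Prop := {e | Q.s e = v}.Infinite

/-- A singular vertex: a sink or an infinite emitter. -/
def IsSingular (v : V) : Prop := Q.IsSink v ∨ Q.IsInfiniteEmitter v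

/-- A regular vertex: one that is not singular. -/
def IsRegular (v : V) : Prop := ¬ Q.IsSingular v

/-- A source: a vertex that receives no edge. -/
def IsSource (v : V) : Prop := {e | Q.r e = v} = ∅

variable {Q} in
theorem IsInfiniteEmitter.isSingular {v : V} (h : Q.IsInfiniteEmitter v) : Q.IsSingular v :=
  Or.inr h

variable {Q} in
theorem IsRegular.finite {v : V} (h : Q.IsRegular v) : {e | Q.s e = v}.Finite := by
  by_contra hf
  exact h (Or.inr hf)

variable {Q} in
theorem isInfiniteEmitter_of_not_isRegular {e : E} (h : ¬ Q.IsRegular (Q.s e)) :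
    Q.IsInfiniteEmitter (Q.s e) := by
  rcases not_not.mp h with h | h
  · exact absurd (show e ∈ {e' | Q.s e' = Q.s e} from rfl) (by rw [h]; simp)
  · exact h

/-- A numbering `e₁, e₂, …` of the edges emitted by each infinite emitter; the value at `n : ℕ` is the
edge `e_{n+1}`. -/
def EmitterNumbering : Type u :=
  ∀ v : V, Q.IsInfiniteEmitter v → (ℕ ≃ {e : E // Q.s e = v})

/-- Vertices of the desingularization: those of `Q`, and for every singular vertex `v` the vertices
`v₁, v₂, …` of an infinite tail; `tail v hv n` is `v_{n+1}`. -/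
inductive DesingVertex : Type u
  | base (v : V)
  | tail (v : V) (hv : Q.IsSingular v) (n : ℕ)

/-- Edges of the desingularization: the edges of `Q` emitted by regular vertices; the edges
`f_{n+1} : v_n → v_{n+1}` of the tail at a singular vertex `v` (`tail v hv n`); and the edges
`g_{n+1} : v_{n+1} → r(e_{n+1})` at an infinite emitter `v` (`exit v hv n`). -/
inductive DesingEdge : Type u
  | base (e : E) (he : Q.IsRegular (Q.s e))
  | tail (v : V) (hv : Q.IsSingular v) (n : ℕ)
  | exit (v : V) (hv : Q.IsInfiniteEmitter v) (n : ℕ)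

/-- The vertex `v_n` of the tail at a singular vertex `v`, with `v₀ = v`. -/
def tailVertex (v : V) (hv : Q.IsSingular v) : ℕ → Q.DesingVertex
  | 0 => .base v
  | n + 1 => .tail v hv n

/-- The desingularization of `Q` (for a given numbering of the edges of infinite emitters). -/
def desing (num : Q.EmitterNumbering) : OrientedGraph Q.DesingVertex Q.DesingEdge where
  s
    | .base e _ => .base (Q.s e)
    | .tail v hv n => Q.tailVertex v hv n
    | .exit v hv n => Q.tailVertex v hv.isSingular (n + 1)
  r
    | .base e _ => .base (Q.r e)
    | .tail v hv n => Q.tailVertex v hv (n + 1)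
    | .exit v hv n => .base (Q.r (num v hv n).1)

/-- Vertices of the source-free graph: those of `Q`, and for every source `w` the vertices
`w₁, w₂, …` of an infinite head; `head w hw n` is `w_{n+1}`. -/
inductive HeadVertex : Type u
  | base (v : V)
  | head (w : V) (hw : Q.IsSource w) (n : ℕ)

/-- Edges of the source-free graph: those of `Q`, and for every source `w` the edges
`f_{n+1} : w_{n+1} → w_n` of an infinite head (`head w hw n`). -/
inductive HeadEdge : Type u
  | base (e : E)
  | head (w : V) (hw : Q.IsSource w) (n : ℕ)

/-- The vertex `w_n` of the head at a source `w`, with `w₀ = w`. -/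
def headVertex (w : V) (hw : Q.IsSource w) : ℕ → Q.HeadVertex
  | 0 => .base w
  | n + 1 => .head w hw n

/-- The source-free graph obtained from `Q` by adding an infinite head at every source. -/
def sourceFree : OrientedGraph Q.HeadVertex Q.HeadEdge where
  s
    | .base e => .base (Q.s e)
    | .head w hw n => Q.headVertex w hw (n + 1)
  r
    | .base e => .base (Q.r e)
    | .head w hw n => Q.headVertex w hw n

end Graphs

/-! ### The Leavitt path algebra -/

section Leavitt

variable {V E : Type u} (Q : OrientedGraph V E)

/-- The generators `Q⁰ ⊔ Q¹ ⊔ (Q¹)*`. -/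
inductive Gen (V E : Type u) : Type u
  | vert (v : V)
  | edge (e : E)
  | ghost (e : E)

/-- The free (associative, non-unital) complex algebra on the generators. -/
abbrev FreeAlg (V E : Type u) : Type u := MonoidAlgebra ℂ (FreeSemigroup (Gen V E))

/-- A generator, as an element of the free algebra. -/
noncomputable def FreeAlg.of {V E : Type u} (x : Gen V E) : FreeAlg V E :=
  MonoidAlgebra.single (FreeSemigroup.of x) 1

open Gen FreeAlg in
/-- The defining relations of the Leavitt path algebra. -/
inductive LeavittRel : FreeAlg V E → FreeAlg V E → Prop
  | vert_mul_self (v : V) : LeavittRel (of (vert v) * of (vert v)) (of (vert v))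
  | vert_mul_ne (v w : V) (h : v ≠ w) : LeavittRel (of (vert v) * of (vert w)) 0
  | source_mul_edge (e : E) : LeavittRel (of (vert (Q.s e)) * of (edge e)) (of (edge e))
  | edge_mul_range (e : E) : LeavittRel (of (edge e) * of (vert (Q.r e))) (of (edge e))
  | range_mul_ghost (e : E) : LeavittRel (of (vert (Q.r e)) * of (ghost e)) (of (ghost e))
  | ghost_mul_source (e : E) : LeavittRel (of (ghost e) * of (vert (Q.s e))) (of (ghost e))
  | ck1_self (e : E) : LeavittRel (of (ghost e) * of (edge e)) (of (vert (Q.r e)))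
  | ck1_ne (e e' : E) (h : e ≠ e') : LeavittRel (of (ghost e) * of (edge e')) 0
  | ck2 (v : V) (hv : Q.IsRegular v) :
      LeavittRel (of (vert v)) (∑ e ∈ hv.finite.toFinset, of (edge e) * of (ghost e))

/-- The congruence generated by the defining relations. As the free algebra has no unit, scalar
multiples of the relations are listed explicitly, so that the congruence is `ℂ`-linear. -/
noncomputable def leavittCon : RingCon (FreeAlg V E) :=
  ringConGen fun a b => ∃ (c : ℂ) (x y : FreeAlg V E), Q.LeavittRel x y ∧ a = c • x ∧ b = c • y

theorem leavittCon_smul (c : ℂ) {a b : FreeAlg V E} (h : Q.leavittCon a b) :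
    Q.leavittCon (c • a) (c • b) := by
  induction h with
  | of x y h =>
    obtain ⟨d, x', y', hxy, rfl, rfl⟩ := h
    exact RingConGen.Rel.of _ _ ⟨c * d, x', y', hxy, smul_smul c d x', smul_smul c d y'⟩
  | refl x => exact RingConGen.Rel.refl _
  | symm _ ih => exact RingConGen.Rel.symm ih
  | trans _ _ ih1 ih2 => exact RingConGen.Rel.trans ih1 ih2
  | add _ _ ih1 ih2 => rw [smul_add, smul_add]; exact RingConGen.Rel.add ih1 ih2
  | mul _ h2 ih1 _ =>
    rw [← smul_mul_assoc, ← smul_mul_assoc]; exact RingConGen.Rel.mul ih1 h2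

/-- The Leavitt path `ℂ`-algebra `L_Q`. -/
def Leavitt : Type u := Q.leavittCon.Quotient

namespace Leavitt

noncomputable instance : NonUnitalRing Q.Leavitt :=
  inferInstanceAs (NonUnitalRing Q.leavittCon.Quotient)

variable {Q}

/-- The quotient map from the free algebra. -/
noncomputable def mk (a : FreeAlg V E) : Q.Leavitt := Q.leavittCon.toQuotient a

theorem mk_surjective : Function.Surjective (mk : FreeAlg V E → Q.Leavitt) :=
  Quotient.mk''_surjective

theorem mk_eq {a b : FreeAlg V E} : (mk a : Q.Leavitt) = mk b ↔ Q.leavittCon a b :=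
  Q.leavittCon.eq

theorem mk_mul (a b : FreeAlg V E) : (mk (a * b) : Q.Leavitt) = mk a * mk b := rfl

theorem mk_add (a b : FreeAlg V E) : (mk (a + b) : Q.Leavitt) = mk a + mk b := rfl

theorem mk_zero : (mk 0 : Q.Leavitt) = 0 := rfl

/-- `mk` as an additive homomorphism. -/
noncomputable def mkAdd : FreeAlg V E →+ Q.Leavitt where
  toFun := mk
  map_zero' := mk_zero
  map_add' := mk_add

noncomputable instance : SMul ℂ Q.Leavitt :=
  ⟨fun c => Quotient.map' (c • ·) fun _ _ h => Q.leavittCon_smul c h⟩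

theorem mk_smul (c : ℂ) (a : FreeAlg V E) : (mk (c • a) : Q.Leavitt) = c • mk a := rfl

noncomputable instance : Module ℂ Q.Leavitt :=
  Function.Surjective.module ℂ mkAdd mk_surjective mk_smul

instance : IsScalarTower ℂ Q.Leavitt Q.Leavitt where
  smul_assoc c x y := by
    obtain ⟨a, rfl⟩ := mk_surjective x
    obtain ⟨b, rfl⟩ := mk_surjective y
    rw [smul_eq_mul, smul_eq_mul, ← mk_smul, ← mk_mul, ← mk_mul, ← mk_smul, smul_mul_assoc]

instance : SMulCommClass ℂ Q.Leavitt Q.Leavitt where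
  smul_comm c x y := by
    obtain ⟨a, rfl⟩ := mk_surjective x
    obtain ⟨b, rfl⟩ := mk_surjective y
    rw [smul_eq_mul, smul_eq_mul, ← mk_smul, ← mk_mul, ← mk_mul, ← mk_smul, mul_smul_comm]

variable (Q) in
/-- The element `v` of `L_Q`. -/
noncomputable def vert (v : V) : Q.Leavitt := mk (FreeAlg.of (.vert v))

variable (Q) in
/-- The element `e` of `L_Q`. -/
noncomputable def edge (e : E) : Q.Leavitt := mk (FreeAlg.of (.edge e))

variable (Q) in
/-- The element `e*` of `L_Q`. -/
noncomputable def ghost (e : E) : Q.Leavitt := mk (FreeAlg.of (.ghost e))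

end Leavitt

/-- Families of elements of an algebra that satisfy the defining relations of `L_Q`. -/
structure IsLeavittFamily {A : Type*} [NonUnitalRing A] (P : V → A) (S T : E → A) : Prop where
  vert_mul_self (v : V) : P v * P v = P v
  vert_mul_ne (v w : V) (h : v ≠ w) : P v * P w = 0
  source_mul_edge (e : E) : P (Q.s e) * S e = S e
  edge_mul_range (e : E) : S e * P (Q.r e) = S e
  range_mul_ghost (e : E) : P (Q.r e) * T e = T e
  ghost_mul_source (e : E) : T e * P (Q.s e) = T e
  ck1_self (e : E) : T e * S e = P (Q.r e)
  ck1_ne (e e' : E) (h : e ≠ e') : T e * S e' = 0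
  ck2 (v : V) (hv : Q.IsRegular v) : P v = ∑ e ∈ hv.finite.toFinset, S e * T e

namespace Leavitt

theorem mk_eq_of_rel {a b : FreeAlg V E} (h : Q.LeavittRel a b) : (mk a : Q.Leavitt) = mk b :=
  mk_eq.mpr (RingConGen.Rel.of _ _ ⟨1, a, b, h, (one_smul _ _).symm, (one_smul _ _).symm⟩)

theorem isLeavittFamily : Q.IsLeavittFamily (vert Q) (edge Q) (ghost Q) where
  vert_mul_self v := mk_eq_of_rel Q (.vert_mul_self v)
  vert_mul_ne v w h := mk_eq_of_rel Q (.vert_mul_ne v w h)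
  source_mul_edge e := mk_eq_of_rel Q (.source_mul_edge e)
  edge_mul_range e := mk_eq_of_rel Q (.edge_mul_range e)
  range_mul_ghost e := mk_eq_of_rel Q (.range_mul_ghost e)
  ghost_mul_source e := mk_eq_of_rel Q (.ghost_mul_source e)
  ck1_self e := mk_eq_of_rel Q (.ck1_self e)
  ck1_ne e e' h := mk_eq_of_rel Q (.ck1_ne e e' h)
  ck2 v hv := (mk_eq_of_rel Q (.ck2 v hv)).trans
    (map_sum (mkAdd (Q := Q)) (fun e => FreeAlg.of (.edge e) * FreeAlg.of (.ghost e)) _)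

variable {Q} {A : Type*} [NonUnitalRing A] [Module ℂ A] [IsScalarTower ℂ A A]
  [SMulCommClass ℂ A A]

/-- The homomorphism from the free algebra determined by the values on generators. -/
noncomputable def freeLift (P : V → A) (S T : E → A) : FreeAlg V E →ₙₐ[ℂ] A :=
  MonoidAlgebra.liftMagma ℂ (FreeSemigroup.lift fun x => match x with
    | .vert v => P v
    | .edge e => S e
    | .ghost e => T e)

theorem freeLift_vert (P : V → A) (S T : E → A) (v : V) :
    freeLift P S T (FreeAlg.of (.vert v)) = P v := by
  simp [freeLift, FreeAlg.of]

theorem freeLift_edge (P : V → A) (S T : E → A) (e : E) :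
    freeLift P S T (FreeAlg.of (.edge e)) = S e := by
  simp [freeLift, FreeAlg.of]

theorem freeLift_ghost (P : V → A) (S T : E → A) (e : E) :
    freeLift P S T (FreeAlg.of (.ghost e)) = T e := by
  simp [freeLift, FreeAlg.of]

theorem freeLift_eq {P : V → A} {S T : E → A} (h : Q.IsLeavittFamily P S T) {a b : FreeAlg V E}
    (hab : Q.leavittCon a b) : freeLift P S T a = freeLift P S T b := by
  induction hab with
  | of x y hxy =>
    obtain ⟨c, x, y, hxy, rfl, rfl⟩ := hxy
    rw [map_smul, map_smul]
    congr 1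
    cases hxy <;>
      simp only [map_mul, map_zero, map_sum, freeLift_vert, freeLift_edge, freeLift_ghost]
    · exact h.vert_mul_self _
    · exact h.vert_mul_ne _ _ ‹_›
    · exact h.source_mul_edge _
    · exact h.edge_mul_range _
    · exact h.range_mul_ghost _
    · exact h.ghost_mul_source _
    · exact h.ck1_self _
    · exact h.ck1_ne _ _ ‹_›
    · exact h.ck2 _ ‹_›
  | refl x => rfl
  | symm _ ih => exact ih.symm
  | trans _ _ ih1 ih2 => exact ih1.trans ih2
  | add _ _ ih1 ih2 => rw [map_add, map_add, ih1, ih2]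
  | mul _ _ ih1 ih2 => rw [map_mul, map_mul, ih1, ih2]

/-- The universal property of `L_Q`. -/
noncomputable def lift {P : V → A} {S T : E → A} (h : Q.IsLeavittFamily P S T) :
    Q.Leavitt →ₙₐ[ℂ] A where
  toFun := Quotient.lift (freeLift P S T) fun _ _ hab => freeLift_eq h hab
  map_smul' c x := by
    obtain ⟨a, rfl⟩ := mk_surjective x
    exact map_smul (freeLift P S T) c a
  map_zero' := map_zero (freeLift P S T)
  map_add' x y := by
    obtain ⟨a, rfl⟩ := mk_surjective x
    obtain ⟨b, rfl⟩ := mk_surjective y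
    exact map_add (freeLift P S T) a b
  map_mul' x y := by
    obtain ⟨a, rfl⟩ := mk_surjective x
    obtain ⟨b, rfl⟩ := mk_surjective y
    exact map_mul (freeLift P S T) a b

theorem induction_on {p : Q.Leavitt → Prop} (a : Q.Leavitt) (vert : ∀ v, p (vert Q v))
    (edge : ∀ e, p (edge Q e)) (ghost : ∀ e, p (ghost Q e)) (zero : p 0)
    (add : ∀ a b, p a → p b → p (a + b)) (mul : ∀ a b, p a → p b → p (a * b))
    (smul : ∀ (c : ℂ) a, p a → p (c • a)) : p a := by
  obtain ⟨x, rfl⟩ := mk_surjective a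
  have hs (w : FreeSemigroup (Gen V E)) : p (mk (MonoidAlgebra.single w 1)) := by
    induction w using FreeSemigroup.recOnMul with
    | ih1 x =>
      cases x with
      | vert v => exact vert v
      | edge e => exact edge e
      | ghost e => exact ghost e
    | ih2 x y hx hy =>
      have := mul _ _ hx hy
      rwa [← mk_mul, MonoidAlgebra.single_mul_single, one_mul] at this
  induction x using MonoidAlgebra.induction_linear with
  | zero => exact zero
  | add f g hf hg => exact add _ _ hf hg
  | single w c =>
    have := smul c _ (hs w)
    rwa [← mk_smul, MonoidAlgebra.smul_single, smul_eq_mul, mul_one] at this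

end Leavitt

end Leavitt

end OrientedGraph

namespace OrientedGraph

/-! ### The canonical homomorphisms -/

section Canonical

variable {V E : Type u} (Q : OrientedGraph V E)

namespace Leavitt

variable {Q}

theorem vert_mul_edge_ne {v : V} {e : E} (h : v ≠ Q.s e) : vert Q v * edge Q e = 0 := by
  rw [← (isLeavittFamily Q).source_mul_edge e, ← mul_assoc,
    (isLeavittFamily Q).vert_mul_ne _ _ h, zero_mul]

theorem ghost_mul_vert_ne {v : V} {e : E} (h : Q.s e ≠ v) : ghost Q e * vert Q v = 0 := by
  rw [← (isLeavittFamily Q).ghost_mul_source e, mul_assoc,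
    (isLeavittFamily Q).vert_mul_ne _ _ h, mul_zero]

end Leavitt

open Leavitt

theorem sourceFree_family :
    Q.IsLeavittFamily (fun v => vert Q.sourceFree (.base v)) (fun e => edge Q.sourceFree (.base e))
      (fun e => ghost Q.sourceFree (.base e)) where
  vert_mul_self v := (isLeavittFamily _).vert_mul_self _
  vert_mul_ne v w h := (isLeavittFamily _).vert_mul_ne _ _ (by simpa using h)
  source_mul_edge e := (isLeavittFamily Q.sourceFree).source_mul_edge (.base e)
  edge_mul_range e := (isLeavittFamily Q.sourceFree).edge_mul_range (.base e)
  range_mul_ghost e := (isLeavittFamily Q.sourceFree).range_mul_ghost (.base e)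
  ghost_mul_source e := (isLeavittFamily Q.sourceFree).ghost_mul_source (.base e)
  ck1_self e := (isLeavittFamily Q.sourceFree).ck1_self (.base e)
  ck1_ne e e' h := (isLeavittFamily Q.sourceFree).ck1_ne _ _ (by simpa using h)
  ck2 v hv := by
    have hset : {e | Q.sourceFree.s e = .base v} = HeadEdge.base '' {e | Q.s e = v} := by
      ext e
      cases e with
      | base e => simp [sourceFree]
      | head w hw n => simp [sourceFree, headVertex]
    have hr : Q.sourceFree.IsRegular (.base v) := by
      rintro (h | h)
      · refine hv (Or.inl ?_)
        rw [IsSink, hset, Set.image_eq_empty] at h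
        exact h
      · rw [IsInfiniteEmitter, hset] at h
        exact h (hv.finite.image _)
    rw [(isLeavittFamily Q.sourceFree).ck2 _ hr]
    symm
    refine Finset.sum_bij (fun e _ => HeadEdge.base e) ?_ ?_ ?_ ?_
    · intro e he
      simpa [sourceFree] using he
    · intro a _ b _ h
      simpa using h
    · intro b hb
      have hb : b ∈ {e | Q.sourceFree.s e = .base v} := by simpa using hb
      rw [hset] at hb
      obtain ⟨e, he, rfl⟩ := hb
      exact ⟨e, by simpa using he, rfl⟩
    · intro e _
      rfl

/-- The canonical homomorphism from `L_Q` to the Leavitt path algebra of the source-free graph,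
induced by the inclusion of graphs. -/
noncomputable def toSourceFree : Q.Leavitt →ₙₐ[ℂ] Q.sourceFree.Leavitt :=
  lift Q.sourceFree_family

variable (num : Q.EmitterNumbering)

/-- The path `f₁ ⋯ f_n` in the tail at a singular vertex `v`. -/
noncomputable def tailPath (v : V) (hv : Q.IsSingular v) : ℕ → (Q.desing num).Leavitt
  | 0 => vert _ (.base v)
  | n + 1 => tailPath v hv n * edge (Q.desing num) (.tail v hv n)

/-- The element `f_n* ⋯ f₁*` for the tail at a singular vertex `v`. -/
noncomputable def tailGhost (v : V) (hv : Q.IsSingular v) : ℕ → (Q.desing num).Leavitt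
  | 0 => vert _ (.base v)
  | n + 1 => ghost (Q.desing num) (.tail v hv n) * tailGhost v hv n

/-- The index `n` such that the edge `e` is the edge `e_{n+1}` of its source. -/
noncomputable def edgeIndex (e : E) (he : Q.IsInfiniteEmitter (Q.s e)) : ℕ :=
  (num (Q.s e) he).symm ⟨e, rfl⟩

open Classical in
/-- The image of an edge: `e ↦ e` if `s(e)` is regular, and `e_i ↦ f₁ ⋯ f_i g_i` otherwise. -/
noncomputable def desingEdge (e : E) : (Q.desing num).Leavitt :=
  if h : Q.IsRegular (Q.s e) then edge (Q.desing num) (.base e h)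
  else
    have hi := isInfiniteEmitter_of_not_isRegular h
    Q.tailPath num (Q.s e) hi.isSingular (Q.edgeIndex num e hi + 1) *
      edge (Q.desing num) (.exit (Q.s e) hi (Q.edgeIndex num e hi))

open Classical in
/-- The image of a ghost edge: `e* ↦ e*` if `s(e)` is regular, and `e_i* ↦ g_i* f_i* ⋯ f₁*`
otherwise. -/
noncomputable def desingGhost (e : E) : (Q.desing num).Leavitt :=
  if h : Q.IsRegular (Q.s e) then ghost (Q.desing num) (.base e h)
  else
    have hi := isInfiniteEmitter_of_not_isRegular h
    ghost (Q.desing num) (.exit (Q.s e) hi (Q.edgeIndex num e hi)) *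
      Q.tailGhost num (Q.s e) hi.isSingular (Q.edgeIndex num e hi + 1)

theorem vert_mul_tailPath (v : V) (hv : Q.IsSingular v) (n : ℕ) :
    vert (Q.desing num) (.base v) * Q.tailPath num v hv n = Q.tailPath num v hv n := by
  induction n with
  | zero => exact (isLeavittFamily _).vert_mul_self _
  | succ n ih => rw [tailPath, ← mul_assoc, ih]

theorem tailGhost_mul_vert (v : V) (hv : Q.IsSingular v) (n : ℕ) :
    Q.tailGhost num v hv n * vert (Q.desing num) (.base v) = Q.tailGhost num v hv n := by
  induction n with
  | zero => exact (isLeavittFamily _).vert_mul_self _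
  | succ n ih => rw [tailGhost, mul_assoc, ih]

theorem tailGhost_mul_tailPath (v : V) (hv : Q.IsSingular v) (n : ℕ) :
    Q.tailGhost num v hv n * Q.tailPath num v hv n =
      vert (Q.desing num) (Q.tailVertex v hv n) := by
  induction n with
  | zero => exact (isLeavittFamily _).vert_mul_self _
  | succ n ih =>
    have h1 := (isLeavittFamily (Q.desing num)).source_mul_edge (.tail v hv n)
    have h2 := (isLeavittFamily (Q.desing num)).ck1_self (.tail v hv n)
    calc _ = ghost (Q.desing num) (.tail v hv n) *
          ((Q.tailGhost num v hv n * Q.tailPath num v hv n) *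
            edge (Q.desing num) (.tail v hv n)) := by simp only [tailGhost, tailPath, mul_assoc]
      _ = _ := by rw [ih]; exact (congrArg _ h1).trans h2

theorem tailGhost_mul_tailPath_lt (v : V) (hv : Q.IsSingular v) (m k : ℕ) :
    ∃ z, Q.tailGhost num v hv m * Q.tailPath num v hv (m + k + 1) =
      edge (Q.desing num) (.tail v hv m) * z := by
  induction k with
  | zero =>
    refine ⟨vert (Q.desing num) (Q.tailVertex v hv (m + 1)), ?_⟩
    rw [add_zero, tailPath, ← mul_assoc, tailGhost_mul_tailPath]
    exact ((isLeavittFamily (Q.desing num)).source_mul_edge (.tail v hv m)).trans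
      ((isLeavittFamily (Q.desing num)).edge_mul_range (.tail v hv m)).symm
  | succ k ih =>
    obtain ⟨z, hz⟩ := ih
    refine ⟨z * edge (Q.desing num) (.tail v hv (m + k + 1)), ?_⟩
    rw [← mul_assoc, ← hz, mul_assoc]
    rfl

theorem tailGhost_mul_tailPath_gt (v : V) (hv : Q.IsSingular v) (m k : ℕ) :
    ∃ z, Q.tailGhost num v hv (m + k + 1) * Q.tailPath num v hv m =
      z * ghost (Q.desing num) (.tail v hv m) := by
  induction k with
  | zero =>
    refine ⟨vert (Q.desing num) (Q.tailVertex v hv (m + 1)), ?_⟩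
    rw [add_zero, tailGhost, mul_assoc, tailGhost_mul_tailPath]
    exact ((isLeavittFamily (Q.desing num)).ghost_mul_source (.tail v hv m)).trans
      ((isLeavittFamily (Q.desing num)).range_mul_ghost (.tail v hv m)).symm
  | succ k ih =>
    obtain ⟨z, hz⟩ := ih
    refine ⟨ghost (Q.desing num) (.tail v hv (m + k + 1)) * z, ?_⟩
    rw [mul_assoc, ← hz, ← mul_assoc]
    rfl

theorem vert_mul_desingEdge (e : E) :
    vert (Q.desing num) (.base (Q.s e)) * Q.desingEdge num e = Q.desingEdge num e := by
  unfold desingEdge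
  split_ifs with h
  · exact (isLeavittFamily (Q.desing num)).source_mul_edge (.base e h)
  · simp only [← mul_assoc, vert_mul_tailPath]

theorem desingGhost_mul_vert (e : E) :
    Q.desingGhost num e * vert (Q.desing num) (.base (Q.s e)) = Q.desingGhost num e := by
  unfold desingGhost
  split_ifs with h
  · exact (isLeavittFamily (Q.desing num)).ghost_mul_source (.base e h)
  · simp only [mul_assoc, tailGhost_mul_vert]

theorem num_edgeIndex (e : E) (he : Q.IsInfiniteEmitter (Q.s e)) :
    (num (Q.s e) he (Q.edgeIndex num e he)).1 = e := by
  rw [edgeIndex, Equiv.apply_symm_apply]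

theorem exit_mul_tail (v : V) (hv : Q.IsInfiniteEmitter v) (n : ℕ) :
    ghost (Q.desing num) (.exit v hv n) * edge (Q.desing num) (.tail v hv.isSingular (n + 1)) = 0 :=
  (isLeavittFamily (Q.desing num)).ck1_ne _ _ (by simp)

theorem tail_mul_exit (v : V) (hv : Q.IsInfiniteEmitter v) (n : ℕ) :
    ghost (Q.desing num) (.tail v hv.isSingular (n + 1)) * edge (Q.desing num) (.exit v hv n) = 0 :=
  (isLeavittFamily (Q.desing num)).ck1_ne _ _ (by simp)

theorem exit_mul_exit_self (v : V) (hv : Q.IsInfiniteEmitter v) (n : ℕ) :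
    ghost (Q.desing num) (.exit v hv n) * Q.tailGhost num v hv.isSingular (n + 1) *
      (Q.tailPath num v hv.isSingular (n + 1) * edge (Q.desing num) (.exit v hv n)) =
      vert (Q.desing num) (.base (Q.r (num v hv n).1)) := by
  have h1 := (isLeavittFamily (Q.desing num)).source_mul_edge (.exit v hv n)
  have h2 := (isLeavittFamily (Q.desing num)).ck1_self (.exit v hv n)
  rw [mul_assoc, ← mul_assoc (Q.tailGhost num v _ _), tailGhost_mul_tailPath]
  exact (congrArg _ h1).trans h2

theorem exit_mul_exit_ne (v : V) (hv : Q.IsInfiniteEmitter v) (m n : ℕ) (hmn : m ≠ n) :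
    ghost (Q.desing num) (.exit v hv m) * Q.tailGhost num v hv.isSingular (m + 1) *
      (Q.tailPath num v hv.isSingular (n + 1) * edge (Q.desing num) (.exit v hv n)) = 0 := by
  rw [mul_assoc, ← mul_assoc (Q.tailGhost num v _ _)]
  rcases lt_or_gt_of_ne hmn with h | h
  · obtain ⟨k, rfl⟩ := Nat.exists_eq_add_of_lt h
    obtain ⟨z, hz⟩ := Q.tailGhost_mul_tailPath_lt num v hv.isSingular (m + 1) k
    rw [show m + k + 1 + 1 = m + 1 + k + 1 by ring, hz, ← mul_assoc, ← mul_assoc,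
      exit_mul_tail, zero_mul, zero_mul]
  · obtain ⟨k, rfl⟩ := Nat.exists_eq_add_of_lt h
    obtain ⟨z, hz⟩ := Q.tailGhost_mul_tailPath_gt num v hv.isSingular (n + 1) k
    rw [show n + k + 1 + 1 = n + 1 + k + 1 by ring, hz, mul_assoc, tail_mul_exit, mul_zero,
      mul_zero]

theorem desingGhost_mul_desingEdge_self (e : E) :
    Q.desingGhost num e * Q.desingEdge num e = vert (Q.desing num) (.base (Q.r e)) := by
  by_cases h : Q.IsRegular (Q.s e)
  · simp only [desingGhost, desingEdge, dif_pos h]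
    exact (isLeavittFamily (Q.desing num)).ck1_self (.base e h)
  · simp only [desingGhost, desingEdge, dif_neg h]
    rw [exit_mul_exit_self, num_edgeIndex]

theorem desingGhost_mul_desingEdge_ne (e e' : E) (hne : e ≠ e') :
    Q.desingGhost num e * Q.desingEdge num e' = 0 := by
  by_cases hs : Q.s e = Q.s e'
  · by_cases h : Q.IsRegular (Q.s e)
    · have h' : Q.IsRegular (Q.s e') := hs ▸ h
      simp only [desingGhost, desingEdge, dif_pos h, dif_pos h']
      exact (isLeavittFamily (Q.desing num)).ck1_ne _ _ (by simpa using hne)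
    · have h' : ¬ Q.IsRegular (Q.s e') := hs ▸ h
      simp only [desingGhost, desingEdge, dif_neg h, dif_neg h']
      have key (v w : V) (hv : Q.IsInfiniteEmitter v) (hw : Q.IsInfiniteEmitter w) (hvw : v = w)
          (m n : ℕ) (hmn : m ≠ n) :
          ghost (Q.desing num) (.exit v hv m) * Q.tailGhost num v hv.isSingular (m + 1) *
          (Q.tailPath num w hw.isSingular (n + 1) * edge (Q.desing num) (.exit w hw n)) = 0 := by
        subst hvw
        exact Q.exit_mul_exit_ne num v hv m n hmn
      have key2 (v w : V) (hv : Q.IsInfiniteEmitter v) (hw : Q.IsInfiniteEmitter w) (hvw : v = w)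
          (m n : ℕ) (hmn : m = n) : (num v hv m).1 = (num w hw n).1 := by
        subst hvw hmn
        rfl
      refine key _ _ _ _ hs _ _ fun hmn => hne ?_
      have := key2 _ _ (isInfiniteEmitter_of_not_isRegular h)
        (isInfiniteEmitter_of_not_isRegular h') hs _ _ hmn
      rwa [num_edgeIndex, num_edgeIndex] at this
  · rw [← desingGhost_mul_vert, ← vert_mul_desingEdge, mul_assoc, ← mul_assoc (vert _ _),
      (isLeavittFamily (Q.desing num)).vert_mul_ne _ _ (by simpa using hs), zero_mul, mul_zero]

theorem desing_family :
    Q.IsLeavittFamily (fun v => vert (Q.desing num) (.base v)) (Q.desingEdge num)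
      (Q.desingGhost num) where
  vert_mul_self v := (isLeavittFamily _).vert_mul_self _
  vert_mul_ne v w h := (isLeavittFamily _).vert_mul_ne _ _ (by simpa using h)
  source_mul_edge := Q.vert_mul_desingEdge num
  edge_mul_range e := by
    unfold desingEdge
    split_ifs with h
    · exact (isLeavittFamily (Q.desing num)).edge_mul_range (.base e h)
    · have hi := isInfiniteEmitter_of_not_isRegular h
      have := (isLeavittFamily (Q.desing num)).edge_mul_range
        (.exit (Q.s e) hi (Q.edgeIndex num e hi))
      rw [show (Q.desing num).r (.exit (Q.s e) hi (Q.edgeIndex num e hi)) = .base (Q.r e) from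
        congrArg (fun e => DesingVertex.base (Q.r e)) (Q.num_edgeIndex num e hi)] at this
      simp only [mul_assoc, this]
  range_mul_ghost e := by
    unfold desingGhost
    split_ifs with h
    · exact (isLeavittFamily (Q.desing num)).range_mul_ghost (.base e h)
    · have hi := isInfiniteEmitter_of_not_isRegular h
      have := (isLeavittFamily (Q.desing num)).range_mul_ghost
        (.exit (Q.s e) hi (Q.edgeIndex num e hi))
      rw [show (Q.desing num).r (.exit (Q.s e) hi (Q.edgeIndex num e hi)) = .base (Q.r e) from
        congrArg (fun e => DesingVertex.base (Q.r e)) (Q.num_edgeIndex num e hi)] at this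
      simp only [← mul_assoc, this]
  ghost_mul_source := Q.desingGhost_mul_vert num
  ck1_self := Q.desingGhost_mul_desingEdge_self num
  ck1_ne := Q.desingGhost_mul_desingEdge_ne num
  ck2 v hv := by
    have hset (e : Q.DesingEdge) : (Q.desing num).s e = .base v ↔
        ∃ e' he', Q.s e' = v ∧ e = .base e' he' := by
      cases e with
      | base e he => simp [desing, he]
      | tail w hw n =>
        cases n with
        | zero =>
          simp only [desing, tailVertex, DesingVertex.base.injEq, reduceCtorEq, and_false,
            exists_false, iff_false]
          rintro rfl
          exact hv hw
        | succ n => simp [desing, tailVertex]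
      | exit w hw n => simp [desing, tailVertex]
    have hr : (Q.desing num).IsRegular (.base v) := by
      rintro (h | h)
      · refine hv (Or.inl (Set.eq_empty_iff_forall_notMem.mpr fun e he => ?_))
        have he : Q.s e = v := he
        have h' : DesingEdge.base e (he ▸ hv) ∈ {e | (Q.desing num).s e = .base v} :=
          (hset _).mpr ⟨e, he ▸ hv, he, rfl⟩
        rw [h] at h'
        exact h'
      · refine h ((hv.finite.dependent_image fun e he =>
          DesingEdge.base e ((show Q.s e = v from he) ▸ hv)).subset fun e he => ?_)
        obtain ⟨e', he', hs, rfl⟩ := (hset e).mp he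
        exact ⟨e', hs, rfl⟩
    rw [(isLeavittFamily (Q.desing num)).ck2 _ hr]
    have hreg {e : E} (he : e ∈ hv.finite.toFinset) : Q.IsRegular (Q.s e) := by
      have he : Q.s e = v := by simpa using he
      exact he ▸ hv
    symm
    refine Finset.sum_bij (fun e he => DesingEdge.base e (hreg he)) ?_ ?_ ?_ ?_
    · intro e he
      have he : Q.s e = v := by simpa using he
      simpa [desing] using he
    · intro a _ b _ h
      simpa using h
    · intro b hb
      have hb : (Q.desing num).s b = .base v := by simpa using hb
      obtain ⟨e', he', hs, rfl⟩ := (hset b).mp hb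
      exact ⟨e', by simpa using hs, rfl⟩
    · intro e he
      simp only [desingEdge, desingGhost, dif_pos (hreg he)]

/-- The canonical homomorphism from `L_Q` to the Leavitt path algebra of the desingularization:
`v ↦ v`, `e ↦ e` if `s(e)` is regular, `e_i ↦ f₁ ⋯ f_i g_i` if `s(e_i)` is an infinite emitter,
and correspondingly on the elements `e*`. -/
noncomputable def toDesing : Q.Leavitt →ₙₐ[ℂ] (Q.desing num).Leavitt :=
  lift (Q.desing_family num)

end Canonical

end OrientedGraph

/-! ### Spatial partial isometries -/

open MeasureTheory
open scoped ENNReal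

section Spatial

variable {X Y : Type u} [MeasurableSpace X] [MeasurableSpace Y]

/-- A measurable set transformation: a homomorphism of σ-algebras from the measurable sets of `X`
modulo `μ`-null sets to the measurable sets of `Y` modulo `ν`-null sets, given by representatives
(only the values on measurable sets, up to null sets, matter). -/
structure SetTransformation (μ : Measure X) (ν : Measure Y) where
  toFun : Set X → Set Y
  measurableSet (A : Set X) : MeasurableSet A → MeasurableSet (toFun A)
  congr (A B : Set X) : MeasurableSet A → MeasurableSet B → A =ᵐ[μ] B → toFun A =ᵐ[ν] toFun B
  compl (A : Set X) : MeasurableSet A → toFun Aᶜ =ᵐ[ν] (toFun A)ᶜ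
  iUnion (A : ℕ → Set X) : (∀ n, MeasurableSet (A n)) →
    toFun (⋃ n, A n) =ᵐ[ν] ⋃ n, toFun (A n)

namespace SetTransformation

variable {μ : Measure X} {ν : Measure Y}

/-- Bijectivity as a map between measurable sets modulo null sets. -/
def IsBijective (S : SetTransformation μ ν) : Prop :=
  (∀ A B, MeasurableSet A → MeasurableSet B → S.toFun A =ᵐ[ν] S.toFun B → A =ᵐ[μ] B) ∧
    ∀ B, MeasurableSet B → ∃ A, MeasurableSet A ∧ S.toFun A =ᵐ[ν] B

/-- `η` represents the transported function `S_*(ξ)`: the preimages of Borel sets under `η` are,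
up to null sets, the images under `S` of the preimages under `ξ`. In particular
`S_*(χ_A) = χ_{S(A)}`. -/
def IsTransport (S : SetTransformation μ ν) (ξ : X → ℂ) (η : Y → ℂ) : Prop :=
  Measurable η ∧ ∀ B : Set ℂ, MeasurableSet B → η ⁻¹' B =ᵐ[ν] S.toFun (ξ ⁻¹' B)

/-- `D` is a Radon–Nikodym derivative with respect to `ν` of the transported measure `S_*(μ)`,
which is determined by `S_*(μ)(S(A)) = μ(A)`. -/
def IsDensity (S : SetTransformation μ ν) (D : Y → ℝ≥0∞) : Prop :=
  Measurable D ∧ ∀ A, MeasurableSet A → ∫⁻ y in S.toFun A, D y ∂ν = μ A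

end SetTransformation

variable {p : ℝ≥0∞} [Fact (1 ≤ p)]

/-- A spatial isometric isomorphism `u : L^p(X) → L^p(Y)`: there are a bijective measurable set
transformation `S` and a measurable phase factor `h` of modulus one such that
`u(ξ) = h · (dS_*(μ)/dν)^{1/p} · S_*(ξ)` for all `ξ`. -/
def IsSpatialIso {μ : Measure X} {ν : Measure Y} (u : Lp ℂ p μ ≃ₗᵢ[ℂ] Lp ℂ p ν) : Prop :=
  ∃ (S : SetTransformation μ ν) (h : Y → ℂ) (D : Y → ℝ≥0∞),
    S.IsBijective ∧ Measurable h ∧ (∀ᵐ y ∂ν, ‖h y‖ = 1) ∧ S.IsDensity D ∧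
    ∀ ξ : Lp ℂ p μ, ∃ η : Y → ℂ, S.IsTransport ξ η ∧
      u ξ =ᵐ[ν] fun y => h y * (((D y).toReal ^ (1 / p.toReal) : ℝ) : ℂ) * η y

/-- `s` is the composite `ι_B u π_A` of the restriction `L^p(X) → L^p(A)`, the isomorphism
`u : L^p(A) → L^p(B)` and the extension by zero `L^p(B) → L^p(X)`. The space `L^p(A)` is realized
as the `L^p`-space of the restricted measure. -/
def IsCompression {μ : Measure X} (A B : Set X)
    (u : Lp ℂ p (μ.restrict A) ≃ₗᵢ[ℂ] Lp ℂ p (μ.restrict B)) (s : Lp ℂ p μ →L[ℂ] Lp ℂ p μ) :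
    Prop :=
  ∀ ξ : Lp ℂ p μ, s ξ =ᵐ[μ] B.indicator (u (LpToLpRestrictCLM X ℂ ℂ μ p A ξ))

/-- `s` is a spatial partial isometry of `L^p(X)` with reverse `t`. -/
def IsSpatialWithReverse {μ : Measure X} (s t : Lp ℂ p μ →L[ℂ] Lp ℂ p μ) : Prop :=
  ∃ (A B : Set X) (u : Lp ℂ p (μ.restrict A) ≃ₗᵢ[ℂ] Lp ℂ p (μ.restrict B)),
    MeasurableSet A ∧ MeasurableSet B ∧ IsSpatialIso u ∧
    IsCompression A B u s ∧ IsCompression B A u.symm t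

/-- `s` is a spatial partial isometry of `L^p(X)`. -/
def IsSpatialPartialIsometry {μ : Measure X} (s : Lp ℂ p μ →L[ℂ] Lp ℂ p μ) : Prop :=
  ∃ t, IsSpatialWithReverse s t

theorem IsCompression.norm_le_one {μ : Measure X} {A B : Set X} (hB : MeasurableSet B)
    {u : Lp ℂ p (μ.restrict A) ≃ₗᵢ[ℂ] Lp ℂ p (μ.restrict B)} {s : Lp ℂ p μ →L[ℂ] Lp ℂ p μ}
    (hs : IsCompression A B u s) : ‖s‖ ≤ 1 := by
  refine s.opNorm_le_bound zero_le_one fun ξ => ?_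
  have h1 : ‖s ξ‖ = ‖u (LpToLpRestrictCLM X ℂ ℂ μ p A ξ)‖ := by
    rw [Lp.norm_def, Lp.norm_def, eLpNorm_congr_ae (hs ξ), eLpNorm_indicator_eq_eLpNorm_restrict hB]
  rw [h1, u.norm_map, one_mul]
  exact norm_Lp_toLp_restrict_le A ξ

end Spatial

/-! ### Spatial representations, spatial seminorms and the algebra `O^p(Q)` -/

namespace OrientedGraph

section Seminorms

variable {V E : Type u} (Q : OrientedGraph V E) (p : ℝ≥0∞) [Fact (1 ≤ p)]

variable {Q p} in
/-- A representation `ρ` of `L_Q` on `L^p(X)` is spatial if every `ρ(v)` is a spatial idempotent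
and every `ρ(e)` is a spatial partial isometry with reverse `ρ(e*)`. -/
structure IsSpatialRep {X : Type u} [MeasurableSpace X] {μ : Measure X}
    (ρ : Q.Leavitt →ₙₐ[ℂ] (Lp ℂ p μ →L[ℂ] Lp ℂ p μ)) : Prop where
  vert (v : V) : IsIdempotentElem (ρ (Leavitt.vert Q v)) ∧
    IsSpatialPartialIsometry (ρ (Leavitt.vert Q v))
  edge (e : E) : IsSpatialWithReverse (ρ (Leavitt.edge Q e)) (ρ (Leavitt.ghost Q e))

/-- The set of spatial `p`-seminorms on `L_Q`: the functions `a ↦ ‖ρ(a)‖`, where `ρ` is a spatial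
representation of `L_Q` on `L^p(X)` for some σ-finite measure space `X`. -/
def spatialSeminorms : Set (Q.Leavitt → ℝ) :=
  {h | ∃ (X : Type u) (_ : MeasurableSpace X) (μ : Measure X) (_ : SigmaFinite μ)
    (ρ : Q.Leavitt →ₙₐ[ℂ] (Lp ℂ p μ →L[ℂ] Lp ℂ p μ)), IsSpatialRep ρ ∧ ∀ a, h a = ‖ρ a‖}

variable {Q p}

theorem spatialSeminorms_bounded (a : Q.Leavitt) :
    ∃ C : ℝ, ∀ h ∈ Q.spatialSeminorms p, h a ≤ C := by
  induction a using Leavitt.induction_on with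
  | vert v =>
    refine ⟨1, ?_⟩
    rintro h ⟨X, _, μ, _, ρ, hρ, hh⟩
    obtain ⟨-, t, A, B, u, -, hB, -, hs, -⟩ := hρ.vert v
    exact hh _ ▸ hs.norm_le_one hB
  | edge e =>
    refine ⟨1, ?_⟩
    rintro h ⟨X, _, μ, _, ρ, hρ, hh⟩
    obtain ⟨A, B, u, -, hB, -, hs, -⟩ := hρ.edge e
    exact hh _ ▸ hs.norm_le_one hB
  | ghost e =>
    refine ⟨1, ?_⟩
    rintro h ⟨X, _, μ, _, ρ, hρ, hh⟩
    obtain ⟨A, B, u, hA, -, -, -, hs⟩ := hρ.edge e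
    exact hh _ ▸ hs.norm_le_one hA
  | zero =>
    refine ⟨0, ?_⟩
    rintro h ⟨X, _, μ, _, ρ, hρ, hh⟩
    rw [hh, map_zero, norm_zero]
  | add a b iha ihb =>
    obtain ⟨C, hC⟩ := iha
    obtain ⟨C', hC'⟩ := ihb
    refine ⟨C + C', fun h hh => (le_trans ?_ (add_le_add (hC h hh) (hC' h hh)))⟩
    obtain ⟨X, _, μ, _, ρ, hρ, hh⟩ := hh
    rw [hh, hh, hh, map_add]
    exact norm_add_le _ _
  | mul a b iha ihb =>
    obtain ⟨C, hC⟩ := iha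
    obtain ⟨C', hC'⟩ := ihb
    refine ⟨|C| * |C'|, ?_⟩
    intro h hh
    have h1 := (hC h hh).trans (le_abs_self C)
    have h2 := (hC' h hh).trans (le_abs_self C')
    obtain ⟨X, _, μ, _, ρ, hρ, hh⟩ := hh
    rw [hh] at h1 h2 ⊢
    rw [map_mul]
    exact (norm_mul_le _ _).trans (mul_le_mul h1 h2 (norm_nonneg _) (abs_nonneg _))
  | smul c a iha =>
    obtain ⟨C, hC⟩ := iha
    refine ⟨‖c‖ * C, fun h hh => (le_trans ?_ (mul_le_mul_of_nonneg_left (hC h hh)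
      (norm_nonneg c)))⟩
    obtain ⟨X, _, μ, _, ρ, hρ, hh⟩ := hh
    rw [hh, hh, map_smul]
    exact norm_smul_le c (ρ a)

variable (Q p)

/-- The algebra `L_Q`, equipped with the supremum of all spatial `p`-seminorms. -/
def NormedLeavitt (_ : ℝ≥0∞) : Type u := Q.Leavitt

noncomputable instance : NonUnitalRing (Q.NormedLeavitt p) :=
  inferInstanceAs (NonUnitalRing Q.Leavitt)

noncomputable instance : Module ℂ (Q.NormedLeavitt p) := inferInstanceAs (Module ℂ Q.Leavitt)

instance : IsScalarTower ℂ (Q.NormedLeavitt p) (Q.NormedLeavitt p) :=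
  inferInstanceAs (IsScalarTower ℂ Q.Leavitt Q.Leavitt)

instance : SMulCommClass ℂ (Q.NormedLeavitt p) (Q.NormedLeavitt p) :=
  inferInstanceAs (SMulCommClass ℂ Q.Leavitt Q.Leavitt)

/-- The identity map of `L_Q`, as an isomorphism onto `NormedLeavitt`. -/
noncomputable def toNormed : Q.Leavitt →ₙₐ[ℂ] Q.NormedLeavitt p := NonUnitalAlgHom.id ℂ Q.Leavitt

/-- The norm `‖a‖ = sup {h(a) : h a spatial p-seminorm}` on `L_Q`. -/
noncomputable def spatialNorm (a : Q.Leavitt) : ℝ := ⨆ h : Q.spatialSeminorms p, h.1 a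

variable {Q p}

theorem bddAbove_spatialSeminorms (a : Q.Leavitt) :
    BddAbove (Set.range fun h : Q.spatialSeminorms p => h.1 a) := by
  obtain ⟨C, hC⟩ := spatialSeminorms_bounded (p := p) a
  exact ⟨C, by rintro _ ⟨h, rfl⟩; exact hC _ h.2⟩

theorem le_spatialNorm (a : Q.Leavitt) (h : Q.spatialSeminorms p) : h.1 a ≤ Q.spatialNorm p a :=
  le_ciSup (bddAbove_spatialSeminorms a) h

theorem spatialNorm_nonneg (a : Q.Leavitt) : 0 ≤ Q.spatialNorm p a := by
  refine Real.iSup_nonneg fun h => ?_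
  obtain ⟨h, X, _, μ, _, ρ, hρ, hh⟩ := h
  exact (norm_nonneg _).trans_eq (hh a).symm

theorem spatialNorm_zero : Q.spatialNorm p 0 = 0 := by
  refine le_antisymm (Real.iSup_le (fun h => ?_) le_rfl) (spatialNorm_nonneg _)
  obtain ⟨h, X, _, μ, _, ρ, hρ, hh⟩ := h
  simp only [hh, map_zero, norm_zero, le_refl]

theorem spatialNorm_neg (a : Q.Leavitt) : Q.spatialNorm p (-a) = Q.spatialNorm p a := by
  refine iSup_congr fun h => ?_
  obtain ⟨h, X, _, μ, _, ρ, hρ, hh⟩ := h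
  simp only [hh, map_neg, norm_neg]

theorem spatialNorm_add_le (a b : Q.Leavitt) :
    Q.spatialNorm p (a + b) ≤ Q.spatialNorm p a + Q.spatialNorm p b := by
  refine Real.iSup_le (fun h => ?_) (add_nonneg (spatialNorm_nonneg _) (spatialNorm_nonneg _))
  refine le_trans ?_ (add_le_add (le_spatialNorm a h) (le_spatialNorm b h))
  obtain ⟨h, X, _, μ, _, ρ, hρ, hh⟩ := h
  simp only [hh, map_add]
  exact norm_add_le _ _

theorem spatialNorm_mul_le (a b : Q.Leavitt) :
    Q.spatialNorm p (a * b) ≤ Q.spatialNorm p a * Q.spatialNorm p b := by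
  refine Real.iSup_le (fun h => ?_) (mul_nonneg (spatialNorm_nonneg _) (spatialNorm_nonneg _))
  have ha := le_spatialNorm a h
  have hb := le_spatialNorm b h
  have h0 := spatialNorm_nonneg (p := p) a
  obtain ⟨h, X, _, μ, _, ρ, hρ, hh⟩ := h
  simp only [hh] at ha hb ⊢
  rw [map_mul]
  exact (norm_mul_le _ _).trans (mul_le_mul ha hb (norm_nonneg _) h0)

theorem spatialNorm_smul_le (c : ℂ) (a : Q.Leavitt) :
    Q.spatialNorm p (c • a) ≤ ‖c‖ * Q.spatialNorm p a := by
  refine Real.iSup_le (fun h => ?_) (mul_nonneg (norm_nonneg _) (spatialNorm_nonneg _))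
  refine le_trans ?_ (mul_le_mul_of_nonneg_left (le_spatialNorm a h) (norm_nonneg c))
  obtain ⟨h, X, _, μ, _, ρ, hρ, hh⟩ := h
  simp only [hh, map_smul]
  exact norm_smul_le c (ρ a)

variable (Q p)

noncomputable instance : SeminormedAddCommGroup (Q.NormedLeavitt p) :=
  AddGroupSeminorm.toSeminormedAddCommGroup (E := Q.NormedLeavitt p)
    { toFun := Q.spatialNorm p
      map_zero' := spatialNorm_zero
      add_le' := spatialNorm_add_le
      neg' := spatialNorm_neg }

noncomputable instance : NonUnitalSeminormedRing (Q.NormedLeavitt p) where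
  __ := (inferInstance : SeminormedAddCommGroup (Q.NormedLeavitt p))
  __ := (inferInstance : NonUnitalRing (Q.NormedLeavitt p))
  norm_mul_le := spatialNorm_mul_le

noncomputable instance : NormedSpace ℂ (Q.NormedLeavitt p) where
  norm_smul_le := spatialNorm_smul_le

end Seminorms

/-! The completion of a (non-unital) seminormed algebra is a Banach algebra. -/

section Completion

open UniformSpace UniformSpace.Completion Function

variable (A : Type*) [NonUnitalSeminormedRing A]

/-- The completion of `A` as a normed space, with the product extended by continuity. -/
def AlgCompletion : Type _ := Completion A

namespace AlgCompletion

noncomputable instance : NormedAddCommGroup (AlgCompletion A) :=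
  inferInstanceAs (NormedAddCommGroup (Completion A))

instance : CompleteSpace (AlgCompletion A) := inferInstanceAs (CompleteSpace (Completion A))

noncomputable instance [NormedSpace ℂ A] : NormedSpace ℂ (AlgCompletion A) :=
  inferInstanceAs (NormedSpace ℂ (Completion A))

variable {A}

/-- The canonical map from `A` to its completion. -/
noncomputable def of (a : A) : AlgCompletion A := ((a : Completion A))

theorem of_add (a b : A) : of (a + b) = of a + of b := Completion.coe_add a b

theorem of_smul [NormedSpace ℂ A] (c : ℂ) (a : A) : of (c • a) = c • of a := Completion.coe_smul c a

theorem norm_of (a : A) : ‖of a‖ = ‖a‖ := Completion.norm_coe a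

theorem continuous_of : Continuous (of : A → AlgCompletion A) := Completion.continuous_coe A

theorem isDenseInducing_of : IsDenseInducing (of : A → AlgCompletion A) :=
  Completion.isDenseInducing_coe

noncomputable instance : Mul (AlgCompletion A) :=
  ⟨curry <| (isDenseInducing_of.prodMap isDenseInducing_of).extend (of ∘ uncurry (· * ·))⟩

theorem of_mul (a b : A) : of (a * b) = of a * of b :=
  ((isDenseInducing_of.prodMap isDenseInducing_of).extend_eq
      (continuous_of.comp (continuous_mul (M := A))) (a, b)).symm

instance : ContinuousMul (AlgCompletion A) where
  continuous_mul := by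
    let m := (AddMonoidHom.mul : A →+ A →+ A).compr₂ (toCompl : A →+ Completion A)
    have : Continuous fun p : A × A => m p.1 p.2 := (continuous_coe A).comp continuous_mul
    have di : IsDenseInducing (toCompl : A → Completion A) := isDenseInducing_coe
    exact (di.extend_Z_bilin di this :)

theorem induction_on {P : AlgCompletion A → Prop} (x : AlgCompletion A)
    (hp : IsClosed {x | P x}) (ih : ∀ a, P (of a)) : P x :=
  Completion.induction_on x hp ih

theorem induction_on₂ {P : AlgCompletion A → AlgCompletion A → Prop} (x y : AlgCompletion A)
    (hp : IsClosed {x : AlgCompletion A × AlgCompletion A | P x.1 x.2})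
    (ih : ∀ a b, P (of a) (of b)) : P x y :=
  Completion.induction_on₂ x y hp ih

theorem induction_on₃ {P : AlgCompletion A → AlgCompletion A → AlgCompletion A → Prop}
    (x y z : AlgCompletion A)
    (hp : IsClosed {x : AlgCompletion A × AlgCompletion A × AlgCompletion A | P x.1 x.2.1 x.2.2})
    (ih : ∀ a b c, P (of a) (of b) (of c)) : P x y z :=
  Completion.induction_on₃ x y z hp ih

theorem of_zero : of (0 : A) = 0 := Completion.coe_zero

theorem zero_mul_aux (x : AlgCompletion A) : 0 * x = 0 :=
  induction_on (P := fun x => 0 * x = 0) x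
    (isClosed_eq (continuous_const.mul continuous_id) continuous_const)
    fun a => by rw [← of_zero, ← of_mul, zero_mul]

theorem mul_zero_aux (x : AlgCompletion A) : x * 0 = 0 :=
  induction_on (P := fun x => x * 0 = 0) x
    (isClosed_eq (continuous_id.mul continuous_const) continuous_const)
    fun a => by rw [← of_zero, ← of_mul, mul_zero]

theorem mul_assoc_aux (x y z : AlgCompletion A) : x * y * z = x * (y * z) :=
  induction_on₃ (P := fun x y z => x * y * z = x * (y * z)) x y z
    (isClosed_eq
      ((continuous_fst.mul (continuous_fst.comp continuous_snd)).mul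
        (continuous_snd.comp continuous_snd))
      (continuous_fst.mul ((continuous_fst.comp continuous_snd).mul
        (continuous_snd.comp continuous_snd))))
    fun a b c => by rw [← of_mul, ← of_mul, ← of_mul, ← of_mul, mul_assoc]

theorem mul_add_aux (x y z : AlgCompletion A) : x * (y + z) = x * y + x * z :=
  induction_on₃ (P := fun x y z => x * (y + z) = x * y + x * z) x y z
    (isClosed_eq
      (continuous_fst.mul ((continuous_fst.comp continuous_snd).add
        (continuous_snd.comp continuous_snd)))
      ((continuous_fst.mul (continuous_fst.comp continuous_snd)).add
        (continuous_fst.mul (continuous_snd.comp continuous_snd))))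
    fun a b c => by rw [← of_add, ← of_mul, ← of_mul, ← of_mul, ← of_add, mul_add]

theorem add_mul_aux (x y z : AlgCompletion A) : (x + y) * z = x * z + y * z :=
  induction_on₃ (P := fun x y z => (x + y) * z = x * z + y * z) x y z
    (isClosed_eq
      ((continuous_fst.add (continuous_fst.comp continuous_snd)).mul
        (continuous_snd.comp continuous_snd))
      ((continuous_fst.mul (continuous_snd.comp continuous_snd)).add
        ((continuous_fst.comp continuous_snd).mul (continuous_snd.comp continuous_snd))))
    fun a b c => by rw [← of_add, ← of_mul, ← of_mul, ← of_mul, ← of_add, add_mul]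

theorem norm_mul_le_aux (x y : AlgCompletion A) : ‖x * y‖ ≤ ‖x‖ * ‖y‖ :=
  induction_on₂ (P := fun x y => ‖x * y‖ ≤ ‖x‖ * ‖y‖) x y
    (isClosed_le (continuous_fst.mul continuous_snd).norm
      (continuous_fst.norm.mul continuous_snd.norm))
    fun a b => by rw [← of_mul, norm_of, norm_of, norm_of]; exact norm_mul_le a b

noncomputable instance : NonUnitalNormedRing (AlgCompletion A) where
  __ := (inferInstance : NormedAddCommGroup (AlgCompletion A))
  mul := (· * ·)
  zero_mul := zero_mul_aux
  mul_zero := mul_zero_aux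
  mul_assoc := mul_assoc_aux
  left_distrib := mul_add_aux
  right_distrib := add_mul_aux
  norm_mul_le := norm_mul_le_aux

theorem smul_mul_aux [NormedSpace ℂ A] [IsScalarTower ℂ A A] (c : ℂ) (x y : AlgCompletion A) :
    (c • x) * y = c • (x * y) :=
  induction_on₂ (P := fun x y => (c • x) * y = c • (x * y)) x y
    (isClosed_eq ((continuous_fst.const_smul c).mul continuous_snd)
      ((continuous_fst.mul continuous_snd).const_smul c))
    fun a b => by rw [← of_smul, ← of_mul, ← of_mul, ← of_smul, smul_mul_assoc]

theorem mul_smul_aux [NormedSpace ℂ A] [SMulCommClass ℂ A A] (c : ℂ) (x y : AlgCompletion A) :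
    x * (c • y) = c • (x * y) :=
  induction_on₂ (P := fun x y => x * (c • y) = c • (x * y)) x y
    (isClosed_eq (continuous_fst.mul (continuous_snd.const_smul c))
      ((continuous_fst.mul continuous_snd).const_smul c))
    fun a b => by rw [← of_smul, ← of_mul, ← of_mul, ← of_smul, mul_smul_comm]

instance [NormedSpace ℂ A] [IsScalarTower ℂ A A] :
    IsScalarTower ℂ (AlgCompletion A) (AlgCompletion A) :=
  ⟨smul_mul_aux⟩

instance [NormedSpace ℂ A] [SMulCommClass ℂ A A] :
    SMulCommClass ℂ (AlgCompletion A) (AlgCompletion A) :=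
  ⟨fun c x y => (mul_smul_aux c x y).symm⟩

/-- The canonical map from `A` to its completion, as a homomorphism of algebras. -/
noncomputable def ofHom [NormedSpace ℂ A] : A →ₙₐ[ℂ] AlgCompletion A where
  toFun := of
  map_smul' := of_smul
  map_zero' := of_zero
  map_add' := of_add
  map_mul' := of_mul

end AlgCompletion

end Completion

section Op

variable {V E : Type u} (Q : OrientedGraph V E) (p : ℝ≥0∞) [Fact (1 ≤ p)]

/-- The Banach algebra `O^p(Q)`: the completion of `L_Q` with respect to the supremum of the
spatial `p`-seminorms. -/
abbrev Op : Type u := AlgCompletion (Q.NormedLeavitt p)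

/-- The canonical homomorphism `L_Q → O^p(Q)`. -/
noncomputable def toOp : Q.Leavitt →ₙₐ[ℂ] Q.Op p := AlgCompletion.ofHom.comp (Q.toNormed p)

end Op

end OrientedGraph

/-! ### Multiplication by indicator functions on `L^p` -/

section Indicator

variable {X Y : Type u} [MeasurableSpace X] [MeasurableSpace Y] {p : ℝ≥0∞} [Fact (1 ≤ p)]
  {μ : Measure X} {ν : Measure Y}

/-! The defining formula of a spatial partial isometry is awkward under products, so it is replaced
by an algebraic condition. A pair `s`, `t` is a Lamperti pair if `sts = s`, `tst = t`, both are
contractions, and `T ↦ sTt`, `T ↦ tTs` preserve the operators of multiplication by indicator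
functions. For `p < ∞` and a σ-finite measure this says exactly that `s` is spatial with reverse
`t`. One direction (`IsSpatialIso.isLampertiIso`) is uniqueness of transported functions. The other
(`IsLampertiIso.isSpatialIso`) is the argument behind Lamperti's theorem: an isometry `u` that
intertwines indicator functions preserves the sets `{|ξ| < |η|}`, hence the preimages of discs under
the quotients `ξ/ω`, so that `u ξ / u ω` is the transport of `ξ/ω`; a strictly positive `ω` then
yields the phase and the density. Consequently (`isSpatialRep_iff`) a representation is spatial iff
vertices act as indicator functions and each `e`, `e*` act as a Lamperti pair.

Restriction of representations: `φ_o` sends generators to generators, and `φ_d` sends edges to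
products of edges. Products of Lamperti pairs are Lamperti pairs because indicator functions
commute.

Extension of representations: given `ρ` on `L^p(X)`, work on `L^p(X × ℕ)`, countably many copies of
`L^p(X)`, where `M k l a` applies `ρ(a)` from copy `l` to copy `k`. The `n`-th vertex of a tail or
head lives in copy `n`. On a head at `w` it acts as `w`. On a tail at `v` it acts as `p_n`, which is
`v` minus the range projections `e_i e_i*` of the edges that have already left the tail. The edges
of the tail act as `p_n` between adjacent copies, and `g_i` acts as `e_i` from copy `0` to copy `i`;
the relation at `v_n` for an infinite emitter becomes `p_n = p_{n+1} + e_n e_n*`. The resulting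
representation composed with `φ_#` is `a ↦ M 0 0 a`, which has the norm of `ρ(a)`.

Hence the two sets of seminorms agree, the suprema agree, `φ_#` preserves the seminorm, and it
extends to the completions (`exists_isometry_op`). -/

theorem indicator_ae_eq_of_ae_restrict {A : Set X} (hA : MeasurableSet A) {f g : X → ℂ}
    (h : f =ᵐ[μ.restrict A] g) : A.indicator f =ᵐ[μ] A.indicator g := by
  filter_upwards [(ae_restrict_iff' hA).mp h] with x hx
  by_cases ha : x ∈ A <;> simp [ha, hx]

/-- Extension by zero `L^p(A) → L^p(X)`. -/
noncomputable def extendByZero (p : ℝ≥0∞) [Fact (1 ≤ p)] (μ : Measure X) {A : Set X}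
    (hA : MeasurableSet A) : Lp ℂ p (μ.restrict A) →ₗᵢ[ℂ] Lp ℂ p μ where
  toFun ξ := ((memLp_indicator_iff_restrict hA).mpr (Lp.memLp ξ)).toLp
  map_add' ξ η := by
    rw [← MemLp.toLp_add]
    refine MemLp.toLp_congr _ _ ?_
    rw [← Set.indicator_add']
    exact indicator_ae_eq_of_ae_restrict hA (Lp.coeFn_add ξ η)
  map_smul' c ξ := by
    rw [RingHom.id_apply, ← MemLp.toLp_const_smul]
    refine MemLp.toLp_congr _ _ ?_
    refine (indicator_ae_eq_of_ae_restrict hA (Lp.coeFn_smul c ξ)).trans (.of_eq ?_)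
    exact Set.indicator_const_smul A c ξ
  norm_map' ξ := by
    change ‖MemLp.toLp (A.indicator ξ) ((memLp_indicator_iff_restrict hA).mpr (Lp.memLp ξ))‖ = _
    rw [Lp.norm_toLp, eLpNorm_indicator_eq_eLpNorm_restrict hA, Lp.norm_def]

theorem extendByZero_ae {A : Set X} (hA : MeasurableSet A) (ξ : Lp ℂ p (μ.restrict A)) :
    extendByZero p μ hA ξ =ᵐ[μ] A.indicator ξ := by
  have h : extendByZero p μ hA ξ = ((memLp_indicator_iff_restrict hA).mpr (Lp.memLp ξ)).toLp := rfl
  rw [h]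
  exact MemLp.coeFn_toLp _

/-- Multiplication by the indicator function of a measurable set. -/
noncomputable def indicatorCLM (p : ℝ≥0∞) [Fact (1 ≤ p)] (μ : Measure X) {A : Set X}
    (hA : MeasurableSet A) : Lp ℂ p μ →L[ℂ] Lp ℂ p μ :=
  (extendByZero p μ hA).toContinuousLinearMap ∘L LpToLpRestrictCLM X ℂ ℂ μ p A

theorem indicatorCLM_ae {A : Set X} (hA : MeasurableSet A) (ξ : Lp ℂ p μ) :
    indicatorCLM p μ hA ξ =ᵐ[μ] A.indicator ξ :=
  (extendByZero_ae hA _).trans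
    (indicator_ae_eq_of_ae_restrict hA (LpToLpRestrictCLM_coeFn ℂ A ξ))

theorem restrict_extendByZero {A : Set X} (hA : MeasurableSet A) (ξ : Lp ℂ p (μ.restrict A)) :
    LpToLpRestrictCLM X ℂ ℂ μ p A (extendByZero p μ hA ξ) = ξ := by
  refine Lp.ext ((LpToLpRestrictCLM_coeFn ℂ A _).trans ?_)
  filter_upwards [ae_restrict_of_ae (s := A) (extendByZero_ae hA ξ), ae_restrict_mem hA] with x h1 h2
  rw [h1, Set.indicator_of_mem h2]

theorem extendByZero_restrict {A : Set X} (hA : MeasurableSet A) (ξ : Lp ℂ p μ) :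
    extendByZero p μ hA (LpToLpRestrictCLM X ℂ ℂ μ p A ξ) = indicatorCLM p μ hA ξ := rfl

theorem indicatorCLM_extendByZero {A : Set X} (hA : MeasurableSet A) (ξ : Lp ℂ p (μ.restrict A)) :
    indicatorCLM p μ hA (extendByZero p μ hA ξ) = extendByZero p μ hA ξ := by
  rw [← extendByZero_restrict, restrict_extendByZero]

theorem restrict_indicatorCLM {A : Set X} (hA : MeasurableSet A) (ξ : Lp ℂ p μ) :
    LpToLpRestrictCLM X ℂ ℂ μ p A (indicatorCLM p μ hA ξ) = LpToLpRestrictCLM X ℂ ℂ μ p A ξ := by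
  rw [← extendByZero_restrict, restrict_extendByZero]

theorem restrict_indicatorCLM_comm {A F : Set X} (hF : MeasurableSet F) (ξ : Lp ℂ p μ) :
    LpToLpRestrictCLM X ℂ ℂ μ p A (indicatorCLM p μ hF ξ) =
      indicatorCLM p (μ.restrict A) hF (LpToLpRestrictCLM X ℂ ℂ μ p A ξ) := by
  refine Lp.ext ?_
  filter_upwards [LpToLpRestrictCLM_coeFn ℂ A (indicatorCLM p μ hF ξ),
    ae_restrict_of_ae (s := A) (indicatorCLM_ae hF ξ), LpToLpRestrictCLM_coeFn ℂ A ξ,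
    indicatorCLM_ae hF (LpToLpRestrictCLM X ℂ ℂ μ p A ξ)] with x h1 h2 h3 h4
  rw [h1, h2, h4]
  simp only [Set.indicator, h3]

theorem norm_indicatorCLM_apply_le {A : Set X} (hA : MeasurableSet A) (ξ : Lp ℂ p μ) :
    ‖indicatorCLM p μ hA ξ‖ ≤ ‖ξ‖ := by
  rw [← extendByZero_restrict, LinearIsometry.norm_map]
  exact norm_Lp_toLp_restrict_le A ξ

theorem indicatorCLM_mul {A B : Set X} (hA : MeasurableSet A) (hB : MeasurableSet B) :
    indicatorCLM p μ hA * indicatorCLM p μ hB = indicatorCLM p μ (hA.inter hB) := by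
  ext1 ξ
  refine Lp.ext ?_
  filter_upwards [indicatorCLM_ae hA (indicatorCLM p μ hB ξ), indicatorCLM_ae hB ξ,
    indicatorCLM_ae (hA.inter hB) ξ] with x h1 h2 h3
  rw [mul_apply_eq_comp, h1, h3]
  by_cases ha : x ∈ A <;> by_cases hb : x ∈ B <;> simp [ha, hb, h2]

theorem indicatorCLM_mul_comm {A B : Set X} (hA : MeasurableSet A) (hB : MeasurableSet B) :
    indicatorCLM p μ hA * indicatorCLM p μ hB = indicatorCLM p μ hB * indicatorCLM p μ hA := by
  simp only [indicatorCLM_mul, Set.inter_comm]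

theorem indicatorCLM_mul_self {A : Set X} (hA : MeasurableSet A) :
    indicatorCLM p μ hA * indicatorCLM p μ hA = indicatorCLM p μ hA := by
  simp only [indicatorCLM_mul, Set.inter_self]

theorem indicatorCLM_diff {A B : Set X} (hA : MeasurableSet A) (hB : MeasurableSet B) :
    indicatorCLM p μ (hA.diff hB) =
      indicatorCLM p μ hA - indicatorCLM p μ hA * indicatorCLM p μ hB := by
  rw [indicatorCLM_mul]
  ext1 ξ
  refine Lp.ext ?_
  rw [sub_apply]
  filter_upwards [indicatorCLM_ae hA ξ, indicatorCLM_ae (hA.inter hB) ξ,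
    indicatorCLM_ae (hA.diff hB) ξ, Lp.coeFn_sub (indicatorCLM p μ hA ξ)
      (indicatorCLM p μ (hA.inter hB) ξ)] with x h1 h2 h3 h4
  rw [h3, h4, Pi.sub_apply, h1, h2]
  by_cases ha : x ∈ A <;> by_cases hb : x ∈ B <;> simp [ha, hb]

theorem indicatorCLM_univ : indicatorCLM p μ MeasurableSet.univ = 1 := by
  ext1 ξ
  refine Lp.ext ((indicatorCLM_ae _ ξ).trans ?_)
  simp

theorem indicatorCLM_empty : indicatorCLM p μ MeasurableSet.empty = 0 := by
  ext1 ξ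
  refine Lp.ext ((indicatorCLM_ae _ ξ).trans ?_)
  rw [Set.indicator_empty]
  exact (Lp.coeFn_zero _ _ _).symm

theorem indicatorCLM_compl {A : Set X} (hA : MeasurableSet A) :
    indicatorCLM p μ hA.compl = 1 - indicatorCLM p μ hA := by
  have := indicatorCLM_diff (p := p) (μ := μ) MeasurableSet.univ hA
  rw [indicatorCLM_univ, one_mul] at this
  rw [← this]
  congr 1
  exact Set.compl_eq_univ_sdiff A

theorem indicatorCLM_congr {A B : Set X} (hA : MeasurableSet A) (hB : MeasurableSet B)
    (h : A =ᵐ[μ] B) : indicatorCLM p μ hA = indicatorCLM p μ hB := by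
  ext1 ξ
  exact Lp.ext ((indicatorCLM_ae hA ξ).trans
    ((indicator_ae_eq_of_ae_eq_set h).trans (indicatorCLM_ae hB ξ).symm))

/-- A σ-finite `L^p`-space has a bounded strictly positive element. -/
theorem exists_pos_memLp (μ : Measure X) [SigmaFinite μ] (hp : p ≠ ∞) :
    ∃ w : X → ℝ, Measurable w ∧ (∀ x, 0 < w x) ∧ (∀ x, w x ≤ 1) ∧
      MemLp (fun x => (w x : ℂ)) p μ := by
  obtain ⟨g, hg, hgm, hgi⟩ := exists_pos_lintegral_lt_of_sigmaFinite μ (one_ne_zero (α := ℝ≥0∞))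
  refine ⟨fun x => min (g x) 1, by fun_prop, fun x => by simp [hg x], fun x => by simp, ?_, ?_⟩
  · exact (by fun_prop : Measurable fun x => ((min (g x : ℝ) 1 : ℝ) : ℂ)).aestronglyMeasurable
  · have hp0 : 1 ≤ p := Fact.out
    have hp0' : p ≠ 0 := (zero_lt_one.trans_le hp0).ne'
    have hpr : 1 ≤ p.toReal := by
      rw [← ENNReal.toReal_one]
      exact (ENNReal.toReal_le_toReal ENNReal.one_ne_top hp).mpr hp0
    rw [eLpNorm_lt_top_iff_lintegral_rpow_enorm_lt_top hp0' hp]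
    -- With `w = min g 1` and `p ≥ 1`: `w ^ p ≤ w ≤ g`, and `g` has integral below `1`.
    refine lt_of_le_of_lt (lintegral_mono fun x => ?_) (hgi.trans ENNReal.one_lt_top)
    have h0 : 0 ≤ min (g x : ℝ) 1 := by positivity
    have h1 : ‖(((min (g x : ℝ) 1) : ℝ) : ℂ)‖ₑ = ENNReal.ofReal (min (g x) 1) := by
      rw [← ofReal_norm, Complex.norm_real, Real.norm_of_nonneg h0]
    have h2 : ENNReal.ofReal (min (g x) 1) ≤ 1 := by
      rw [← ENNReal.ofReal_one]
      exact ENNReal.ofReal_le_ofReal (min_le_right _ _)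
    calc _ ≤ ‖((min (g x : ℝ) 1 : ℝ) : ℂ)‖ₑ := by
          rw [h1]
          exact (ENNReal.rpow_le_rpow_of_exponent_ge h2 hpr).trans_eq (ENNReal.rpow_one _)
      _ ≤ _ := by
          rw [h1]
          refine (ENNReal.ofReal_le_ofReal (min_le_left _ _)).trans_eq ?_
          exact ENNReal.ofReal_coe_nnreal

/-- Applied to a strictly positive element of `L^p`, the operator reveals the set: the result is
nonzero exactly there. -/
theorem ae_eq_of_indicatorCLM_eq [SigmaFinite μ] (hp : p ≠ ∞) {A B : Set X} (hA : MeasurableSet A)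
    (hB : MeasurableSet B) (h : indicatorCLM p μ hA = indicatorCLM p μ hB) : A =ᵐ[μ] B := by
  obtain ⟨w, -, hw, -, hwL⟩ := exists_pos_memLp (p := p) μ hp
  have h1 := indicatorCLM_ae hA hwL.toLp
  rw [h] at h1
  filter_upwards [h1, indicatorCLM_ae hB hwL.toLp, hwL.coeFn_toLp] with x h1 h2 h3
  rw [h1] at h2
  have hw0 : (w x : ℂ) ≠ 0 := by exact_mod_cast (hw x).ne'
  refine propext ?_
  change x ∈ A ↔ x ∈ B
  by_cases ha : x ∈ A <;> by_cases hb : x ∈ B <;> simp_all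

/-! ### Equality of norms under pointwise domination -/

theorem lintegral_rpow_enorm_ne_top (hp : p ≠ ∞) (ξ : Lp ℂ p μ) :
    ∫⁻ x, ‖ξ x‖ₑ ^ p.toReal ∂μ ≠ ∞ :=
  ((eLpNorm_lt_top_iff_lintegral_rpow_enorm_lt_top
    (zero_lt_one.trans_le (Fact.out : 1 ≤ p)).ne' hp).mp (Lp.memLp ξ).2).ne

theorem norm_le_norm_iff_lintegral (hp : p ≠ ∞) (ξ : Lp ℂ p μ) (η : Lp ℂ p ν) :
    ‖ξ‖ ≤ ‖η‖ ↔ ∫⁻ x, ‖ξ x‖ₑ ^ p.toReal ∂μ ≤ ∫⁻ y, ‖η y‖ₑ ^ p.toReal ∂ν := by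
  have hp0 : p ≠ 0 := (zero_lt_one.trans_le (Fact.out : 1 ≤ p)).ne'
  have hpr : 0 < p.toReal := ENNReal.toReal_pos hp0 hp
  rw [Lp.norm_def, Lp.norm_def, ENNReal.toReal_le_toReal (Lp.eLpNorm_ne_top _)
    (Lp.eLpNorm_ne_top _), eLpNorm_eq_lintegral_rpow_enorm_toReal hp0 hp,
    eLpNorm_eq_lintegral_rpow_enorm_toReal hp0 hp, ENNReal.rpow_le_rpow_iff (by positivity)]

/-- If `ξ` is dominated by `η` but has at least the norm of `η`, the absolute values agree. -/
theorem ae_enorm_eq_of_norm_le (hp : p ≠ ∞) {ξ η : Lp ℂ p μ} (hle : ∀ᵐ x ∂μ, ‖ξ x‖ₑ ≤ ‖η x‖ₑ)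
    (h : ‖η‖ ≤ ‖ξ‖) : ∀ᵐ x ∂μ, ‖ξ x‖ₑ = ‖η x‖ₑ := by
  have hpr : 0 < p.toReal :=
    ENNReal.toReal_pos (zero_lt_one.trans_le (Fact.out : 1 ≤ p)).ne' hp
  rw [norm_le_norm_iff_lintegral hp] at h
  filter_upwards [ae_eq_of_ae_le_of_lintegral_le
    (hle.mono fun x hx => ENNReal.rpow_le_rpow hx hpr.le) (lintegral_rpow_enorm_ne_top hp ξ)
    ((Lp.aestronglyMeasurable η).enorm.pow_const _) h] with x hx
  exact ENNReal.rpow_left_injective hpr.ne' hx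

/-- If multiplication by the indicator function does not decrease the norm of `ξ`, it fixes `ξ`. -/
theorem indicatorCLM_eq_self_of_norm_le (hp : p ≠ ∞) {A : Set X} (hA : MeasurableSet A)
    (ξ : Lp ℂ p μ) (h : ‖ξ‖ ≤ ‖indicatorCLM p μ hA ξ‖) : indicatorCLM p μ hA ξ = ξ := by
  have hle : ∀ᵐ x ∂μ, ‖indicatorCLM p μ hA ξ x‖ₑ ≤ ‖ξ x‖ₑ := by
    filter_upwards [indicatorCLM_ae hA ξ] with x hx
    rw [hx]
    exact enorm_indicator_le_enorm_self _ _
  refine Lp.ext ?_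
  filter_upwards [ae_enorm_eq_of_norm_le hp hle h, indicatorCLM_ae hA ξ] with x h1 h2
  rw [h2] at h1 ⊢
  by_cases ha : x ∈ A
  · simp [ha]
  · rw [Set.indicator_of_notMem ha, enorm_zero] at h1
    rw [Set.indicator_of_notMem ha]
    exact (enorm_eq_zero.mp h1.symm).symm

/-- An operator that is multiplication by the indicator function of a measurable set. -/
def IsIndicator (T : Lp ℂ p μ →L[ℂ] Lp ℂ p μ) : Prop :=
  ∃ (A : Set X) (hA : MeasurableSet A), T = indicatorCLM p μ hA

theorem isIndicator_indicatorCLM {A : Set X} (hA : MeasurableSet A) :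
    IsIndicator (indicatorCLM p μ hA) := ⟨A, hA, rfl⟩

/-! ### Algebra of indicator operators -/

namespace IsIndicator

variable {S T : Lp ℂ p μ →L[ℂ] Lp ℂ p μ}

theorem mul (hS : IsIndicator S) (hT : IsIndicator T) : IsIndicator (S * T) := by
  obtain ⟨A, hA, rfl⟩ := hS
  obtain ⟨B, hB, rfl⟩ := hT
  exact ⟨_, _, indicatorCLM_mul hA hB⟩

theorem comm (hS : IsIndicator S) (hT : IsIndicator T) : S * T = T * S := by
  obtain ⟨A, hA, rfl⟩ := hS
  obtain ⟨B, hB, rfl⟩ := hT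
  exact indicatorCLM_mul_comm hA hB

theorem mul_self (hS : IsIndicator S) : S * S = S := by
  obtain ⟨A, hA, rfl⟩ := hS
  exact indicatorCLM_mul_self hA

/-- The operator of a difference of sets. It keeps the projections along a tail within the indicator
operators. -/
theorem sub_mul (hS : IsIndicator S) (hT : IsIndicator T) : IsIndicator (S - S * T) := by
  obtain ⟨A, hA, rfl⟩ := hS
  obtain ⟨B, hB, rfl⟩ := hT
  exact ⟨_, _, (indicatorCLM_diff hA hB).symm⟩

theorem norm_apply_le (hS : IsIndicator S) (ξ : Lp ℂ p μ) : ‖S ξ‖ ≤ ‖ξ‖ := by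
  obtain ⟨A, hA, rfl⟩ := hS
  exact norm_indicatorCLM_apply_le hA ξ

theorem norm_le_one (hS : IsIndicator S) : ‖S‖ ≤ 1 :=
  S.opNorm_le_bound zero_le_one fun ξ => by rw [one_mul]; exact hS.norm_apply_le ξ

theorem one : IsIndicator (1 : Lp ℂ p μ →L[ℂ] Lp ℂ p μ) := ⟨_, _, indicatorCLM_univ.symm⟩

end IsIndicator

/-- `s` and `t` are mutually inverse contractive partial isometries, conjugation by which maps
multiplications by indicator functions to such. -/
structure IsLampertiPair (s t : Lp ℂ p μ →L[ℂ] Lp ℂ p μ) : Prop where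
  left : s * t * s = s
  right : t * s * t = t
  norm_left : ‖s‖ ≤ 1
  norm_right : ‖t‖ ≤ 1
  conj_left {T : Lp ℂ p μ →L[ℂ] Lp ℂ p μ} : IsIndicator T → IsIndicator (s * T * t)
  conj_right {T : Lp ℂ p μ →L[ℂ] Lp ℂ p μ} : IsIndicator T → IsIndicator (t * T * s)

/-! ### Products of Lamperti pairs, and idempotents among them -/

namespace IsLampertiPair

variable {s t s' t' : Lp ℂ p μ →L[ℂ] Lp ℂ p μ}

theorem symm (h : IsLampertiPair s t) : IsLampertiPair t s :=
  ⟨h.right, h.left, h.norm_right, h.norm_left, h.conj_right, h.conj_left⟩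

theorem isIndicator_left (h : IsLampertiPair s t) : IsIndicator (s * t) := by
  simpa using h.conj_left .one

theorem isIndicator_right (h : IsLampertiPair s t) : IsIndicator (t * s) := h.symm.isIndicator_left

/-- The range projection `s' * t'` and the domain projection `t * s` are both indicator operators,
so they commute. For general partial isometries the product could fail to be one. -/
theorem mul_left (h : IsLampertiPair s t) (h' : IsLampertiPair s' t') :
    s * s' * (t' * t) * (s * s') = s * s' := by
  calc _ = s * ((s' * t') * (t * s)) * s' := by noncomm_ring
    _ = s * ((t * s) * (s' * t')) * s' := by rw [h'.isIndicator_left.comm h.isIndicator_right]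
    _ = (s * t * s) * (s' * t' * s') := by noncomm_ring
    _ = _ := by rw [h.left, h'.left]

theorem mul (h : IsLampertiPair s t) (h' : IsLampertiPair s' t') :
    IsLampertiPair (s * s') (t' * t) where
  left := mul_left h h'
  right := mul_left h'.symm h.symm
  norm_left := (norm_mul_le _ _).trans (mul_le_one₀ h.norm_left (norm_nonneg _) h'.norm_left)
  norm_right := (norm_mul_le _ _).trans (mul_le_one₀ h'.norm_right (norm_nonneg _) h.norm_right)
  conj_left {T} hT := by
    have := h.conj_left (h'.conj_left hT)
    simpa only [mul_assoc] using this
  conj_right {T} hT := by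
    have := h'.conj_right (h.conj_right hT)
    simpa only [mul_assoc] using this

theorem of_isIndicator (h : IsIndicator s) : IsLampertiPair s s where
  left := by rw [h.mul_self, h.mul_self]
  right := by rw [h.mul_self, h.mul_self]
  norm_left := h.norm_le_one
  norm_right := h.norm_le_one
  conj_left hT := (h.mul hT).mul h
  conj_right hT := (h.mul hT).mul h

/-- The operator equals its own domain projection `t * s`. As `s` is a contraction and `s ξ = s (t s
(s ξ))`, cutting `s ξ` down to the domain cannot lower its norm. For `p < ∞` this means that `s ξ`
is supported in the domain, i.e. `t s s = s`; idempotency then gives `s = t s`. -/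
theorem isIndicator_of_isIdempotentElem (hp : p ≠ ∞) (h : IsLampertiPair s t)
    (hs : IsIdempotentElem s) : IsIndicator s := by
  have hts : t * s * s = s := by
    obtain ⟨A, hA, hts⟩ := h.isIndicator_right
    rw [hts]
    ext1 ξ
    refine indicatorCLM_eq_self_of_norm_le hp hA _ ?_
    have h1 : s ξ = s (indicatorCLM p μ hA (s ξ)) := by
      change s ξ = (s * indicatorCLM p μ hA * s) ξ
      rw [← hts, ← mul_assoc, h.left, hs.eq]
    calc ‖s ξ‖ = ‖s (indicatorCLM p μ hA (s ξ))‖ := by rw [← h1]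
      _ ≤ _ := s.le_of_opNorm_le h.norm_left _ |>.trans_eq (one_mul _)
  have : s = t * s := by rw [← hs.eq, ← mul_assoc, hts, hs.eq]
  rw [this]
  exact h.isIndicator_right

end IsLampertiPair

end Indicator

/-! ### Measurable set transformations and transported functions -/

namespace SetTransformation

variable {X Y : Type u} [MeasurableSpace X] [MeasurableSpace Y] {μ : Measure X} {ν : Measure Y}
  (S : SetTransformation μ ν)

theorem union {A B : Set X} (hA : MeasurableSet A) (hB : MeasurableSet B) :
    S.toFun (A ∪ B) =ᵐ[ν] (S.toFun A ∪ S.toFun B : Set Y) := by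
  -- The axioms mention countable unions only; the sequence is `A, B, B, …`.
  have h := S.iUnion (fun n => if n = 0 then A else B) fun n => by split_ifs <;> assumption
  have h1 : (⋃ n : ℕ, if n = 0 then A else B) = A ∪ B := by
    ext x
    simp only [Set.mem_iUnion, Set.mem_union]
    refine ⟨fun ⟨n, hn⟩ => ?_, fun hx => hx.elim (fun hx => ⟨0, by simpa⟩) fun hx => ⟨1, by simpa⟩⟩
    split_ifs at hn
    exacts [Or.inl hn, Or.inr hn]
  have h2 : (⋃ n : ℕ, S.toFun (if n = 0 then A else B)) = S.toFun A ∪ S.toFun B := by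
    ext x
    simp only [Set.mem_iUnion, Set.mem_union]
    refine ⟨fun ⟨n, hn⟩ => ?_, fun hx => hx.elim (fun hx => ⟨0, by simpa⟩) fun hx => ⟨1, by simpa⟩⟩
    split_ifs at hn
    exacts [Or.inl hn, Or.inr hn]
  rwa [h1, h2] at h

theorem inter {A B : Set X} (hA : MeasurableSet A) (hB : MeasurableSet B) :
    S.toFun (A ∩ B) =ᵐ[ν] (S.toFun A ∩ S.toFun B : Set Y) := by
  have h1 := S.compl _ (hA.compl.union hB.compl)
  have h2 := (S.union hA.compl hB.compl).trans ((S.compl _ hA).union (S.compl _ hB))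
  have h3 : S.toFun (Aᶜ ∪ Bᶜ)ᶜ =ᵐ[ν] (((S.toFun A)ᶜ ∪ (S.toFun B)ᶜ)ᶜ : Set Y) :=
    h1.trans h2.compl
  simpa only [Set.compl_union, compl_compl] using h3

theorem univ : S.toFun Set.univ =ᵐ[ν] Set.univ := by
  have h : S.toFun (∅ ∪ ∅ᶜ) =ᵐ[ν] (S.toFun ∅ ∪ (S.toFun ∅)ᶜ : Set Y) :=
    (S.union MeasurableSet.empty MeasurableSet.empty.compl).trans
      ((Filter.EventuallyEq.refl _ _).union (S.compl _ MeasurableSet.empty))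
  rwa [Set.union_compl_self, Set.union_compl_self] at h

theorem empty : S.toFun ∅ =ᵐ[ν] (∅ : Set Y) := by
  have h : S.toFun Set.univᶜ =ᵐ[ν] (Set.univᶜ : Set Y) :=
    (S.compl _ MeasurableSet.univ).trans S.univ.compl
  rwa [Set.compl_univ, Set.compl_univ] at h

theorem ite {F A B : Set X} (hF : MeasurableSet F) (hA : MeasurableSet A) (hB : MeasurableSet B) :
    S.toFun (F.ite A B) =ᵐ[ν] (S.toFun F).ite (S.toFun A) (S.toFun B) := by
  rw [Set.ite, Set.ite, Set.sdiff_eq, Set.sdiff_eq]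
  exact (S.union (hA.inter hF) (hB.inter hF.compl)).trans ((S.inter hA hF).union
    ((S.inter hB hF.compl).trans ((Filter.EventuallyEq.refl _ _).inter (S.compl _ hF))))

/-- `η` represents the transport of `ξ`, for functions with values in any measurable space. -/
def Intertwines {Z : Type*} [MeasurableSpace Z] (ξ : X → Z) (η : Y → Z) : Prop :=
  ∀ C : Set Z, MeasurableSet C → η ⁻¹' C =ᵐ[ν] S.toFun (ξ ⁻¹' C)

variable {S}

namespace Intertwines

variable {Z Z' : Type*} [MeasurableSpace Z] [MeasurableSpace Z'] {ξ : X → Z} {η : Y → Z}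

/-- Countably many measurable sets separate the points, so a function is determined up to a null set
by its preimages modulo null sets. -/
theorem ae_eq {Z : Type*} [MeasurableSpace Z] [MeasurableSpace.CountablySeparated Z]
    {ξ : X → Z} {η η' : Y → Z} (h : S.Intertwines ξ η) (h' : S.Intertwines ξ η') : η =ᵐ[ν] η' :=
  Filter.EventuallyEq.of_forall_separating_preimage MeasurableSet
    fun C hC => (h C hC).trans (h' C hC).symm

theorem congr_left {ξ' : X → Z} (hξ : Measurable ξ) (hξ' : Measurable ξ') (h : S.Intertwines ξ η)
    (hae : ξ =ᵐ[μ] ξ') : S.Intertwines ξ' η := fun C hC =>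
  (h C hC).trans (S.congr _ _ (hξ hC) (hξ' hC) (hae.preimage C))

theorem comp {φ : Z → Z'} (hφ : Measurable φ) (h : S.Intertwines ξ η) :
    S.Intertwines (φ ∘ ξ) (φ ∘ η) := fun _ hC => h _ (hφ hC)

/-- The sets `C` with the required property form a σ-algebra, as `S` commutes with complements and
countable unions modulo null sets. -/
theorem of_generateFrom {Z : Type*} [m : MeasurableSpace Z] {ξ : X → Z} {η : Y → Z}
    (hξ : Measurable ξ) {𝒞 : Set (Set Z)} (hm : m = MeasurableSpace.generateFrom 𝒞)
    (h : ∀ C ∈ 𝒞, η ⁻¹' C =ᵐ[ν] S.toFun (ξ ⁻¹' C)) : S.Intertwines ξ η := by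
  have key : ∀ C : Set Z, MeasurableSet[MeasurableSpace.generateFrom 𝒞] C →
      η ⁻¹' C =ᵐ[ν] S.toFun (ξ ⁻¹' C) := by
    intro C hC
    induction C, hC using MeasurableSpace.generateFrom_induction with
    | hC t ht => exact h t ht
    | empty => exact S.empty.symm
    | compl t ht ih => exact ih.compl.trans (S.compl _ (hξ (hm ▸ ht))).symm
    | iUnion t ht ih =>
      simp only [Set.preimage_iUnion]
      exact (Filter.EventuallyEq.countable_iUnion ih).trans
        (S.iUnion _ fun n => hξ (hm ▸ ht n)).symm
  exact fun C hC => key C (hm ▸ hC)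

/-- Together with `comp` this makes transport compatible with pointwise operations such as products;
it is the reason for allowing values in any measurable space. -/
theorem prodMk {ζ : X → Z'} {θ : Y → Z'} (hξ : Measurable ξ) (hζ : Measurable ζ)
    (h : S.Intertwines ξ η) (h' : S.Intertwines ζ θ) :
    S.Intertwines (fun x => (ξ x, ζ x)) (fun y => (η y, θ y)) := by
  refine of_generateFrom (hξ.prodMk hζ) generateFrom_prod.symm ?_
  rintro _ ⟨C, hC, C', hC', rfl⟩
  exact ((h C hC).inter (h' C' hC')).trans (S.inter (hξ hC) (hζ hC')).symm

theorem indicator {ξ : X → ℂ} {η : Y → ℂ} {F : Set X} (hξ : Measurable ξ) (hF : MeasurableSet F)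
    (h : S.Intertwines ξ η) : S.Intertwines (F.indicator ξ) ((S.toFun F).indicator η) := by
  intro C hC
  classical
  rw [Set.indicator_preimage, Set.indicator_preimage]
  -- Off `F` the indicator is the constant `0`, whose preimages are empty or everything.
  have h0 : S.toFun ((0 : X → ℂ) ⁻¹' C) =ᵐ[ν] ((0 : Y → ℂ) ⁻¹' C) := by
    by_cases hc : (0 : ℂ) ∈ C
    · have h1 : (0 : X → ℂ) ⁻¹' C = Set.univ := by ext; simp [hc]
      have h2 : (0 : Y → ℂ) ⁻¹' C = Set.univ := by ext; simp [hc]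
      rw [h1, h2]
      exact S.univ
    · have h1 : (0 : X → ℂ) ⁻¹' C = ∅ := by ext; simp [hc]
      have h2 : (0 : Y → ℂ) ⁻¹' C = ∅ := by ext; simp [hc]
      rw [h1, h2]
      exact S.empty
  refine Filter.EventuallyEq.trans ?_ (S.ite hF (hξ hC) (measurable_zero hC)).symm
  rw [Set.ite, Set.ite]
  exact ((h C hC).inter (.refl _ _)).union (h0.symm.diff (.refl _ _))

end Intertwines

end SetTransformation

/-! ### Spatial isomorphisms intertwine indicator functions -/

section Spatial

variable {X Y : Type u} [MeasurableSpace X] [MeasurableSpace Y] {p : ℝ≥0∞} [Fact (1 ≤ p)]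
  {μ : Measure X} {ν : Measure Y}

/-- An isometric isomorphism that intertwines multiplications by indicator functions. -/
structure IsLampertiIso (u : Lp ℂ p μ ≃ₗᵢ[ℂ] Lp ℂ p ν) : Prop where
  exists_image {F : Set X} (hF : MeasurableSet F) : ∃ (G : Set Y) (hG : MeasurableSet G),
    ∀ ξ, u (indicatorCLM p μ hF ξ) = indicatorCLM p ν hG (u ξ)
  exists_preimage {G : Set Y} (hG : MeasurableSet G) : ∃ (F : Set X) (hF : MeasurableSet F),
    ∀ ξ, u (indicatorCLM p μ hF ξ) = indicatorCLM p ν hG (u ξ)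

/-- The transport of `1_F ξ` is `1_{S(F)}` times that of `ξ`, by uniqueness of transports, and the
factor `h D^{1/p}` is pointwise. Preimages come from surjectivity of `S`. -/
theorem IsSpatialIso.isLampertiIso {u : Lp ℂ p μ ≃ₗᵢ[ℂ] Lp ℂ p ν} (hu : IsSpatialIso u) :
    IsLampertiIso u := by
  obtain ⟨S, h, D, hS, -, -, -, hform⟩ := hu
  have key {F : Set X} (hF : MeasurableSet F) (ξ : Lp ℂ p μ) :
      u (indicatorCLM p μ hF ξ) = indicatorCLM p ν (S.measurableSet F hF) (u ξ) := by
    obtain ⟨η, ⟨-, h1⟩, h2⟩ := hform ξ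
    obtain ⟨η', ⟨-, h1'⟩, h2'⟩ := hform (indicatorCLM p μ hF ξ)
    have h3 : S.Intertwines ξ η := h1
    have h3' : S.Intertwines (indicatorCLM p μ hF ξ) η' := h1'
    have h4 := (h3'.congr_left (Lp.stronglyMeasurable _).measurable ((Lp.stronglyMeasurable ξ).measurable.indicator hF)
      (indicatorCLM_ae hF ξ)).ae_eq (h3.indicator (Lp.stronglyMeasurable ξ).measurable hF)
    refine Lp.ext ?_
    filter_upwards [h2, h2', h4, indicatorCLM_ae (S.measurableSet F hF) (u ξ)] with y e1 e2 e3 e4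
    rw [e2, e4, e3]
    by_cases hy : y ∈ S.toFun F <;> simp [hy, e1]
  refine ⟨fun hF => ⟨_, _, key hF⟩, fun {G} hG => ?_⟩
  obtain ⟨F, hF, hFG⟩ := hS.2 G hG
  exact ⟨F, hF, fun ξ => by rw [key hF, indicatorCLM_congr _ hG hFG]⟩

end Spatial

/-! ### Isometries intertwining indicator functions are spatial -/

namespace IsLampertiIso

variable {X Y : Type u} [MeasurableSpace X] [MeasurableSpace Y] {p : ℝ≥0∞} [Fact (1 ≤ p)]
  {μ : Measure X} {ν : Measure Y} {u : Lp ℂ p μ ≃ₗᵢ[ℂ] Lp ℂ p ν}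

/-- The measurable set `F` of `X` corresponds under `u` to the measurable set `G` of `Y`. -/
def Corresp (u : Lp ℂ p μ ≃ₗᵢ[ℂ] Lp ℂ p ν) (F : Set X) (G : Set Y) : Prop :=
  ∃ (hF : MeasurableSet F) (hG : MeasurableSet G),
    ∀ ξ, u (indicatorCLM p μ hF ξ) = indicatorCLM p ν hG (u ξ)

/-! ### Calculus of corresponding sets -/

namespace Corresp

variable {F F' : Set X} {G G' : Set Y}

theorem symm (h : Corresp u F G) : Corresp u.symm G F := by
  obtain ⟨hF, hG, h⟩ := h
  exact ⟨hG, hF, fun ξ => by rw [LinearIsometryEquiv.symm_apply_eq, h,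
    LinearIsometryEquiv.apply_symm_apply]⟩

theorem inter (h : Corresp u F G) (h' : Corresp u F' G') : Corresp u (F ∩ F') (G ∩ G') := by
  obtain ⟨hF, hG, h⟩ := h
  obtain ⟨hF', hG', h'⟩ := h'
  refine ⟨hF.inter hF', hG.inter hG', fun ξ => ?_⟩
  rw [← indicatorCLM_mul hF hF', ← indicatorCLM_mul hG hG', mul_apply_eq_comp,
    mul_apply_eq_comp, h, h']

theorem compl (h : Corresp u F G) : Corresp u Fᶜ Gᶜ := by
  obtain ⟨hF, hG, h⟩ := h
  refine ⟨hF.compl, hG.compl, fun ξ => ?_⟩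
  rw [indicatorCLM_compl hF, indicatorCLM_compl hG, sub_apply, sub_apply, map_sub, h]
  rfl

theorem empty : Corresp u ∅ ∅ :=
  ⟨MeasurableSet.empty, MeasurableSet.empty, fun ξ => by
    rw [indicatorCLM_empty, indicatorCLM_empty]; exact map_zero u⟩

/-- Since `u` is onto, it determines the operator of `G` from that of `F`, and the operator
determines `G` modulo null sets. -/
theorem image_ae_eq [SigmaFinite ν] (hp : p ≠ ∞) (h : Corresp u F G) (h' : Corresp u F' G')
    (hFF : F =ᵐ[μ] F') : G =ᵐ[ν] G' := by
  obtain ⟨hF, hG, h⟩ := h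
  obtain ⟨hF', hG', h'⟩ := h'
  refine ae_eq_of_indicatorCLM_eq hp hG hG' ?_
  ext1 η
  obtain ⟨ξ, rfl⟩ := u.surjective η
  rw [← h, ← h', indicatorCLM_congr hF hF' hFF]

theorem image_ae_le [SigmaFinite ν] (hp : p ≠ ∞) (h : Corresp u F G) (h' : Corresp u F' G')
    (hFF : F ≤ᵐ[μ] F') : G ≤ᵐ[ν] G' := by
  have h1 : (F ∩ F' : Set X) =ᵐ[μ] F := by
    filter_upwards [hFF] with x hx
    exact propext ⟨fun hx => hx.1, fun hx' => ⟨hx', hx hx'⟩⟩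
  filter_upwards [(h.inter h').image_ae_eq hp h h1] with y hy hyG
  have : y ∈ G ∩ G' := hy.mpr hyG
  exact this.2

end Corresp

/-! ### The set transformation underlying an intertwining isometry -/

theorem symm (hu : IsLampertiIso u) : IsLampertiIso u.symm where
  exists_image hF := by
    obtain ⟨G, hG, h⟩ := hu.exists_preimage hF
    exact ⟨G, hG, (Corresp.symm ⟨hG, hF, h⟩).2.2⟩
  exists_preimage hF := by
    obtain ⟨G, hG, h⟩ := hu.exists_image hF
    exact ⟨G, hG, (Corresp.symm ⟨hF, hG, h⟩).2.2⟩

theorem exists_corresp (hu : IsLampertiIso u) {F : Set X} (hF : MeasurableSet F) :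
    ∃ G, Corresp u F G := by
  obtain ⟨G, hG, h⟩ := hu.exists_image hF
  exact ⟨G, hF, hG, h⟩

theorem exists_corresp' (hu : IsLampertiIso u) {G : Set Y} (hG : MeasurableSet G) :
    ∃ F, Corresp u F G := by
  obtain ⟨F, hF, h⟩ := hu.exists_preimage hG
  exact ⟨F, hF, hG, h⟩

open Classical in
/-- The set transformation underlying `u`. -/
noncomputable def image (hu : IsLampertiIso u) (F : Set X) : Set Y :=
  if hF : MeasurableSet F then (hu.exists_corresp hF).choose else ∅

theorem corresp_image (hu : IsLampertiIso u) {F : Set X} (hF : MeasurableSet F) :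
    Corresp u F (hu.image F) := by
  rw [image, dif_pos hF]
  exact (hu.exists_corresp hF).choose_spec

/-- The correspondence is monotone in both directions, hence an order isomorphism modulo null sets,
and so respects countable suprema. The set `K` pulls back the union of the images, and it dominates
every `A n`. -/
theorem image_iUnion [SigmaFinite μ] [SigmaFinite ν] (hp : p ≠ ∞) (hu : IsLampertiIso u)
    (A : ℕ → Set X) (hA : ∀ n, MeasurableSet (A n)) :
    hu.image (⋃ n, A n) =ᵐ[ν] ⋃ n, hu.image (A n) := by
  have hU := hu.corresp_image (MeasurableSet.iUnion hA)
  have hn n := hu.corresp_image (hA n)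
  obtain ⟨K, hK⟩ := hu.exists_corresp' (MeasurableSet.iUnion fun n => (hn n).2.1)
  have h1 : ∀ n, A n ≤ᵐ[μ] K := fun n => (hn n).symm.image_ae_le hp hK.symm
    (Filter.Eventually.of_forall fun y hy => Set.mem_iUnion_of_mem n hy)
  have h2 : (⋃ n, A n) ≤ᵐ[μ] K := by
    filter_upwards [ae_all_iff.mpr h1] with x hx hxU
    obtain ⟨n, hxn⟩ := Set.mem_iUnion.mp hxU
    exact hx n hxn
  have h3 : ∀ n, hu.image (A n) ≤ᵐ[ν] hu.image (⋃ n, A n) := fun n => (hn n).image_ae_le hp hU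
    (Filter.Eventually.of_forall fun y hy => Set.mem_iUnion_of_mem n hy)
  refine (hU.image_ae_le hp hK h2).antisymm ?_
  filter_upwards [ae_all_iff.mpr h3] with x hx hxU
  obtain ⟨n, hxn⟩ := Set.mem_iUnion.mp hxU
  exact hx n hxn

/-- The set transformation underlying `u`. -/
noncomputable def setTransformation [SigmaFinite μ] [SigmaFinite ν] (hp : p ≠ ∞)
    (hu : IsLampertiIso u) : SetTransformation μ ν where
  toFun := hu.image
  measurableSet _ hA := (hu.corresp_image hA).2.1
  congr _ _ hA hB hAB := (hu.corresp_image hA).image_ae_eq hp (hu.corresp_image hB) hAB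
  compl _ hA := (hu.corresp_image hA.compl).image_ae_eq hp (hu.corresp_image hA).compl (.refl _ _)
  iUnion := hu.image_iUnion hp

/-- `u` transports the measure `|ω|^p μ` to the measure `|u(ω)|^p ν`. -/
theorem setLIntegral_image (hp : p ≠ ∞) (hu : IsLampertiIso u) (ω : Lp ℂ p μ) {F : Set X}
    (hF : MeasurableSet F) :
    ∫⁻ y in hu.image F, ‖u ω y‖ₑ ^ p.toReal ∂ν = ∫⁻ x in F, ‖ω x‖ₑ ^ p.toReal ∂μ := by
  have hpr : 0 < p.toReal :=
    ENNReal.toReal_pos (zero_lt_one.trans_le (Fact.out : 1 ≤ p)).ne' hp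
  have hset {Z : Type u} [MeasurableSpace Z] {κ : Measure Z} (f : Lp ℂ p κ) {A : Set Z}
      (hA : MeasurableSet A) : ∫⁻ z, ‖indicatorCLM p κ hA f z‖ₑ ^ p.toReal ∂κ =
        ∫⁻ z in A, ‖f z‖ₑ ^ p.toReal ∂κ := by
    rw [← lintegral_indicator hA]
    refine lintegral_congr_ae ?_
    filter_upwards [indicatorCLM_ae hA f] with z hz
    rw [hz]
    by_cases h : z ∈ A <;> simp [h, hpr]
  have hG := hu.corresp_image hF
  -- Both sides become `p`-th powers of norms: those of `u (1_F ω)` and of `1_F ω`.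
  rw [← hset (u ω) hG.2.1, ← hset ω hF, ← hG.2.2]
  have := u.norm_map (indicatorCLM p μ hF ω)
  exact le_antisymm ((norm_le_norm_iff_lintegral hp _ _).mp this.le)
    ((norm_le_norm_iff_lintegral hp _ _).mp this.ge)

/-! ### Lamperti's argument: quotients, phase and density -/

variable [SigmaFinite ν]

/-- The zero set of `u ω` corresponds to a set `F` with `1_F ω = 0`, which is null because `ω`
vanishes almost nowhere. -/
theorem ae_apply_ne_zero (hp : p ≠ ∞) (hu : IsLampertiIso u) {ω : Lp ℂ p μ}
    (hω : ∀ᵐ x ∂μ, ω x ≠ 0) : ∀ᵐ y ∂ν, u ω y ≠ 0 := by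
  have hZ : MeasurableSet {y | u ω y = 0} :=
    (Lp.stronglyMeasurable (u ω)).measurable (measurableSet_singleton 0)
  obtain ⟨F, hF⟩ := hu.exists_corresp' hZ
  have h0 : indicatorCLM p μ hF.1 ω = 0 := by
    refine u.injective ?_
    rw [map_zero, hF.2.2]
    refine Lp.ext ?_
    filter_upwards [indicatorCLM_ae hZ (u ω), Lp.coeFn_zero ℂ p ν] with y h1 h2
    rw [h1, h2]
    by_cases hy : u ω y = 0
    · rw [Set.indicator_of_mem (show y ∈ {y | u ω y = 0} from hy), hy]; rfl
    · exact Set.indicator_of_notMem (s := {y | u ω y = 0}) hy _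
  have hF0 : F =ᵐ[μ] (∅ : Set X) := by
    filter_upwards [indicatorCLM_ae hF.1 ω, Lp.coeFn_zero ℂ p μ, hω] with x h1 h2 h3
    refine propext ⟨fun hx => ?_, False.elim⟩
    have hx : x ∈ F := hx
    rw [h0, h2, Set.indicator_of_mem hx] at h1
    exact h3 h1.symm
  filter_upwards [hF.image_ae_eq hp .empty hF0] with y hy hy0
  exact hy.mp hy0

variable [SigmaFinite μ]

theorem isBijective_setTransformation (hp : p ≠ ∞) (hu : IsLampertiIso u) :
    (hu.setTransformation hp).IsBijective := by
  refine ⟨fun A B hA hB h => ?_, fun B hB => ?_⟩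
  · exact (hu.corresp_image hA).symm.image_ae_eq hp (hu.corresp_image hB).symm h
  · obtain ⟨F, hF⟩ := hu.exists_corresp' hB
    exact ⟨F, hF.1, (hu.corresp_image hF.1).image_ae_eq hp hF (.refl _ _)⟩

/-- The set where `ξ` is strictly dominated by `η` is mapped to the corresponding set. -/
theorem image_lt_ae_le (hp : p ≠ ∞) (hu : IsLampertiIso u) (ξ η : Lp ℂ p μ) {G : Set Y}
    (hG : Corresp u {x | ‖ξ x‖ < ‖η x‖} G) : G ≤ᵐ[ν] {y | ‖u ξ y‖ < ‖u η y‖} := by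
  set K := {y | ‖u ξ y‖ < ‖u η y‖}
  have hK : MeasurableSet K := measurableSet_lt (Lp.stronglyMeasurable _).measurable.norm
    (Lp.stronglyMeasurable _).measurable.norm
  -- The exceptional set `G \ K` must be shown null. On it `|u η| ≤ |u ξ|`, so `1_F η` has at most
  -- the norm of `1_F ξ`; but `|ξ| < |η|` on `F`. For `p < ∞` this forces `F` to be null.
  obtain ⟨F, hF⟩ := hu.exists_corresp' (hG.2.1.diff hK)
  have hFle : F ≤ᵐ[μ] {x | ‖ξ x‖ < ‖η x‖} := hF.symm.image_ae_le hp hG.symm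
    (Filter.Eventually.of_forall fun y hy => hy.1)
  have hnorm : ‖indicatorCLM p μ hF.1 η‖ ≤ ‖indicatorCLM p μ hF.1 ξ‖ := by
    rw [← u.norm_map, ← u.norm_map (indicatorCLM p μ hF.1 ξ), hF.2.2, hF.2.2]
    refine Lp.norm_le_norm_of_ae_le ?_
    filter_upwards [indicatorCLM_ae hF.2.1 (u ξ), indicatorCLM_ae hF.2.1 (u η)] with y h1 h2
    rw [h1, h2]
    by_cases hy : y ∈ G \ K
    · rw [Set.indicator_of_mem hy, Set.indicator_of_mem hy]
      exact not_lt.mp hy.2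
    · simp [Set.indicator_of_notMem hy]
  have hle : ∀ᵐ x ∂μ, ‖indicatorCLM p μ hF.1 ξ x‖ₑ ≤ ‖indicatorCLM p μ hF.1 η x‖ₑ := by
    filter_upwards [indicatorCLM_ae hF.1 ξ, indicatorCLM_ae hF.1 η, hFle] with x h1 h2 h3
    rw [h1, h2]
    by_cases hx : x ∈ F
    · rw [Set.indicator_of_mem hx, Set.indicator_of_mem hx]
      exact enorm_le_iff_norm_le.mpr (le_of_lt (h3 hx))
    · simp [Set.indicator_of_notMem hx]
  have hF0 : F =ᵐ[μ] (∅ : Set X) := by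
    filter_upwards [ae_enorm_eq_of_norm_le hp hle hnorm, indicatorCLM_ae hF.1 ξ,
      indicatorCLM_ae hF.1 η, hFle] with x h0 h1 h2 h3
    refine propext ⟨fun hx => ?_, False.elim⟩
    have hx : x ∈ F := hx
    rw [h1, h2, Set.indicator_of_mem hx, Set.indicator_of_mem hx, enorm_eq_iff_norm_eq] at h0
    exact absurd h0 (ne_of_lt (h3 hx))
  filter_upwards [hF.image_ae_eq hp .empty hF0] with y hy hyG
  by_contra hyK
  exact hy.mp ⟨hyG, hyK⟩

/-- The reverse inclusion is the one-sided statement for `u.symm`. -/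
theorem image_lt_ae_eq (hp : p ≠ ∞) (hu : IsLampertiIso u) (ξ η : Lp ℂ p μ) {G : Set Y}
    (hG : Corresp u {x | ‖ξ x‖ < ‖η x‖} G) : {y | ‖u ξ y‖ < ‖u η y‖} =ᵐ[ν] G := by
  have hK : MeasurableSet {y | ‖u ξ y‖ < ‖u η y‖} := measurableSet_lt
    (Lp.stronglyMeasurable _).measurable.norm (Lp.stronglyMeasurable _).measurable.norm
  obtain ⟨F, hF⟩ := hu.exists_corresp' hK
  refine Filter.EventuallyLE.antisymm ?_ (hu.image_lt_ae_le hp ξ η hG)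
  have := hu.symm.image_lt_ae_le hp (u ξ) (u η) hF.symm
  simp only [LinearIsometryEquiv.symm_apply_apply] at this
  exact hF.image_ae_le hp hG this

/-- Discs are the convenient generators: that `ξ/ω` lies in a disc is a strict domination between
two combinations of `ξ` and `ω`. -/
theorem _root_.Complex.measurableSpace_eq_generateFrom_ball :
    (inferInstance : MeasurableSpace ℂ) =
      MeasurableSpace.generateFrom {C | ∃ (c : ℂ) (r : ℝ), 0 < r ∧ C = Metric.ball c r} := by
  rw [BorelSpace.measurable_eq (α := ℂ)]
  refine TopologicalSpace.IsTopologicalBasis.borel_eq_generateFrom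
    (TopologicalSpace.isTopologicalBasis_of_isOpen_of_nhds ?_ ?_)
  · rintro _ ⟨c, r, -, rfl⟩
    exact Metric.isOpen_ball
  · intro a U ha hU
    obtain ⟨r, hr, h⟩ := Metric.isOpen_iff.mp hU a ha
    exact ⟨_, ⟨a, r, hr, rfl⟩, Metric.mem_ball_self hr, h⟩

/-- Where `ω ≠ 0`, `ξ/ω` lies in the disc of centre `c` and radius `r` iff `|ξ - c ω| < |r ω|`. By
linearity of `u` the same inequality describes `u ξ / u ω`, and `u` preserves such domination sets.
-/
theorem intertwines_div (hp : p ≠ ∞) (hu : IsLampertiIso u) {ω : Lp ℂ p μ}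
    (hω : ∀ᵐ x ∂μ, ω x ≠ 0) (ξ : Lp ℂ p μ) :
    (hu.setTransformation hp).Intertwines (fun x => ξ x / ω x) (fun y => u ξ y / u ω y) := by
  have hm (ζ : Lp ℂ p μ) : Measurable ζ := (Lp.stronglyMeasurable ζ).measurable
  have hq : Measurable fun x => ξ x / ω x := (hm ξ).div (hm ω)
  refine .of_generateFrom hq Complex.measurableSpace_eq_generateFrom_ball ?_
  rintro _ ⟨c, r, hr, rfl⟩
  have hball {z w : ℂ} (hw : w ≠ 0) :
      z / w ∈ Metric.ball c r ↔ ‖z - c * w‖ < ‖(r : ℂ) * w‖ := by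
    rw [mem_ball_iff_norm, div_sub' hw, norm_div, div_lt_iff₀ (norm_pos_iff.mpr hw), norm_mul,
      Complex.norm_real, Real.norm_of_nonneg hr.le, mul_comm w]
  have hset {Z : Type u} [MeasurableSpace Z] {κ : Measure Z} (f g : Lp ℂ p κ)
      (hg : ∀ᵐ z ∂κ, g z ≠ 0) : (fun z => f z / g z) ⁻¹' Metric.ball c r =ᵐ[κ]
        {z | ‖(f - c • g) z‖ < ‖((r : ℂ) • g) z‖} := by
    filter_upwards [hg, Lp.coeFn_sub f (c • g), Lp.coeFn_smul c g, Lp.coeFn_smul (r : ℂ) g] with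
      z h0 h1 h2 h3
    refine propext ((hball h0).trans ?_)
    change _ ↔ ‖(f - c • g) z‖ < ‖((r : ℂ) • g) z‖
    rw [h1, Pi.sub_apply, h2, h3]
    rfl
  have hE : MeasurableSet {z | ‖(ξ - c • ω) z‖ < ‖((r : ℂ) • ω) z‖} :=
    measurableSet_lt (hm _).norm (hm _).norm
  refine (hset (u ξ) (u ω) (hu.ae_apply_ne_zero hp hω)).trans ?_
  rw [← map_smul, ← map_smul, ← map_sub]
  refine (hu.image_lt_ae_eq hp _ _ (hu.corresp_image hE)).trans ?_
  exact (hu.setTransformation hp).congr _ _ hE (hq measurableSet_ball) (hset ξ ω hω).symm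

/-- Fix a positive `w ≤ 1` in `L^p`, with class `ω`, and put `g = u ω`. Then `u ξ = g · S_*(ξ/w)`,
so with `k = S_*(w)` one has `u ξ = (g/k) · S_*(ξ)`. As `k > 0`, the phase is `g/|g|` and the
density is `|g/k|^p`. -/
theorem isSpatialIso (hp : p ≠ ∞) (hu : IsLampertiIso u) : IsSpatialIso u := by
  have hpr : 0 < p.toReal :=
    ENNReal.toReal_pos (zero_lt_one.trans_le (Fact.out : 1 ≤ p)).ne' hp
  obtain ⟨w, hwm, hw0, hw1, hwL⟩ := exists_pos_memLp (p := p) μ hp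
  -- The function `w` has to be written as a quotient `w²/w` of elements of `L^p` for its transport
  -- to be computed; `w ≤ 1` puts `w²` in `L^p`.
  have hwL2 : MemLp (fun x => (w x : ℂ) * w x) p μ := by
    refine hwL.mono (by fun_prop) (Filter.Eventually.of_forall fun x => ?_)
    rw [norm_mul]
    refine mul_le_of_le_one_left (norm_nonneg _) ?_
    rw [Complex.norm_real, Real.norm_of_nonneg (hw0 x).le]
    exact hw1 x
  have hwC (x : X) : (w x : ℂ) ≠ 0 := by exact_mod_cast (hw0 x).ne'
  set S := hu.setTransformation hp
  set ω : Lp ℂ p μ := hwL.toLp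
  have hω : (ω : X → ℂ) =ᵐ[μ] fun x => (w x : ℂ) := hwL.coeFn_toLp
  have hω0 : ∀ᵐ x ∂μ, ω x ≠ 0 := by
    filter_upwards [hω] with x hx
    rw [hx]
    exact hwC x
  have hm {Z : Type u} [MeasurableSpace Z] {κ : Measure Z} (f : Lp ℂ p κ) : Measurable f :=
    (Lp.stronglyMeasurable f).measurable
  set g : Y → ℂ := fun y => u ω y
  have hg0 : ∀ᵐ y ∂ν, g y ≠ 0 := hu.ae_apply_ne_zero hp hω0
  have hgm : Measurable g := hm _
  set k : Y → ℂ := fun y => u hwL2.toLp y / g y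
  have hkm : Measurable k := (hm _).div hgm
  have hk : S.Intertwines (fun x => (w x : ℂ)) k := by
    refine (hu.intertwines_div hp hω0 hwL2.toLp).congr_left ((hm _).div (hm _)) (by fun_prop) ?_
    filter_upwards [hω, hwL2.coeFn_toLp] with x h1 h2
    rw [Pi.div_apply, h1, h2, mul_div_cancel_right₀ _ (hwC x)]
  -- Positivity is a condition on the values, so it passes from `w` to its transport `k`.
  have hkpos : ∀ᵐ y ∂ν, k y = (‖k y‖ : ℂ) ∧ k y ≠ 0 := by
    have hC : MeasurableSet {z : ℂ | z = (‖z‖ : ℂ) ∧ z ≠ 0} :=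
      (measurableSet_eq_fun measurable_id (by fun_prop)).inter
        (measurableSet_singleton (0 : ℂ)).compl
    have h1 := hk _ hC
    have h2 : (fun x => (w x : ℂ)) ⁻¹' {z : ℂ | z = (‖z‖ : ℂ) ∧ z ≠ 0} = Set.univ := by
      refine Set.eq_univ_of_forall fun x => ⟨?_, hwC x⟩
      rw [Complex.norm_real, Real.norm_of_nonneg (hw0 x).le]
    rw [h2] at h1
    filter_upwards [h1.trans S.univ] with y hy
    exact hy.mpr trivial
  -- The value `1` where `g = 0` is immaterial: that set is null.
  refine ⟨S, fun y => if g y = 0 then 1 else g y / ‖g y‖,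
    fun y => ‖g y‖ₑ ^ p.toReal * (‖k y‖ₑ ^ p.toReal)⁻¹, hu.isBijective_setTransformation hp,
    ?_, ?_, ⟨by fun_prop, fun F hF => ?_⟩, fun ξ => ?_⟩
  · exact Measurable.ite (hgm (measurableSet_singleton 0)) measurable_const (by fun_prop)
  · filter_upwards [hg0] with y hy
    rw [if_neg hy, norm_div, Complex.norm_real, norm_norm, div_self (norm_ne_zero_iff.mpr hy)]
  · have hwm' : Measurable fun x => (w x : ℂ) := by fun_prop
    -- The measures `|g|^p ν` on `S(F)` and `|ω|^p μ` on `F` have the same image in `ℂ` under `k`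
    -- and `w`, because `u` is isometric on indicator pieces of `ω`. Integrating `|z|^{-p}` against
    -- this image gives `∫_{S(F)} |g/k|^p dν = ∫_F |ω/w|^p dμ = μ(F)`.
    have hmap : ((ν.restrict (S.toFun F)).withDensity fun y => ‖g y‖ₑ ^ p.toReal).map k =
        ((μ.restrict F).withDensity fun x => ‖ω x‖ₑ ^ p.toReal).map fun x => (w x : ℂ) := by
      ext C hC
      have hFC : MeasurableSet (F ∩ (fun x => (w x : ℂ)) ⁻¹' C) := hF.inter (hwm' hC)
      rw [Measure.map_apply hkm hC, Measure.map_apply hwm' hC, withDensity_apply _ (hkm hC),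
        withDensity_apply _ (hwm' hC), Measure.restrict_restrict (hkm hC),
        Measure.restrict_restrict (hwm' hC), Set.inter_comm _ F,
        ← hu.setLIntegral_image hp ω hFC]
      refine setLIntegral_congr ?_
      rw [Set.inter_comm]
      exact ((Filter.EventuallyEq.refl _ _).inter (hk C hC)).trans
        (S.inter hF (hwm' hC)).symm
    have hφ : Measurable fun z : ℂ => (‖z‖ₑ ^ p.toReal)⁻¹ := by fun_prop
    have h1 := congrArg (fun κ : Measure ℂ => ∫⁻ z, (‖z‖ₑ ^ p.toReal)⁻¹ ∂κ) hmap
    rw [lintegral_map hφ hkm, lintegral_map hφ hwm',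
      lintegral_withDensity_eq_lintegral_mul _ (hgm.enorm.pow_const _)
        (by fun_prop : Measurable fun y => (‖k y‖ₑ ^ p.toReal)⁻¹),
      lintegral_withDensity_eq_lintegral_mul _ ((hm ω).enorm.pow_const _)
        (by fun_prop : Measurable fun x => (‖(w x : ℂ)‖ₑ ^ p.toReal)⁻¹)] at h1
    refine h1.trans ?_
    rw [← setLIntegral_one]
    refine lintegral_congr_ae ?_
    filter_upwards [ae_restrict_of_ae hω] with x hx
    change ‖ω x‖ₑ ^ p.toReal * (‖(w x : ℂ)‖ₑ ^ p.toReal)⁻¹ = 1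
    rw [hx]
    refine ENNReal.mul_inv_cancel ?_ (by simp [hpr.le])
    rw [Ne, ENNReal.rpow_eq_zero_iff_of_pos hpr, enorm_eq_zero]
    exact hwC x
  -- The transport of `ξ = (ξ/ω) · w` is the product of the two transports.
  · refine ⟨fun y => u ξ y / g y * k y, ⟨((hm _).div hgm).mul hkm, ?_⟩, ?_⟩
    · have h1 := ((hu.intertwines_div hp hω0 ξ).prodMk ((hm _).div (hm _)) (by fun_prop) hk).comp
        (φ := fun z : ℂ × ℂ => z.1 * z.2) (by fun_prop)
      refine h1.congr_left (((hm _).div (hm _)).mul (by fun_prop)) (hm ξ) ?_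
      filter_upwards [hω] with x hx
      change ξ x / ω x * (w x : ℂ) = ξ x
      rw [hx]
      exact div_mul_cancel₀ _ (hwC x)
    · filter_upwards [hg0, hkpos] with y h1 ⟨h2, h3⟩
      have hD : (‖g y‖ₑ ^ p.toReal * (‖k y‖ₑ ^ p.toReal)⁻¹).toReal ^ (1 / p.toReal) =
          ‖g y‖ / ‖k y‖ := by
        rw [ENNReal.toReal_mul, ENNReal.toReal_inv, ← ENNReal.toReal_rpow, ← ENNReal.toReal_rpow,
          toReal_enorm, toReal_enorm, ← Real.inv_rpow (norm_nonneg _),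
          ← Real.mul_rpow (norm_nonneg _) (by positivity), one_div,
          Real.rpow_rpow_inv (by positivity) hpr.ne', div_eq_mul_inv]
      have h4 : (‖g y‖ : ℂ) ≠ 0 := by exact_mod_cast norm_ne_zero_iff.mpr h1
      have h5 : (‖k y‖ : ℂ) ≠ 0 := by exact_mod_cast norm_ne_zero_iff.mpr h3
      have h6 : u ξ y / g y * k y = u ξ y / g y * (‖k y‖ : ℂ) := by rw [← h2]
      rw [hD, if_neg h1, Complex.ofReal_div, h6]
      field_simp

end IsLampertiIso

/-! ### Spatial partial isometries are exactly the Lamperti pairs -/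

section Spatial

variable {X : Type u} [MeasurableSpace X] {p : ℝ≥0∞} [Fact (1 ≤ p)] {μ : Measure X}
  {s t : Lp ℂ p μ →L[ℂ] Lp ℂ p μ}

theorem isCompression_iff {A B : Set X} (hB : MeasurableSet B)
    {u : Lp ℂ p (μ.restrict A) ≃ₗᵢ[ℂ] Lp ℂ p (μ.restrict B)} :
    IsCompression A B u s ↔
      ∀ ξ, s ξ = extendByZero p μ hB (u (LpToLpRestrictCLM X ℂ ℂ μ p A ξ)) :=
  forall_congr' fun _ => ⟨fun h => Lp.ext (h.trans (extendByZero_ae hB _).symm),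
    fun h => h ▸ extendByZero_ae hB _⟩

theorem extendByZero_indicatorCLM {A F : Set X} (hA : MeasurableSet A) (hF : MeasurableSet F)
    (ξ : Lp ℂ p (μ.restrict A)) :
    extendByZero p μ hA (indicatorCLM p (μ.restrict A) hF ξ) =
      indicatorCLM p μ hF (extendByZero p μ hA ξ) := by
  conv_lhs => rw [← restrict_extendByZero hA ξ, ← restrict_indicatorCLM_comm,
    extendByZero_restrict]
  rw [← mul_apply_eq_comp, indicatorCLM_mul_comm, mul_apply_eq_comp, indicatorCLM_extendByZero]

/-- If `u` carries `F` to `G`, conjugation carries the operator of `F` to that of `B ∩ G`. -/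
theorem IsLampertiIso.isIndicator_conj {A B : Set X} (hA : MeasurableSet A) (hB : MeasurableSet B)
    {u : Lp ℂ p (μ.restrict A) ≃ₗᵢ[ℂ] Lp ℂ p (μ.restrict B)} (hu : IsLampertiIso u)
    (hs : ∀ ξ, s ξ = extendByZero p μ hB (u (LpToLpRestrictCLM X ℂ ℂ μ p A ξ)))
    (ht : ∀ ξ, t ξ = extendByZero p μ hA (u.symm (LpToLpRestrictCLM X ℂ ℂ μ p B ξ)))
    {T : Lp ℂ p μ →L[ℂ] Lp ℂ p μ} (hT : IsIndicator T) : IsIndicator (s * T * t) := by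
  obtain ⟨F, hF, rfl⟩ := hT
  obtain ⟨G, hG, h⟩ := hu.exists_image hF
  refine ⟨_, hB.inter hG, ?_⟩
  rw [← indicatorCLM_mul hB hG]
  ext1 ξ
  simp only [mul_apply_eq_comp, hs, ht, restrict_indicatorCLM_comm, restrict_extendByZero, h,
    LinearIsometryEquiv.apply_symm_apply]
  rw [← restrict_indicatorCLM_comm, extendByZero_restrict]

theorem IsSpatialWithReverse.isLampertiPair (h : IsSpatialWithReverse s t) :
    IsLampertiPair s t := by
  obtain ⟨A, B, u, hA, hB, hu, hs, ht⟩ := h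
  have hs' := (isCompression_iff hB).mp hs
  have ht' := (isCompression_iff hA).mp ht
  exact
    { left := by
        ext1 ξ
        simp only [mul_apply_eq_comp, hs', ht', restrict_extendByZero,
          LinearIsometryEquiv.symm_apply_apply]
      right := by
        ext1 ξ
        simp only [mul_apply_eq_comp, hs', ht', restrict_extendByZero,
          LinearIsometryEquiv.apply_symm_apply]
      norm_left := hs.norm_le_one hB
      norm_right := ht.norm_le_one hA
      conj_left := hu.isLampertiIso.isIndicator_conj hA hB hs' ht'
      conj_right := hu.isLampertiIso.symm.isIndicator_conj hB hA ht' hs' }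

namespace IsLampertiPair

theorem restrict_apply_apply (h : IsLampertiPair s t) {A B : Set X} (hA : MeasurableSet A)
    (hB : MeasurableSet B) (hts : t * s = indicatorCLM p μ hA) (hst : s * t = indicatorCLM p μ hB)
    (η : Lp ℂ p (μ.restrict B)) :
    LpToLpRestrictCLM X ℂ ℂ μ p B (s (extendByZero p μ hA (LpToLpRestrictCLM X ℂ ℂ μ p A
      (t (extendByZero p μ hB η))))) = η := by
  have h1 : s (t (s (t (extendByZero p μ hB η)))) = s (t (extendByZero p μ hB η)) :=
    congrArg (fun T : Lp ℂ p μ →L[ℂ] Lp ℂ p μ => T (t (extendByZero p μ hB η))) h.left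
  rw [extendByZero_restrict, ← hts, mul_apply_eq_comp, h1, ← mul_apply_eq_comp, hst,
    indicatorCLM_extendByZero, restrict_extendByZero]

theorem norm_restrict_apply_le {A B : Set X} (hA : MeasurableSet A) (hs : ‖s‖ ≤ 1)
    (ξ : Lp ℂ p (μ.restrict A)) :
    ‖LpToLpRestrictCLM X ℂ ℂ μ p B (s (extendByZero p μ hA ξ))‖ ≤ ‖ξ‖ := by
  refine (norm_Lp_toLp_restrict_le B _).trans ((s.le_of_opNorm_le hs _).trans_eq ?_)
  rw [one_mul, LinearIsometry.norm_map]

/-- The isometric isomorphism of which the partial isometry `s` is the compression. -/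
noncomputable def restrictEquiv (h : IsLampertiPair s t) {A B : Set X} (hA : MeasurableSet A)
    (hB : MeasurableSet B) (hts : t * s = indicatorCLM p μ hA)
    (hst : s * t = indicatorCLM p μ hB) :
    Lp ℂ p (μ.restrict A) ≃ₗᵢ[ℂ] Lp ℂ p (μ.restrict B) where
  toLinearEquiv := LinearEquiv.ofLinearMap
    ((LpToLpRestrictCLM X ℂ ℂ μ p B ∘L s ∘L
      (extendByZero p μ hA).toContinuousLinearMap : _ →L[ℂ] _) : _ →ₗ[ℂ] _)
    ((LpToLpRestrictCLM X ℂ ℂ μ p A ∘L t ∘L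
      (extendByZero p μ hB).toContinuousLinearMap : _ →L[ℂ] _) : _ →ₗ[ℂ] _)
    (LinearMap.ext fun η => h.restrict_apply_apply hA hB hts hst η)
    (LinearMap.ext fun ξ => h.symm.restrict_apply_apply hB hA hst hts ξ)
  norm_map' ξ := by
    -- A contraction with a contractive inverse is isometric.
    refine le_antisymm (norm_restrict_apply_le hA h.norm_left ξ) ?_
    conv_lhs => rw [← h.symm.restrict_apply_apply hB hA hst hts ξ]
    exact norm_restrict_apply_le hB h.norm_right _

theorem restrictEquiv_apply (h : IsLampertiPair s t) {A B : Set X} (hA : MeasurableSet A)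
    (hB : MeasurableSet B) (hts : t * s = indicatorCLM p μ hA)
    (hst : s * t = indicatorCLM p μ hB) (ξ : Lp ℂ p (μ.restrict A)) :
    h.restrictEquiv hA hB hts hst ξ =
      LpToLpRestrictCLM X ℂ ℂ μ p B (s (extendByZero p μ hA ξ)) := rfl

theorem restrictEquiv_symm_apply (h : IsLampertiPair s t) {A B : Set X} (hA : MeasurableSet A)
    (hB : MeasurableSet B) (hts : t * s = indicatorCLM p μ hA)
    (hst : s * t = indicatorCLM p μ hB) (η : Lp ℂ p (μ.restrict B)) :
    (h.restrictEquiv hA hB hts hst).symm η =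
      LpToLpRestrictCLM X ℂ ℂ μ p A (t (extendByZero p μ hB η)) := rfl

theorem isLampertiIso_restrictEquiv (h : IsLampertiPair s t) {A B : Set X} (hA : MeasurableSet A)
    (hB : MeasurableSet B) (hts : t * s = indicatorCLM p μ hA)
    (hst : s * t = indicatorCLM p μ hB) : IsLampertiIso (h.restrictEquiv hA hB hts hst) where
  exists_image {F} hF := by
    obtain ⟨G, hG, hFG⟩ := h.conj_left (isIndicator_indicatorCLM hF)
    refine ⟨G, hG, fun ξ => ?_⟩
    rw [restrictEquiv_apply, restrictEquiv_apply, extendByZero_indicatorCLM,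
      ← restrict_indicatorCLM_comm, ← hFG, mul_apply_eq_comp, mul_apply_eq_comp,
      ← mul_apply_eq_comp t s, hts, indicatorCLM_extendByZero]
  exists_preimage {G} hG := by
    obtain ⟨F, hF, hFG⟩ := h.conj_right (isIndicator_indicatorCLM hG)
    refine ⟨F, hF, fun ξ => ?_⟩
    rw [restrictEquiv_apply, restrictEquiv_apply, extendByZero_indicatorCLM,
      ← restrict_indicatorCLM_comm, ← hFG, mul_apply_eq_comp, mul_apply_eq_comp,
      ← mul_apply_eq_comp s t, hst, restrict_indicatorCLM]

/-- The sets `A` and `B` are those of the indicator operators `t * s` and `s * t`; between them `s`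
restricts to an isometric isomorphism intertwining indicator functions, which is spatial by
Lamperti's argument. -/
theorem isSpatialWithReverse [SigmaFinite μ] (hp : p ≠ ∞) (h : IsLampertiPair s t) :
    IsSpatialWithReverse s t := by
  obtain ⟨A, hA, hts⟩ := h.isIndicator_right
  obtain ⟨B, hB, hst⟩ := h.isIndicator_left
  refine ⟨A, B, h.restrictEquiv hA hB hts hst, hA, hB,
    (h.isLampertiIso_restrictEquiv hA hB hts hst).isSpatialIso hp,
    (isCompression_iff hB).mpr fun ξ => ?_, (isCompression_iff hA).mpr fun ξ => ?_⟩
  · rw [restrictEquiv_apply, extendByZero_restrict, extendByZero_restrict, ← hts, ← hst,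
      ← mul_apply_eq_comp, ← mul_apply_eq_comp, ← mul_assoc, h.left, h.left]
  · rw [restrictEquiv_symm_apply, extendByZero_restrict, extendByZero_restrict, ← hts, ← hst,
      ← mul_apply_eq_comp, ← mul_apply_eq_comp, ← mul_assoc, h.right, h.right]

end IsLampertiPair

theorem isIndicator_iff [SigmaFinite μ] (hp : p ≠ ∞) :
    IsIndicator s ↔ IsIdempotentElem s ∧ IsSpatialPartialIsometry s :=
  ⟨fun h => ⟨h.mul_self, s, (IsLampertiPair.of_isIndicator h).isSpatialWithReverse hp⟩,
    fun ⟨h, _, ht⟩ => ht.isLampertiPair.isIndicator_of_isIdempotentElem hp h⟩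

/-- The working definition of a spatial representation in the comparison of seminorms: both
conditions on the right are stable under products and matrix units. -/
theorem OrientedGraph.isSpatialRep_iff [SigmaFinite μ] (hp : p ≠ ∞) {V E : Type u}
    {Q : OrientedGraph V E} {ρ : Q.Leavitt →ₙₐ[ℂ] (Lp ℂ p μ →L[ℂ] Lp ℂ p μ)} :
    IsSpatialRep ρ ↔ (∀ v, IsIndicator (ρ (Leavitt.vert Q v))) ∧
      ∀ e, IsLampertiPair (ρ (Leavitt.edge Q e)) (ρ (Leavitt.ghost Q e)) :=
  ⟨fun h => ⟨fun v => (isIndicator_iff hp).mpr (h.vert v), fun e => (h.edge e).isLampertiPair⟩,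
    fun h => ⟨fun v => (isIndicator_iff hp).mp (h.1 v),
      fun e => (h.2 e).isSpatialWithReverse hp⟩⟩

end Spatial

/-! ### Countably many copies of an `L^p`-space -/

section Copies

variable {X : Type u} [MeasurableSpace X] {p : ℝ≥0∞} [Fact (1 ≤ p)] {μ : Measure X}

/-- The `n`-th copy of `X` in `X × ℕ`. -/
def copySet (X : Type u) (n : ℕ) : Set (X × ℕ) := Prod.snd ⁻¹' {n}

theorem measurableSet_copySet (n : ℕ) : MeasurableSet (copySet X n) :=
  measurable_snd (measurableSet_singleton n)

theorem restrict_copySet [SigmaFinite μ] (n : ℕ) :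
    (μ.prod Measure.count).restrict (copySet X n) = μ.map fun x => (x, n) := by
  have h : copySet X n = Set.univ ×ˢ {n} := by ext; simp [copySet]
  rw [h, ← Measure.prod_restrict, Measure.restrict_univ, Measure.restrict_singleton,
    Measure.count_singleton, one_smul, Measure.prod_dirac]

theorem measurePreserving_mk [SigmaFinite μ] (n : ℕ) : MeasurePreserving (fun x => (x, n)) μ
    ((μ.prod Measure.count).restrict (copySet X n)) :=
  ⟨by fun_prop, (restrict_copySet n).symm⟩

theorem measurePreserving_fst [SigmaFinite μ] (n : ℕ) : MeasurePreserving Prod.fst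
    ((μ.prod Measure.count).restrict (copySet X n)) μ := by
  refine ⟨by fun_prop, ?_⟩
  rw [restrict_copySet, Measure.map_map (by fun_prop) (by fun_prop)]
  exact Measure.map_id

/-- The `n`-th coordinate of an element of `L^p(X × ℕ)`. -/
noncomputable def copyProj (p : ℝ≥0∞) [Fact (1 ≤ p)] (μ : Measure X) [SigmaFinite μ] (n : ℕ) :
    Lp ℂ p (μ.prod (Measure.count : Measure ℕ)) →L[ℂ] Lp ℂ p μ :=
  (Lp.compMeasurePreservingₗᵢ ℂ _ (measurePreserving_mk n)).toContinuousLinearMap ∘L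
    LpToLpRestrictCLM _ ℂ ℂ _ p (copySet X n)

/-- The embedding of `L^p(X)` as the `n`-th copy in `L^p(X × ℕ)`. -/
noncomputable def copyIncl (p : ℝ≥0∞) [Fact (1 ≤ p)] (μ : Measure X) [SigmaFinite μ] (n : ℕ) :
    Lp ℂ p μ →ₗᵢ[ℂ] Lp ℂ p (μ.prod (Measure.count : Measure ℕ)) :=
  (extendByZero p _ (measurableSet_copySet n)).comp
    (Lp.compMeasurePreservingₗᵢ ℂ _ (measurePreserving_fst n))

variable [SigmaFinite μ]

theorem copyProj_ae (n : ℕ) (ξ : Lp ℂ p (μ.prod (Measure.count : Measure ℕ))) :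
    copyProj p μ n ξ =ᵐ[μ] fun x => ξ (x, n) :=
  (Lp.coeFn_compMeasurePreserving _ (measurePreserving_mk n)).trans
    ((measurePreserving_mk n).quasiMeasurePreserving.ae (LpToLpRestrictCLM_coeFn ℂ _ ξ))

theorem copyIncl_ae (n : ℕ) (ξ : Lp ℂ p μ) :
    copyIncl p μ n ξ =ᵐ[μ.prod Measure.count] (copySet X n).indicator fun z => ξ z.1 :=
  (extendByZero_ae (measurableSet_copySet n) _).trans
    (indicator_ae_eq_of_ae_restrict (measurableSet_copySet n)
      (Lp.coeFn_compMeasurePreserving _ (measurePreserving_fst n)))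

theorem ae_mk_of_ae {P : X × ℕ → Prop} (h : ∀ᵐ z ∂(μ.prod Measure.count), P z) (n : ℕ) :
    ∀ᵐ x ∂μ, P (x, n) :=
  (measurePreserving_mk n).quasiMeasurePreserving.ae (ae_restrict_of_ae h)

theorem copyProj_copyIncl (n : ℕ) (ξ : Lp ℂ p μ) : copyProj p μ n (copyIncl p μ n ξ) = ξ := by
  refine Lp.ext ?_
  filter_upwards [copyProj_ae n (copyIncl p μ n ξ), ae_mk_of_ae (copyIncl_ae n ξ) n] with x h1 h2
  rw [h1, h2]
  exact Set.indicator_of_mem (s := copySet X n) rfl _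

theorem copyProj_copyIncl_ne {m n : ℕ} (hmn : m ≠ n) (ξ : Lp ℂ p μ) :
    copyProj p μ m (copyIncl p μ n ξ) = 0 := by
  refine Lp.ext ?_
  filter_upwards [copyProj_ae m (copyIncl p μ n ξ), ae_mk_of_ae (copyIncl_ae n ξ) m,
    Lp.coeFn_zero ℂ p μ] with x h1 h2 h3
  rw [h1, h2, h3]
  exact Set.indicator_of_notMem (s := copySet X n) hmn _

theorem norm_copyProj_apply_le (n : ℕ) (ξ : Lp ℂ p (μ.prod (Measure.count : Measure ℕ))) :
    ‖copyProj p μ n ξ‖ ≤ ‖ξ‖ :=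
  ((Lp.compMeasurePreservingₗᵢ ℂ _ (measurePreserving_mk n)).norm_map _).trans_le
    (norm_Lp_toLp_restrict_le _ ξ)

/-- The operator on `L^p(X × ℕ)` that acts as `a` from the `l`-th copy to the `k`-th copy. -/
noncomputable def matrixUnit (k l : ℕ) (a : Lp ℂ p μ →L[ℂ] Lp ℂ p μ) :
    Lp ℂ p (μ.prod (Measure.count : Measure ℕ)) →L[ℂ]
      Lp ℂ p (μ.prod (Measure.count : Measure ℕ)) :=
  (copyIncl p μ k).toContinuousLinearMap ∘L a ∘L copyProj p μ l

theorem matrixUnit_apply (k l : ℕ) (a : Lp ℂ p μ →L[ℂ] Lp ℂ p μ)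
    (ξ : Lp ℂ p (μ.prod (Measure.count : Measure ℕ))) :
    matrixUnit k l a ξ = copyIncl p μ k (a (copyProj p μ l ξ)) := rfl

theorem matrixUnit_mul (k l n : ℕ) (a b : Lp ℂ p μ →L[ℂ] Lp ℂ p μ) :
    matrixUnit k l a * matrixUnit l n b = matrixUnit k n (a * b) := by
  ext1 ξ
  simp only [mul_apply_eq_comp, matrixUnit_apply, copyProj_copyIncl]

theorem matrixUnit_mul_ne (k n : ℕ) {l m : ℕ} (h : l ≠ m) (a b : Lp ℂ p μ →L[ℂ] Lp ℂ p μ) :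
    matrixUnit k l a * matrixUnit m n b = 0 := by
  ext1 ξ
  simp only [mul_apply_eq_comp, matrixUnit_apply, copyProj_copyIncl_ne h, map_zero, zero_apply]

theorem matrixUnit_add (k l : ℕ) (a b : Lp ℂ p μ →L[ℂ] Lp ℂ p μ) :
    matrixUnit k l (a + b) = matrixUnit k l a + matrixUnit k l b := by
  ext1 ξ
  simp only [add_apply, matrixUnit_apply, map_add]

theorem matrixUnit_smul (k l : ℕ) (c : ℂ) (a : Lp ℂ p μ →L[ℂ] Lp ℂ p μ) :
    matrixUnit k l (c • a) = c • matrixUnit k l a := by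
  ext1 ξ
  simp only [smul_apply, matrixUnit_apply, map_smul]

theorem norm_matrixUnit_le (k l : ℕ) (a : Lp ℂ p μ →L[ℂ] Lp ℂ p μ) : ‖matrixUnit k l a‖ ≤ ‖a‖ := by
  refine ContinuousLinearMap.opNorm_le_bound _ (norm_nonneg _) fun ξ => ?_
  rw [matrixUnit_apply, LinearIsometry.norm_map]
  exact a.le_opNorm_of_le (norm_copyProj_apply_le l ξ)

/-- The norm of `a` is already attained on vectors supported in the `l`-th copy. -/
theorem norm_matrixUnit (k l : ℕ) (a : Lp ℂ p μ →L[ℂ] Lp ℂ p μ) : ‖matrixUnit k l a‖ = ‖a‖ := by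
  refine le_antisymm (norm_matrixUnit_le k l a) ?_
  refine ContinuousLinearMap.opNorm_le_bound _ (norm_nonneg _) fun ξ => ?_
  rw [← (copyIncl p μ k).norm_map, ← (copyIncl p μ l).norm_map ξ]
  conv_lhs => rw [← copyProj_copyIncl l ξ, ← matrixUnit_apply]
  exact ContinuousLinearMap.le_opNorm _ _

/-! ### Indicator operators and Lamperti pairs on the copies -/

theorem copyProj_indicatorCLM {A : Set (X × ℕ)} (hA : MeasurableSet A) (n : ℕ)
    (ξ : Lp ℂ p (μ.prod (Measure.count : Measure ℕ))) :
    copyProj p μ n (indicatorCLM p _ hA ξ) =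
      indicatorCLM p μ (measurable_prodMk_right (y := n) hA) (copyProj p μ n ξ) := by
  refine Lp.ext ?_
  filter_upwards [copyProj_ae n (indicatorCLM p _ hA ξ), ae_mk_of_ae (indicatorCLM_ae hA ξ) n,
    indicatorCLM_ae (measurable_prodMk_right (y := n) hA) (copyProj p μ n ξ),
    copyProj_ae n ξ] with x h1 h2 h3 h4
  rw [h1, h2, h3]
  by_cases hx : (x, n) ∈ A
  · rw [Set.indicator_of_mem hx, Set.indicator_of_mem (by exact hx), h4]
  · rw [Set.indicator_of_notMem hx, Set.indicator_of_notMem (by exact hx)]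

theorem IsIndicator.matrixUnit {T : Lp ℂ p μ →L[ℂ] Lp ℂ p μ} (hT : IsIndicator T) (n : ℕ) :
    IsIndicator (matrixUnit n n T) := by
  obtain ⟨F, hF, rfl⟩ := hT
  have hFn : MeasurableSet (Prod.fst ⁻¹' F ∩ copySet X n) :=
    (measurable_fst hF).inter (measurableSet_copySet n)
  refine ⟨_, hFn, ?_⟩
  ext1 ξ
  refine Lp.ext ?_
  have h3 := (measurePreserving_fst (μ := μ) n).quasiMeasurePreserving.ae
    ((indicatorCLM_ae hF (copyProj p μ n ξ)).and (copyProj_ae n ξ))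
  filter_upwards [copyIncl_ae n (indicatorCLM p μ hF (copyProj p μ n ξ)), indicatorCLM_ae hFn ξ,
    (ae_restrict_iff' (measurableSet_copySet n)).mp h3] with z h1 h2 h3
  rw [matrixUnit_apply, h1, h2]
  by_cases hz : z ∈ copySet X n
  · obtain ⟨h4, h5⟩ := h3 hz
    rw [Set.indicator_of_mem hz, h4]
    obtain ⟨x, m⟩ := z
    have hm : m = n := hz
    subst hm
    by_cases hx : x ∈ F
    · rw [Set.indicator_of_mem hx, Set.indicator_of_mem (by exact ⟨hx, hz⟩), h5]
    · rw [Set.indicator_of_notMem hx, Set.indicator_of_notMem fun h => hx h.1]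
  · rw [Set.indicator_of_notMem hz, Set.indicator_of_notMem fun h => hz h.2]

/-- Between matrix units only the `n`-th diagonal block of `T` matters, and that block is the
indicator operator of the `n`-th slice of the set. -/
theorem matrixUnit_mul_isIndicator_mul {T : Lp ℂ p (μ.prod (Measure.count : Measure ℕ)) →L[ℂ]
    Lp ℂ p (μ.prod (Measure.count : Measure ℕ))} (hT : IsIndicator T) (n : ℕ) :
    ∃ T' : Lp ℂ p μ →L[ℂ] Lp ℂ p μ, IsIndicator T' ∧ ∀ (k l : ℕ) (a b : Lp ℂ p μ →L[ℂ] Lp ℂ p μ),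
      matrixUnit k n a * T * matrixUnit n l b = matrixUnit k l (a * T' * b) := by
  obtain ⟨A, hA, rfl⟩ := hT
  refine ⟨_, isIndicator_indicatorCLM (measurable_prodMk_right (y := n) hA), fun k l a b => ?_⟩
  ext1 ξ
  simp only [mul_apply_eq_comp, matrixUnit_apply, copyProj_indicatorCLM, copyProj_copyIncl]

theorem IsLampertiPair.matrixUnit {s t : Lp ℂ p μ →L[ℂ] Lp ℂ p μ} (h : IsLampertiPair s t)
    (k l : ℕ) : IsLampertiPair (matrixUnit k l s) (matrixUnit l k t) where
  left := by rw [matrixUnit_mul, matrixUnit_mul, h.left]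
  right := by rw [matrixUnit_mul, matrixUnit_mul, h.right]
  norm_left := (norm_matrixUnit_le k l s).trans h.norm_left
  norm_right := (norm_matrixUnit_le l k t).trans h.norm_right
  conj_left hT := by
    obtain ⟨T', hT', hc⟩ := matrixUnit_mul_isIndicator_mul hT l
    rw [hc]
    exact (h.conj_left hT').matrixUnit k
  conj_right hT := by
    obtain ⟨T', hT', hc⟩ := matrixUnit_mul_isIndicator_mul hT k
    rw [hc]
    exact (h.conj_right hT').matrixUnit l

end Copies

/-! ### Leavitt families over the enlarged graphs -/

namespace OrientedGraph

section Families

variable {V E : Type u} {Q : OrientedGraph V E}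

/-- A system of linear maps that multiply like the matrix units with entries in `L`. -/
structure IsMatrixSystem {L B : Type*} [NonUnitalRing L] [Module ℂ L] [NonUnitalRing B]
    [Module ℂ B] (M : ℕ → ℕ → L →ₗ[ℂ] B) : Prop where
  mul (k l n : ℕ) (a b : L) : M k l a * M l n b = M k n (a * b)
  mul_ne (k n : ℕ) {l m : ℕ} (h : l ≠ m) (a b : L) : M k l a * M m n b = 0

namespace Leavitt

section Lift

variable {A : Type*} [NonUnitalRing A] [Module ℂ A] [IsScalarTower ℂ A A] [SMulCommClass ℂ A A]
  {P : V → A} {S T : E → A}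

theorem lift_vert (h : Q.IsLeavittFamily P S T) (v : V) : lift h (vert Q v) = P v :=
  freeLift_vert P S T v

theorem lift_edge (h : Q.IsLeavittFamily P S T) (e : E) : lift h (edge Q e) = S e :=
  freeLift_edge P S T e

theorem lift_ghost (h : Q.IsLeavittFamily P S T) (e : E) : lift h (ghost Q e) = T e :=
  freeLift_ghost P S T e

end Lift

theorem vert_mul_vert_ne {v w : V} (h : v ≠ w) : vert Q v * vert Q w = 0 :=
  (isLeavittFamily Q).vert_mul_ne v w h

theorem vert_mul_self (v : V) : vert Q v * vert Q v = vert Q v :=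
  (isLeavittFamily Q).vert_mul_self v

theorem vert_mul_edge {v : V} {e : E} (h : Q.s e = v) : vert Q v * edge Q e = edge Q e :=
  h ▸ (isLeavittFamily Q).source_mul_edge e

theorem ghost_mul_vert {v : V} {e : E} (h : Q.s e = v) : ghost Q e * vert Q v = ghost Q e :=
  h ▸ (isLeavittFamily Q).ghost_mul_source e

theorem edge_mul_vert (e : E) : edge Q e * vert Q (Q.r e) = edge Q e :=
  (isLeavittFamily Q).edge_mul_range e

theorem vert_mul_ghost (e : E) : vert Q (Q.r e) * ghost Q e = ghost Q e :=
  (isLeavittFamily Q).range_mul_ghost e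

theorem ghost_mul_edge (e : E) : ghost Q e * edge Q e = vert Q (Q.r e) :=
  (isLeavittFamily Q).ck1_self e

theorem ghost_mul_edge_ne {e e' : E} (h : e ≠ e') : ghost Q e * edge Q e' = 0 :=
  (isLeavittFamily Q).ck1_ne e e' h

end Leavitt

open Leavitt

/-! ### The decreasing projections along a tail -/

section Tail

variable (num : Q.EmitterNumbering)

open Classical in
/-- The projection `v - ∑_{i < n} e_i e_i*`, which corresponds to the vertex `v_n` of the tail at
`v`; the correction terms are present for infinite emitters only. -/
noncomputable def tailProj (v : V) : ℕ → Q.Leavitt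
  | 0 => vert Q v
  | 1 => vert Q v
  | n + 2 => tailProj v (n + 1) - if h : Q.IsInfiniteEmitter v then
      edge Q (num v h n).1 * ghost Q (num v h n).1 else 0

theorem tailProj_add_two {v : V} (h : Q.IsInfiniteEmitter v) (n : ℕ) :
    tailProj num v (n + 2) =
      tailProj num v (n + 1) - edge Q (num v h n).1 * ghost Q (num v h n).1 := by
  rw [tailProj, dif_pos h]

theorem tailProj_add_two_of_not {v : V} (h : ¬ Q.IsInfiniteEmitter v) (n : ℕ) :
    tailProj num v (n + 2) = tailProj num v (n + 1) := by
  rw [tailProj, dif_neg h, sub_zero]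

theorem num_ne {v : V} (h : Q.IsInfiniteEmitter v) {m n : ℕ} (hmn : m ≠ n) :
    (num v h m).1 ≠ (num v h n).1 := fun he => hmn ((num v h).injective (Subtype.ext he))

theorem vert_mul_tailProj (v : V) (n : ℕ) : vert Q v * tailProj num v n = tailProj num v n := by
  match n with
  | 0 => exact vert_mul_self v
  | 1 => exact vert_mul_self v
  | n + 2 =>
    by_cases h : Q.IsInfiniteEmitter v
    · rw [tailProj_add_two num h, mul_sub, vert_mul_tailProj v (n + 1), ← mul_assoc,
        vert_mul_edge (num v h n).2]
    · rw [tailProj_add_two_of_not num h, vert_mul_tailProj v (n + 1)]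

theorem tailProj_mul_vert (v : V) (n : ℕ) : tailProj num v n * vert Q v = tailProj num v n := by
  match n with
  | 0 => exact vert_mul_self v
  | 1 => exact vert_mul_self v
  | n + 2 =>
    by_cases h : Q.IsInfiniteEmitter v
    · rw [tailProj_add_two num h, sub_mul, tailProj_mul_vert v (n + 1), mul_assoc,
        ghost_mul_vert (num v h n).2]
    · rw [tailProj_add_two_of_not num h, tailProj_mul_vert v (n + 1)]

/-- The `(n+1)`-st projection has lost exactly the ranges of the edges with index below `n`; the
remaining edges start inside it. The shift arises because `v_0` emits only `f_1`, so nothing is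
removed before `v_2`. -/
theorem tailProj_mul_edge {v : V} (h : Q.IsInfiniteEmitter v) (n i : ℕ) :
    tailProj num v (n + 1) * edge Q (num v h i).1 =
      if i < n then 0 else edge Q (num v h i).1 := by
  induction n with
  | zero => exact vert_mul_edge (num v h i).2
  | succ n ih =>
    rw [tailProj_add_two num h, sub_mul, ih, mul_assoc]
    rcases lt_trichotomy i n with hi | rfl | hi
    · rw [if_pos hi, if_pos (by omega), ghost_mul_edge_ne (num_ne num h hi.ne'), mul_zero,
        sub_zero]
    · rw [if_neg (lt_irrefl _), if_pos (by omega), ghost_mul_edge, edge_mul_vert, sub_self]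
    · rw [if_neg (by omega), if_neg (by omega), ghost_mul_edge_ne (num_ne num h hi.ne), mul_zero,
        sub_zero]

theorem ghost_mul_tailProj {v : V} (h : Q.IsInfiniteEmitter v) (n i : ℕ) :
    ghost Q (num v h i).1 * tailProj num v (n + 1) =
      if i < n then 0 else ghost Q (num v h i).1 := by
  induction n with
  | zero => exact ghost_mul_vert (num v h i).2
  | succ n ih =>
    rw [tailProj_add_two num h, mul_sub, ih, ← mul_assoc]
    rcases lt_trichotomy i n with hi | rfl | hi
    · rw [if_pos hi, if_pos (by omega), ghost_mul_edge_ne (num_ne num h hi.ne), zero_mul,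
        sub_zero]
    · rw [if_neg (lt_irrefl _), if_pos (by omega), ghost_mul_edge, vert_mul_ghost, sub_self]
    · rw [if_neg (by omega), if_neg (by omega), ghost_mul_edge_ne (num_ne num h hi.ne'), zero_mul,
        sub_zero]

theorem tailProj_mul_edge_self {v : V} (h : Q.IsInfiniteEmitter v) (n : ℕ) :
    tailProj num v (n + 1) * edge Q (num v h n).1 = edge Q (num v h n).1 := by
  rw [tailProj_mul_edge, if_neg (lt_irrefl n)]

theorem ghost_mul_tailProj_self {v : V} (h : Q.IsInfiniteEmitter v) (n : ℕ) :
    ghost Q (num v h n).1 * tailProj num v (n + 1) = ghost Q (num v h n).1 := by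
  rw [ghost_mul_tailProj, if_neg (lt_irrefl n)]

theorem tailProj_mul_self (v : V) (n : ℕ) :
    tailProj num v n * tailProj num v n = tailProj num v n := by
  match n with
  | 0 => exact vert_mul_self v
  | 1 => exact vert_mul_self v
  | n + 2 =>
    by_cases h : Q.IsInfiniteEmitter v
    · have h1 : tailProj num v (n + 2) * edge Q (num v h n).1 = 0 := by
        rw [tailProj_mul_edge, if_pos (by omega)]
      have h2 : tailProj num v (n + 2) * tailProj num v (n + 1) = tailProj num v (n + 2) := by
        rw [tailProj_add_two num h, sub_mul, tailProj_mul_self v (n + 1), mul_assoc,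
          ghost_mul_tailProj_self]
      -- Only the right factor is expanded: the new projection absorbs the previous one and
      -- annihilates the edge just removed.
      nth_rewrite 2 [tailProj_add_two num h]
      rw [mul_sub, h2, ← mul_assoc, h1, zero_mul, sub_zero]
    · rw [tailProj_add_two_of_not num h, tailProj_mul_self v (n + 1)]

theorem tailProj_mul_succ (v : V) (n : ℕ) :
    tailProj num v n * tailProj num v (n + 1) = tailProj num v (n + 1) := by
  match n with
  | 0 => exact vert_mul_self v
  | n + 1 =>
    by_cases h : Q.IsInfiniteEmitter v
    · rw [tailProj_add_two num h, mul_sub, tailProj_mul_self, ← mul_assoc, tailProj_mul_edge_self]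
    · rw [tailProj_add_two_of_not num h, tailProj_mul_self]

theorem tailProj_succ_mul (v : V) (n : ℕ) :
    tailProj num v (n + 1) * tailProj num v n = tailProj num v (n + 1) := by
  match n with
  | 0 => exact vert_mul_self v
  | n + 1 =>
    by_cases h : Q.IsInfiniteEmitter v
    · rw [tailProj_add_two num h, sub_mul, tailProj_mul_self, mul_assoc, ghost_mul_tailProj_self]
    · rw [tailProj_add_two_of_not num h, tailProj_mul_self]

theorem tailProj_mul_ne {v w : V} (h : v ≠ w) (m n : ℕ) :
    tailProj num v m * tailProj num w n = 0 := by
  rw [← tailProj_mul_vert num v, ← vert_mul_tailProj num w, mul_assoc, ← mul_assoc (vert Q v),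
    vert_mul_vert_ne h, zero_mul, mul_zero]

theorem tailProj_mul_edge_ne {v : V} {e : E} (h : v ≠ Q.s e) (n : ℕ) :
    tailProj num v n * edge Q e = 0 := by
  rw [← tailProj_mul_vert num v, mul_assoc, vert_mul_edge_ne h, mul_zero]

theorem ghost_mul_tailProj_ne {v : V} {e : E} (h : Q.s e ≠ v) (n : ℕ) :
    ghost Q e * tailProj num v n = 0 := by
  rw [← vert_mul_tailProj num v, ← mul_assoc, ghost_mul_vert_ne h, zero_mul]

end Tail

/-! ### The Leavitt family over the desingularization -/

section Desing

variable (num : Q.EmitterNumbering) {B : Type*} [NonUnitalRing B] [Module ℂ B]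
  (M : ℕ → ℕ → Q.Leavitt →ₗ[ℂ] B)

/-- The projections of the family over the desingularization. -/
noncomputable def desingFamilyVert : Q.DesingVertex → B
  | .base v => M 0 0 (vert Q v)
  | .tail v _ n => M (n + 1) (n + 1) (tailProj num v (n + 1))

/-- The partial isometries of the family over the desingularization. -/
noncomputable def desingFamilyEdge : Q.DesingEdge → B
  | .base e _ => M 0 0 (edge Q e)
  | .tail v _ n => M n (n + 1) (tailProj num v (n + 1))
  | .exit v hv n => M (n + 1) 0 (edge Q (num v hv n).1)

/-- The reverses of the partial isometries of the family over the desingularization. -/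
noncomputable def desingFamilyGhost : Q.DesingEdge → B
  | .base e _ => M 0 0 (ghost Q e)
  | .tail v _ n => M (n + 1) n (tailProj num v (n + 1))
  | .exit v hv n => M 0 (n + 1) (ghost Q (num v hv n).1)

theorem desingFamilyVert_tailVertex (v : V) (hv : Q.IsSingular v) (n : ℕ) :
    desingFamilyVert num M (Q.tailVertex v hv n) = M n n (tailProj num v n) := by
  cases n <;> rfl

theorem desing_s_eq_base_iff {v : V} (hv : Q.IsRegular v) (e : Q.DesingEdge) :
    (Q.desing num).s e = .base v ↔ ∃ e' he', Q.s e' = v ∧ e = .base e' he' := by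
  cases e with
  | base e he => simp [desing, he]
  | tail w hw n =>
    cases n with
    | zero =>
      simp only [desing, tailVertex, DesingVertex.base.injEq, reduceCtorEq, and_false,
        exists_false, iff_false]
      rintro rfl
      exact hv hw
    | succ n => simp [desing, tailVertex]
  | exit w hw n => simp [desing, tailVertex]

theorem desing_s_eq_base_singular_iff {v : V} (hv : Q.IsSingular v) (e : Q.DesingEdge) :
    (Q.desing num).s e = .base v ↔ e = .tail v hv 0 := by
  cases e with
  | base e he =>
    simp only [desing, DesingVertex.base.injEq, reduceCtorEq, iff_false]
    rintro rfl
    exact he hv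
  | tail w hw n => cases n <;> simp [desing, tailVertex]
  | exit w hw n => simp [desing, tailVertex]

theorem desing_s_eq_tail_iff {v : V} (hv : Q.IsSingular v) (n : ℕ) (e : Q.DesingEdge) :
    (Q.desing num).s e = .tail v hv n ↔
      e = .tail v hv (n + 1) ∨ ∃ h : Q.IsInfiniteEmitter v, e = .exit v h n := by
  cases e with
  | base e he => simp [desing]
  | tail w hw m => cases m <;> simp [desing, tailVertex]
  | exit w hw m =>
    simp only [desing, tailVertex, DesingVertex.tail.injEq, reduceCtorEq, DesingEdge.exit.injEq,
      false_or]
    refine ⟨fun ⟨h1, h2⟩ => ⟨h1 ▸ hw, h1, h2⟩, fun ⟨_, h1, h2⟩ => ⟨h1, h2⟩⟩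

variable {M}

/-- Edges whose sources lie in different copies are orthogonal by the matrix indices. In the same
copy, different base vertices separate them, or distinct edges of `Q` do, or, for `f_{n+2}` against
`g_{n+1}`, the fact that the projection of `f_{n+2}` has already lost that edge. -/
theorem desing_family_ck1_ne (hM : IsMatrixSystem M) (x y : Q.DesingEdge) (hxy : x ≠ y) :
    desingFamilyGhost num M x * desingFamilyEdge num M y = 0 := by
  have hreg {e : E} {v : V} (he : Q.IsRegular (Q.s e)) (hv : Q.IsSingular v) : Q.s e ≠ v := by
    rintro rfl
    exact he hv
  cases x with
  | base e he =>
    cases y with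
    | base e' he' =>
      rw [desingFamilyGhost, desingFamilyEdge, hM.mul,
        ghost_mul_edge_ne (by simpa using hxy), map_zero]
    | tail w hw m =>
      rw [desingFamilyGhost, desingFamilyEdge]
      cases m with
      | zero => rw [hM.mul, ghost_mul_tailProj_ne num (hreg he hw), map_zero]
      | succ m => exact hM.mul_ne _ _ (by omega) _ _
    | exit w hw m => exact hM.mul_ne _ _ (by omega) _ _
  | tail v hv n =>
    cases y with
    | base e' he' =>
      rw [desingFamilyGhost, desingFamilyEdge]
      cases n with
      | zero => rw [hM.mul, tailProj_mul_edge_ne num (hreg he' hv).symm, map_zero]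
      | succ n => exact hM.mul_ne _ _ (by omega) _ _
    | tail w hw m =>
      rw [desingFamilyGhost, desingFamilyEdge]
      rcases eq_or_ne n m with rfl | h
      · rw [hM.mul, tailProj_mul_ne num (by simpa using hxy), map_zero]
      · exact hM.mul_ne _ _ h _ _
    | exit w hw m =>
      rw [desingFamilyGhost, desingFamilyEdge]
      rcases eq_or_ne n (m + 1) with rfl | h
      · rw [hM.mul]
        rcases eq_or_ne v w with rfl | h
        · rw [tailProj_mul_edge, if_pos (by omega), map_zero]
        · rw [tailProj_mul_edge_ne num (by rwa [(num w hw m).2]), map_zero]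
      · exact hM.mul_ne _ _ h _ _
  | exit v hv n =>
    cases y with
    | base e' he' => exact hM.mul_ne _ _ (by omega) _ _
    | tail w hw m =>
      rw [desingFamilyGhost, desingFamilyEdge]
      rcases eq_or_ne (n + 1) m with rfl | h
      · rw [hM.mul]
        rcases eq_or_ne v w with rfl | h
        · rw [ghost_mul_tailProj, if_pos (by omega), map_zero]
        · rw [ghost_mul_tailProj_ne num (by rwa [(num v hv n).2]), map_zero]
      · exact hM.mul_ne _ _ h _ _
    | exit w hw m =>
      rw [desingFamilyGhost, desingFamilyEdge]
      rcases eq_or_ne n m with rfl | h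
      · rw [hM.mul, ghost_mul_edge_ne, map_zero]
        intro h
        have h' := congrArg Q.s h
        rw [(num v hv n).2, (num w hw n).2] at h'
        exact hxy (by subst h'; rfl)
      · exact hM.mul_ne _ _ (by omega) _ _

theorem desing_family_ck2 (hM : IsMatrixSystem M) (x : Q.DesingVertex)
    (hx : (Q.desing num).IsRegular x) :
    desingFamilyVert num M x = ∑ e ∈ hx.finite.toFinset,
      desingFamilyEdge num M e * desingFamilyGhost num M e := by
  classical
  cases x with
  | base v =>
    by_cases hv : Q.IsSingular v
    -- A singular vertex emits only `f_1` in the new graph, and the first projection is still `v`.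
    · have h1 : hx.finite.toFinset = {.tail v hv 0} := by
        ext e
        simp [desing_s_eq_base_singular_iff num hv]
      rw [h1, Finset.sum_singleton, desingFamilyEdge, desingFamilyGhost, hM.mul,
        tailProj_mul_self]
      rfl
    · have hv : Q.IsRegular v := hv
      have hreg {e : E} (he : e ∈ hv.finite.toFinset) : Q.IsRegular (Q.s e) := by
        have he : Q.s e = v := by simpa using he
        exact he ▸ hv
      rw [desingFamilyVert, (isLeavittFamily Q).ck2 v hv, map_sum]
      refine Finset.sum_bij (fun e he => DesingEdge.base e (hreg he)) ?_ ?_ ?_ ?_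
      · intro e he
        have he : Q.s e = v := by simpa using he
        simpa [desing] using he
      · intro a _ b _ h
        simpa using h
      · intro b hb
        have hb : (Q.desing num).s b = .base v := by simpa using hb
        obtain ⟨e', he', hs, rfl⟩ := (desing_s_eq_base_iff num hv b).mp hb
        exact ⟨e', by simpa using hs, rfl⟩
      · intro e he
        exact (hM.mul 0 0 0 _ _).symm
  | tail v hv n =>
    by_cases h : Q.IsInfiniteEmitter v
    -- The recursion for the projections is precisely the relation here: what remains at this vertex
    -- splits into the next projection and the range of the departing edge.
    · have h1 : hx.finite.toFinset = {.tail v hv (n + 1), .exit v h n} := by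
        ext e
        simp [desing_s_eq_tail_iff, h]
      rw [h1, Finset.sum_pair (by simp), desingFamilyEdge, desingFamilyGhost, desingFamilyEdge,
        desingFamilyGhost, hM.mul, hM.mul, tailProj_mul_self, ← map_add, tailProj_add_two num h,
        sub_add_cancel]
      rfl
    · have h1 : hx.finite.toFinset = {.tail v hv (n + 1)} := by
        ext e
        simp [desing_s_eq_tail_iff, h]
      rw [h1, Finset.sum_singleton, desingFamilyEdge, desingFamilyGhost, hM.mul,
        tailProj_mul_self, tailProj_add_two_of_not num h]
      rfl

theorem desing_matrix_family (hM : IsMatrixSystem M) : (Q.desing num).IsLeavittFamily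
    (desingFamilyVert num M) (desingFamilyEdge num M) (desingFamilyGhost num M) where
  vert_mul_self x := by
    cases x with
    | base v => rw [desingFamilyVert, hM.mul, vert_mul_self]
    | tail v hv n => rw [desingFamilyVert, hM.mul, tailProj_mul_self]
  vert_mul_ne x y hxy := by
    cases x with
    | base v =>
      cases y with
      | base w =>
        rw [desingFamilyVert, desingFamilyVert, hM.mul, vert_mul_vert_ne (by simpa using hxy),
          map_zero]
      | tail w hw m => exact hM.mul_ne _ _ (by omega) _ _
    | tail v hv n =>
      cases y with
      | base w => exact hM.mul_ne _ _ (by omega) _ _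
      | tail w hw m =>
        rw [desingFamilyVert, desingFamilyVert]
        rcases eq_or_ne n m with rfl | h
        · rw [hM.mul, tailProj_mul_ne num (by simpa using hxy), map_zero]
        · exact hM.mul_ne _ _ (by omega) _ _
  source_mul_edge x := by
    cases x with
    | base e he =>
      simp only [desing, desingFamilyVert, desingFamilyEdge, hM.mul, vert_mul_edge]
    | tail v hv n =>
      simp only [desing, desingFamilyVert_tailVertex, desingFamilyEdge, hM.mul, tailProj_mul_succ]
    | exit v hv n =>
      simp only [desing, desingFamilyVert_tailVertex, desingFamilyEdge, hM.mul,
        tailProj_mul_edge_self]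
  edge_mul_range x := by
    cases x with
    | base e he =>
      simp only [desing, desingFamilyVert, desingFamilyEdge, hM.mul, edge_mul_vert]
    | tail v hv n =>
      simp only [desing, desingFamilyVert_tailVertex, desingFamilyEdge, hM.mul, tailProj_mul_self]
    | exit v hv n =>
      simp only [desing, desingFamilyVert, desingFamilyEdge, hM.mul, edge_mul_vert]
  range_mul_ghost x := by
    cases x with
    | base e he =>
      simp only [desing, desingFamilyVert, desingFamilyGhost, hM.mul, vert_mul_ghost]
    | tail v hv n =>
      simp only [desing, desingFamilyVert_tailVertex, desingFamilyGhost, hM.mul, tailProj_mul_self]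
    | exit v hv n =>
      simp only [desing, desingFamilyVert, desingFamilyGhost, hM.mul, vert_mul_ghost]
  ghost_mul_source x := by
    cases x with
    | base e he =>
      simp only [desing, desingFamilyVert, desingFamilyGhost, hM.mul, ghost_mul_vert]
    | tail v hv n =>
      simp only [desing, desingFamilyVert_tailVertex, desingFamilyGhost, hM.mul, tailProj_succ_mul]
    | exit v hv n =>
      simp only [desing, desingFamilyVert_tailVertex, desingFamilyGhost, hM.mul,
        ghost_mul_tailProj_self]
  ck1_self x := by
    cases x with
    | base e he =>
      simp only [desing, desingFamilyVert, desingFamilyEdge, desingFamilyGhost, hM.mul,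
        ghost_mul_edge]
    | tail v hv n =>
      simp only [desing, desingFamilyVert_tailVertex, desingFamilyEdge, desingFamilyGhost, hM.mul,
        tailProj_mul_self]
    | exit v hv n =>
      simp only [desing, desingFamilyVert, desingFamilyEdge, desingFamilyGhost, hM.mul,
        ghost_mul_edge]
  ck1_ne := desing_family_ck1_ne num hM
  ck2 := desing_family_ck2 num hM

variable [IsScalarTower ℂ B B] [SMulCommClass ℂ B B]

/-- The projections decrease, so the product along the path collapses to the last one. -/
theorem lift_tailPath (hM : IsMatrixSystem M) (v : V) (hv : Q.IsSingular v) (n : ℕ) :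
    lift (desing_matrix_family num hM) (Q.tailPath num v hv n) = M 0 n (tailProj num v n) := by
  induction n with
  | zero => exact lift_vert _ _
  | succ n ih =>
    rw [tailPath, map_mul, ih, lift_edge, desingFamilyEdge, hM.mul, tailProj_mul_succ]

theorem lift_tailGhost (hM : IsMatrixSystem M) (v : V) (hv : Q.IsSingular v) (n : ℕ) :
    lift (desing_matrix_family num hM) (Q.tailGhost num v hv n) = M n 0 (tailProj num v n) := by
  induction n with
  | zero => exact lift_vert _ _
  | succ n ih =>
    rw [tailGhost, map_mul, ih, lift_ghost, desingFamilyGhost, hM.mul, tailProj_succ_mul]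

theorem lift_desingEdge (hM : IsMatrixSystem M) (e : E) :
    lift (desing_matrix_family num hM) (Q.desingEdge num e) = M 0 0 (edge Q e) := by
  rw [desingEdge]
  split_ifs with h
  · exact lift_edge _ _
  · rw [map_mul, lift_tailPath num hM, lift_edge, desingFamilyEdge, hM.mul, tailProj_mul_edge_self,
      num_edgeIndex]

theorem lift_desingGhost (hM : IsMatrixSystem M) (e : E) :
    lift (desing_matrix_family num hM) (Q.desingGhost num e) = M 0 0 (ghost Q e) := by
  rw [desingGhost]
  split_ifs with h
  · exact lift_ghost _ _
  · rw [map_mul, lift_tailGhost num hM, lift_ghost, desingFamilyGhost, hM.mul, ghost_mul_tailProj_self,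
      num_edgeIndex]

/-- The extended family restricts to the corner `M 0 0`: each detour `f_1 ⋯ f_i g_i` ends as `e_i`
in copy `0`, since the projection at `v_i` fixes `e_i`. -/
theorem lift_toDesing (hM : IsMatrixSystem M) (a : Q.Leavitt) :
    lift (desing_matrix_family num hM) (Q.toDesing num a) = M 0 0 a := by
  induction a using Leavitt.induction_on with
  | vert v => rw [toDesing, lift_vert, lift_vert]; rfl
  | edge e => rw [toDesing, lift_edge, lift_desingEdge num hM]
  | ghost e => rw [toDesing, lift_ghost, lift_desingGhost num hM]
  | zero => simp only [map_zero]
  | add a b ha hb => rw [map_add, map_add, map_add, ha, hb]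
  | mul a b ha hb => rw [map_mul, map_mul, ha, hb, hM.mul]
  | smul c a ha => rw [map_smul, map_smul, map_smul, ha]

end Desing

/-! ### The Leavitt family over the source-free graph -/

section SourceFree

variable {B : Type*} [NonUnitalRing B] [Module ℂ B] (M : ℕ → ℕ → Q.Leavitt →ₗ[ℂ] B)

/-- The projections of the family over the source-free graph. -/
noncomputable def headFamilyVert : Q.HeadVertex → B
  | .base v => M 0 0 (vert Q v)
  | .head w _ n => M (n + 1) (n + 1) (vert Q w)

/-- The partial isometries of the family over the source-free graph. -/
noncomputable def headFamilyEdge : Q.HeadEdge → B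
  | .base e => M 0 0 (edge Q e)
  | .head w _ n => M (n + 1) n (vert Q w)

/-- The reverses of the partial isometries of the family over the source-free graph. -/
noncomputable def headFamilyGhost : Q.HeadEdge → B
  | .base e => M 0 0 (ghost Q e)
  | .head w _ n => M n (n + 1) (vert Q w)

theorem headFamilyVert_headVertex (w : V) (hw : Q.IsSource w) (n : ℕ) :
    headFamilyVert M (Q.headVertex w hw n) = M n n (vert Q w) := by
  cases n <;> rfl

theorem sourceFree_s_eq_base_iff (v : V) (e : Q.HeadEdge) :
    Q.sourceFree.s e = .base v ↔ ∃ e', Q.s e' = v ∧ e = .base e' := by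
  cases e with
  | base e => simp [sourceFree]
  | head w hw n => simp [sourceFree, headVertex]

theorem sourceFree_s_eq_head_iff {w : V} (hw : Q.IsSource w) (n : ℕ) (e : Q.HeadEdge) :
    Q.sourceFree.s e = .head w hw n ↔ e = .head w hw n := by
  cases e with
  | base e => simp [sourceFree]
  | head w hw n => simp [sourceFree, headVertex]

variable {M}

theorem sourceFree_family_ck2 (hM : IsMatrixSystem M) (x : Q.HeadVertex)
    (hx : Q.sourceFree.IsRegular x) :
    headFamilyVert M x = ∑ e ∈ hx.finite.toFinset, headFamilyEdge M e * headFamilyGhost M e := by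
  cases x with
  | base v =>
    -- Heads add no edge starting at an original vertex, so such a vertex is regular in the new
    -- graph only if it was in the old.
    have hset : {e | Q.sourceFree.s e = .base v} = HeadEdge.base '' {e | Q.s e = v} := by
      ext e
      exact (sourceFree_s_eq_base_iff v e).trans
        (exists_congr fun _ => and_congr_right fun _ => eq_comm)
    have hv : Q.IsRegular v := by
      rintro (h | h)
      · refine hx (Or.inl ?_)
        rw [IsSink, hset, Set.image_eq_empty]
        exact h
      · refine hx (Or.inr ?_)
        rw [IsInfiniteEmitter, hset]
        exact h.image fun _ _ _ _ h => by simpa using h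
    rw [headFamilyVert, (isLeavittFamily Q).ck2 v hv, map_sum]
    refine Finset.sum_bij (fun e _ => HeadEdge.base e) ?_ ?_ ?_ ?_
    · intro e he
      have he : Q.s e = v := by simpa using he
      simpa [sourceFree] using he
    · intro a _ b _ h
      simpa using h
    · intro b hb
      have hb : Q.sourceFree.s b = .base v := by simpa using hb
      obtain ⟨e', hs, rfl⟩ := (sourceFree_s_eq_base_iff v b).mp hb
      exact ⟨e', by simpa using hs, rfl⟩
    · intro e he
      exact (hM.mul 0 0 0 _ _).symm
  | head w hw n =>
    have h1 : hx.finite.toFinset = {.head w hw n} := by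
      ext e
      simp [sourceFree_s_eq_head_iff]
    rw [h1, Finset.sum_singleton, headFamilyEdge, headFamilyGhost, hM.mul, vert_mul_self]
    rfl

theorem sourceFree_matrix_family (hM : IsMatrixSystem M) : Q.sourceFree.IsLeavittFamily
    (headFamilyVert M) (headFamilyEdge M) (headFamilyGhost M) where
  vert_mul_self x := by
    cases x <;> rw [headFamilyVert, hM.mul, vert_mul_self]
  vert_mul_ne x y hxy := by
    cases x with
    | base v =>
      cases y with
      | base w =>
        rw [headFamilyVert, headFamilyVert, hM.mul, vert_mul_vert_ne (by simpa using hxy),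
          map_zero]
      | head w hw m => exact hM.mul_ne _ _ (by omega) _ _
    | head v hv n =>
      cases y with
      | base w => exact hM.mul_ne _ _ (by omega) _ _
      | head w hw m =>
        rw [headFamilyVert, headFamilyVert]
        rcases eq_or_ne n m with rfl | h
        · rw [hM.mul, vert_mul_vert_ne (by simpa using hxy), map_zero]
        · exact hM.mul_ne _ _ (by omega) _ _
  source_mul_edge x := by
    cases x with
    | base e => simp only [sourceFree, headFamilyVert, headFamilyEdge, hM.mul, vert_mul_edge]
    | head w hw n =>
      simp only [sourceFree, headFamilyVert_headVertex, headFamilyEdge, hM.mul, vert_mul_self]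
  edge_mul_range x := by
    cases x with
    | base e => simp only [sourceFree, headFamilyVert, headFamilyEdge, hM.mul, edge_mul_vert]
    | head w hw n =>
      simp only [sourceFree, headFamilyVert_headVertex, headFamilyEdge, hM.mul, vert_mul_self]
  range_mul_ghost x := by
    cases x with
    | base e => simp only [sourceFree, headFamilyVert, headFamilyGhost, hM.mul, vert_mul_ghost]
    | head w hw n =>
      simp only [sourceFree, headFamilyVert_headVertex, headFamilyGhost, hM.mul, vert_mul_self]
  ghost_mul_source x := by
    cases x with
    | base e => simp only [sourceFree, headFamilyVert, headFamilyGhost, hM.mul, ghost_mul_vert]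
    | head w hw n =>
      simp only [sourceFree, headFamilyVert_headVertex, headFamilyGhost, hM.mul, vert_mul_self]
  ck1_self x := by
    cases x with
    | base e =>
      simp only [sourceFree, headFamilyVert, headFamilyEdge, headFamilyGhost, hM.mul,
        ghost_mul_edge]
    | head w hw n =>
      simp only [sourceFree, headFamilyVert_headVertex, headFamilyEdge, headFamilyGhost, hM.mul,
        vert_mul_self]
  ck1_ne x y hxy := by
    cases x with
    | base e =>
      cases y with
      | base e' =>
        rw [headFamilyGhost, headFamilyEdge, hM.mul, ghost_mul_edge_ne (by simpa using hxy),
          map_zero]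
      | head w hw m => exact hM.mul_ne _ _ (by omega) _ _
    | head v hv n =>
      cases y with
      | base e' => exact hM.mul_ne _ _ (by omega) _ _
      | head w hw m =>
        rw [headFamilyGhost, headFamilyEdge]
        rcases eq_or_ne n m with rfl | h
        · rw [hM.mul, vert_mul_vert_ne (by simpa using hxy), map_zero]
        · exact hM.mul_ne _ _ (by omega) _ _
  ck2 := sourceFree_family_ck2 hM

variable [IsScalarTower ℂ B B] [SMulCommClass ℂ B B]

theorem lift_toSourceFree (hM : IsMatrixSystem M) (a : Q.Leavitt) :
    lift (sourceFree_matrix_family hM) (Q.toSourceFree a) = M 0 0 a := by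
  induction a using Leavitt.induction_on with
  | vert v => rw [toSourceFree, lift_vert, lift_vert]; rfl
  | edge e => rw [toSourceFree, lift_edge, lift_edge]; rfl
  | ghost e => rw [toSourceFree, lift_ghost, lift_ghost]; rfl
  | zero => simp only [map_zero]
  | add a b ha hb => rw [map_add, map_add, map_add, ha, hb]
  | mul a b ha hb => rw [map_mul, map_mul, ha, hb, hM.mul]
  | smul c a ha => rw [map_smul, map_smul, map_smul, ha]

end SourceFree

end Families

end OrientedGraph

namespace OrientedGraph

/-! ### Comparison of the spatial seminorms -/

section Comparison

variable {V E : Type u} {Q : OrientedGraph V E} {p : ℝ≥0∞} [Fact (1 ≤ p)]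

open Leavitt

/-! ### Restricting spatial representations along the canonical homomorphisms -/

section Restriction

variable {X : Type u} [MeasurableSpace X] {μ : Measure X}

theorem IsSpatialRep.comp_toSourceFree
    {ρ : Q.sourceFree.Leavitt →ₙₐ[ℂ] (Lp ℂ p μ →L[ℂ] Lp ℂ p μ)} (hρ : IsSpatialRep ρ) :
    IsSpatialRep (ρ.comp Q.toSourceFree) where
  vert v := by
    rw [NonUnitalAlgHom.comp_apply, toSourceFree, lift_vert]
    exact hρ.vert _
  edge e := by
    rw [NonUnitalAlgHom.comp_apply, NonUnitalAlgHom.comp_apply, toSourceFree, lift_edge,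
      lift_ghost]
    exact hρ.edge _

variable [SigmaFinite μ]

theorem isLampertiPair_tailPath (hp : p ≠ ∞) (num : Q.EmitterNumbering)
    {ρ : (Q.desing num).Leavitt →ₙₐ[ℂ] (Lp ℂ p μ →L[ℂ] Lp ℂ p μ)} (hρ : IsSpatialRep ρ)
    (v : V) (hv : Q.IsSingular v) (n : ℕ) :
    IsLampertiPair (ρ (Q.tailPath num v hv n)) (ρ (Q.tailGhost num v hv n)) := by
  rw [isSpatialRep_iff hp] at hρ
  induction n with
  | zero => exact .of_isIndicator (hρ.1 _)
  | succ n ih =>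
    rw [tailPath, tailGhost, map_mul, map_mul]
    exact ih.mul (hρ.2 _)

/-- Edges of infinite emitters become products along the tail; this is where closure of Lamperti
pairs under products is needed. -/
theorem IsSpatialRep.comp_toDesing (hp : p ≠ ∞) (num : Q.EmitterNumbering)
    {ρ : (Q.desing num).Leavitt →ₙₐ[ℂ] (Lp ℂ p μ →L[ℂ] Lp ℂ p μ)} (hρ : IsSpatialRep ρ) :
    IsSpatialRep (ρ.comp (Q.toDesing num)) := by
  have hρ' := (isSpatialRep_iff hp).mp hρ
  refine (isSpatialRep_iff hp).mpr ⟨fun v => ?_, fun e => ?_⟩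
  · rw [NonUnitalAlgHom.comp_apply, toDesing, lift_vert]
    exact hρ'.1 _
  · rw [NonUnitalAlgHom.comp_apply, NonUnitalAlgHom.comp_apply, toDesing, lift_edge, lift_ghost,
      desingEdge, desingGhost]
    split_ifs with h
    · exact hρ'.2 _
    · rw [map_mul, map_mul]
      exact (isLampertiPair_tailPath hp num hρ _ _ _).mul (hρ'.2 _)

end Restriction

/-! ### Extending spatial representations to countably many copies -/

section Extension

variable {X : Type u} [MeasurableSpace X] {μ : Measure X} [SigmaFinite μ]
  (ρ : Q.Leavitt →ₙₐ[ℂ] (Lp ℂ p μ →L[ℂ] Lp ℂ p μ))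

/-- The matrix units on `L^p(X × ℕ)` with entries `ρ(a)`. -/
noncomputable def repMatrix (k l : ℕ) : Q.Leavitt →ₗ[ℂ]
    (Lp ℂ p (μ.prod (Measure.count : Measure ℕ)) →L[ℂ]
      Lp ℂ p (μ.prod (Measure.count : Measure ℕ))) where
  toFun a := matrixUnit k l (ρ a)
  map_add' a b := by rw [map_add, matrixUnit_add]
  map_smul' c a := by rw [map_smul, matrixUnit_smul, RingHom.id_apply]

theorem repMatrix_apply (k l : ℕ) (a : Q.Leavitt) :
    repMatrix ρ k l a = matrixUnit k l (ρ a) := rfl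

theorem isMatrixSystem_repMatrix : IsMatrixSystem (repMatrix ρ) where
  mul k l n a b := by simp only [repMatrix_apply, matrixUnit_mul, map_mul]
  mul_ne k n _ _ h a b := matrixUnit_mul_ne k n h _ _

variable {ρ}

theorem isIndicator_tailProj (hp : p ≠ ∞) (num : Q.EmitterNumbering) (hρ : IsSpatialRep ρ)
    (v : V) (n : ℕ) : IsIndicator (ρ (tailProj num v n)) := by
  have hρ' := (isSpatialRep_iff hp).mp hρ
  match n with
  | 0 => exact hρ'.1 v
  | 1 => exact hρ'.1 v
  | n + 2 =>
    have ih := isIndicator_tailProj hp num hρ v (n + 1)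
    by_cases h : Q.IsInfiniteEmitter v
    · have h1 : tailProj num v (n + 2) = tailProj num v (n + 1) -
          tailProj num v (n + 1) * (edge Q (num v h n).1 * ghost Q (num v h n).1) := by
        rw [← mul_assoc, tailProj_mul_edge_self, tailProj_add_two]
      rw [h1, map_sub, map_mul, map_mul]
      exact ih.sub_mul (hρ'.2 _).isIndicator_left
    · rw [tailProj_add_two_of_not num h]
      exact ih

theorem isSpatialRep_lift_desing (hp : p ≠ ∞) (num : Q.EmitterNumbering) (hρ : IsSpatialRep ρ) :
    IsSpatialRep (lift (desing_matrix_family num (isMatrixSystem_repMatrix ρ))) := by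
  have hρ' := (isSpatialRep_iff hp).mp hρ
  refine (isSpatialRep_iff hp).mpr ⟨fun x => ?_, fun x => ?_⟩
  · rw [lift_vert]
    cases x with
    | base v => exact (hρ'.1 v).matrixUnit 0
    | tail v hv n => exact (isIndicator_tailProj hp num hρ v (n + 1)).matrixUnit (n + 1)
  · rw [lift_edge, lift_ghost]
    cases x with
    | base e he => exact (hρ'.2 e).matrixUnit 0 0
    | tail v hv n =>
      exact (IsLampertiPair.of_isIndicator (isIndicator_tailProj hp num hρ v (n + 1))).matrixUnit
        n (n + 1)
    | exit v hv n => exact (hρ'.2 _).matrixUnit (n + 1) 0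

theorem isSpatialRep_lift_sourceFree (hp : p ≠ ∞) (hρ : IsSpatialRep ρ) :
    IsSpatialRep (lift (sourceFree_matrix_family (isMatrixSystem_repMatrix ρ))) := by
  have hρ' := (isSpatialRep_iff hp).mp hρ
  refine (isSpatialRep_iff hp).mpr ⟨fun x => ?_, fun x => ?_⟩
  · rw [lift_vert]
    cases x with
    | base v => exact (hρ'.1 v).matrixUnit 0
    | head w hw n => exact (hρ'.1 w).matrixUnit (n + 1)
  · rw [lift_edge, lift_ghost]
    cases x with
    | base e => exact (hρ'.2 e).matrixUnit 0 0
    | head w hw n => exact (IsLampertiPair.of_isIndicator (hρ'.1 w)).matrixUnit (n + 1) n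

end Extension

/-! ### Equality of the sets of spatial seminorms -/

theorem image_spatialSeminorms_desing (hp : p ≠ ∞) (num : Q.EmitterNumbering) :
    (fun h => h ∘ Q.toDesing num) '' (Q.desing num).spatialSeminorms p =
      Q.spatialSeminorms p := by
  refine Set.Subset.antisymm ?_ ?_
  · rintro _ ⟨h, ⟨X, _, μ, _, ρ, hρ, hh⟩, rfl⟩
    exact ⟨X, _, μ, ‹_›, ρ.comp (Q.toDesing num), hρ.comp_toDesing hp num, fun a => hh _⟩
  · rintro h ⟨X, _, μ, _, ρ, hρ, hh⟩
    -- The product with counting measure on `ℕ` is again σ-finite, and the corner `M 0 0` has the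
    -- norm of `ρ a`.
    refine ⟨_, ⟨X × ℕ, inferInstance, μ.prod Measure.count, inferInstance, _,
      isSpatialRep_lift_desing hp num hρ, fun a => rfl⟩, funext fun a => ?_⟩
    change ‖lift _ (Q.toDesing num a)‖ = _
    rw [hh, lift_toDesing num (isMatrixSystem_repMatrix ρ), repMatrix_apply, norm_matrixUnit]

theorem image_spatialSeminorms_sourceFree (hp : p ≠ ∞) :
    (fun h => h ∘ Q.toSourceFree) '' Q.sourceFree.spatialSeminorms p = Q.spatialSeminorms p := by
  refine Set.Subset.antisymm ?_ ?_
  · rintro _ ⟨h, ⟨X, _, μ, _, ρ, hρ, hh⟩, rfl⟩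
    exact ⟨X, _, μ, ‹_›, ρ.comp Q.toSourceFree, hρ.comp_toSourceFree, fun a => hh _⟩
  · rintro h ⟨X, _, μ, _, ρ, hρ, hh⟩
    refine ⟨_, ⟨X × ℕ, inferInstance, μ.prod Measure.count, inferInstance, _,
      isSpatialRep_lift_sourceFree hp hρ, fun a => rfl⟩, funext fun a => ?_⟩
    change ‖lift _ (Q.toSourceFree a)‖ = _
    rw [hh, lift_toSourceFree (isMatrixSystem_repMatrix ρ), repMatrix_apply, norm_matrixUnit]

end Comparison

/-! ### Isometric homomorphisms extend to the completions -/

section Completion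

open UniformSpace

namespace AlgCompletion

variable {A B : Type*} [NonUnitalSeminormedRing A] [NonUnitalSeminormedRing B]

/-- The extension to the completions of a map. -/
noncomputable def mapFun (f : A → B) : AlgCompletion A → AlgCompletion B := Completion.map f

theorem continuous_mapFun (f : A → B) : Continuous (mapFun f) := Completion.continuous_map

theorem mapFun_of {f : A → B} (hf : Isometry f) (a : A) : mapFun f (of a) = of (f a) :=
  Completion.map_coe hf.uniformContinuous a

theorem isometry_mapFun {f : A → B} (hf : Isometry f) : Isometry (mapFun f) := hf.completion_map

/-- The extension to the completions of a norm-preserving homomorphism. -/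
noncomputable def mapHom [NormedSpace ℂ A] [NormedSpace ℂ B] (f : A →ₙₐ[ℂ] B) (hf : Isometry f) :
    AlgCompletion A →ₙₐ[ℂ] AlgCompletion B where
  toFun := mapFun f
  map_smul' c x := induction_on (P := fun x => mapFun f (c • x) = c • mapFun f x) x
    (isClosed_eq ((continuous_mapFun f).comp (continuous_const_smul c))
      ((continuous_mapFun f).const_smul c))
    fun a => by rw [← of_smul, mapFun_of hf, mapFun_of hf, map_smul, of_smul]
  map_zero' := by rw [← of_zero, mapFun_of hf, map_zero, of_zero]
  map_add' x y := induction_on₂ (P := fun x y => mapFun f (x + y) = mapFun f x + mapFun f y) x y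
    (isClosed_eq ((continuous_mapFun f).comp (continuous_fst.add continuous_snd))
      (((continuous_mapFun f).comp continuous_fst).add
        ((continuous_mapFun f).comp continuous_snd)))
    fun a b => by
      rw [← of_add, mapFun_of hf, mapFun_of hf, mapFun_of hf, map_add, of_add]
  map_mul' x y := induction_on₂ (P := fun x y => mapFun f (x * y) = mapFun f x * mapFun f y) x y
    (isClosed_eq ((continuous_mapFun f).comp (continuous_fst.mul continuous_snd))
      (((continuous_mapFun f).comp continuous_fst).mul
        ((continuous_mapFun f).comp continuous_snd)))
    fun a b => by
      rw [← of_mul, mapFun_of hf, mapFun_of hf, mapFun_of hf, map_mul, of_mul]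

end AlgCompletion

/-! ### From equal seminorm sets to isometries of the Banach algebras -/

variable {V E V' E' : Type u} {Q : OrientedGraph V E} {Q' : OrientedGraph V' E'} {p : ℝ≥0∞}
  [Fact (1 ≤ p)]

theorem spatialNorm_comp {φ : Q.Leavitt →ₙₐ[ℂ] Q'.Leavitt}
    (h : (fun h => h ∘ φ) '' Q'.spatialSeminorms p = Q.spatialSeminorms p) (a : Q.Leavitt) :
    Q'.spatialNorm p (φ a) = Q.spatialNorm p a := by
  -- Both norms are rewritten as suprema of sets of real numbers, which coincide by hypothesis.
  have h1 := sSup_image' (s := Q'.spatialSeminorms p) (f := fun h => h (φ a))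
  have h2 := sSup_image' (s := Q.spatialSeminorms p) (f := fun h => h a)
  rw [spatialNorm, spatialNorm, ← h1, ← h2, ← h, Set.image_image]
  rfl

theorem exists_isometry_op {φ : Q.Leavitt →ₙₐ[ℂ] Q'.Leavitt}
    (h : (fun h => h ∘ φ) '' Q'.spatialSeminorms p = Q.spatialSeminorms p) :
    ∃ Φ : Q.Op p →ₙₐ[ℂ] Q'.Op p, Isometry Φ ∧ ∀ a, Φ (Q.toOp p a) = Q'.toOp p (φ a) := by
  let f : Q.NormedLeavitt p →ₙₐ[ℂ] Q'.NormedLeavitt p := φ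
  have hf : Isometry f := AddMonoidHomClass.isometry_of_norm f fun a => spatialNorm_comp h a
  exact ⟨AlgCompletion.mapHom f hf, AlgCompletion.isometry_mapFun hf,
    fun a => AlgCompletion.mapFun_of hf a⟩

end Completion

end OrientedGraph

theorem mainTheorem10 {V E : Type u} [Countable V] [Countable E] (Q : OrientedGraph V E)
    (num : Q.EmitterNumbering) (p : ℝ≥0∞) [Fact (1 ≤ p)] (hp : p ≠ ∞) :
    (fun h => h ∘ Q.toDesing num) '' (Q.desing num).spatialSeminorms p = Q.spatialSeminorms p ∧
    (fun h => h ∘ Q.toSourceFree) '' Q.sourceFree.spatialSeminorms p = Q.spatialSeminorms p ∧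
    (∃ Φ : Q.Op p →ₙₐ[ℂ] (Q.desing num).Op p,
      Isometry Φ ∧ ∀ a, Φ (Q.toOp p a) = (Q.desing num).toOp p (Q.toDesing num a)) ∧
    (∃ Φ : Q.Op p →ₙₐ[ℂ] Q.sourceFree.Op p,
      Isometry Φ ∧ ∀ a, Φ (Q.toOp p a) = Q.sourceFree.toOp p (Q.toSourceFree a)) :=
  ⟨OrientedGraph.image_spatialSeminorms_desing hp num,
    OrientedGraph.image_spatialSeminorms_sourceFree hp,
    OrientedGraph.exists_isometry_op (OrientedGraph.image_spatialSeminorms_desing hp num),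
    OrientedGraph.exists_isometry_op (OrientedGraph.image_spatialSeminorms_sourceFree hp)⟩
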